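/- Let $n\ge1$ and $s\in\mathbf R$. Conventions: $\hat\varphi(\xi)=\int_{\mathbf R^n}\varphi(x)e^{-ix\cdot\xi}\,dx$ for $\varphi$ in the Schwartz space $\mathcal S=\mathcal S(\mathbf R^n)$, extended to tempered distributions by duality; $D_j=-i\partial_j$; $\delta_0$ is the unit point mass at $0$. For real $d$, a "homogeneous polynomial of degree $d$" is a polynomial with complex coefficients all of whose monomials have total degree exactly $d$; in particular it is $0$ if $d$ is not a nonnegative integer. A cutoff function is a $\chi\in C_c^\infty(\mathbf R^n)$ with $0\le\chi\le1$ and $\chi=1$ in a neighbourhood of $0$; a patch function is $\theta=1-\chi$ with $\chi$ a cutoff function. A function $u\in C^\infty(\mathbf R^n\setminus\{0\})$ (complex-valued) is homogeneous of degree $s$ if $u(\lambda x)=\lambda^su(x)$ for all $x\ne0$, $\lambda>0$. A prolongation of such a $u$ is a tempered distribution $\dot u$ on $\mathbf R^n$ which equals $u$ on $\mathbf R^n\setminus\{0\}$ and such that for every $t>0$ the distribution $\dot u(t\,\cdot)-t^s\dot u$ is of the form $P(D)\delta_0$ with $P$ a homogeneous polynomial of degree $-n-s$ (so $\dot u$ is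 homogeneous of degree $s$ if $-n-s\notin\{0,1,2,\dots\}$). Let $\mathcal H_s$ be the space of all distributions $$\dot U_s+Q_s\log|\cdot|+P_{-n-s}(D)\delta_0,$$ where $\dot U_s$ is a prolongation of some $U_s\in C^\infty(\mathbf R^n\setminus\{0\})$ homogeneous of degree $s$, and $Q_s$, $P_{-n-s}$ are homogeneous polynomials of degrees $s$ and $-n-s$, respectively. For a cutoff or patch function $\psi$ put $\psi\mathcal H_s+\mathcal S=\{\psi v+g:\ v\in\mathcal H_s,\ g\in\mathcal S\}$. (i) Let $u\in C^\infty(\mathbf R^n\setminus\{0\})$ be homogeneous of degree $s$. Then $u$ has a prolongation. Let $Q$ be the homogeneous polynomial of degree $-n-s$ which is $0$ if $-n-s\notin\{0,1,2,\dots\}$ and is given by $$Q(\xi)=\int_{\mathbf S^{n-1}}\frac{(-ix\cdot\xi)^k\,u(x)}{k!}\,dx$$ (unnormalized surface measure) if $-n-s=k\in\{0,1,2,\dots\}$. For every prolongation $\dot u$ of $u$, $$\widehat{\dot u}=U-Q\log|\cdot|,$$ where $U$ is a homogeneous distribution on $\mathbf R^n$ of degree $-n-s$ which is smooth on $\mathbf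 R^n\setminus\{0\}$; and for every patch function $\theta$ and every cutoff function $\chi$ there is $g\in\mathcal S$ with $$\widehat{\theta u}=(U-Q\log|\cdot|)\,\chi+g.$$ (ii) For every patch function $\theta$ and every cutoff function $\chi$, the Fourier transform is a bijection of $\theta\mathcal H_s+\mathcal S$ onto $\chi\mathcal H_{-n-s}+\mathcal S$. Moreover, the sets $\theta\mathcal H_s+\mathcal S$ and $\chi\mathcal H_s+\mathcal S$ do not depend on the choice of $\theta$ and $\chi$. -/

import Mathlib

open MeasureTheory SchwartzMap LineDeriv FourierTransform
open scoped ContDiff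

noncomputable section

namespace HomogDistr

/-- Euclidean space `ℝⁿ`. -/
abbrev E (n : ℕ) := EuclideanSpace ℝ (Fin n)

variable {n : ℕ}

/-! ### Functions -/

/-- `u` is a smooth function on `ℝⁿ ∖ {0}` (the value `u 0` is irrelevant). -/
def SmoothOffZero (u : E n → ℂ) : Prop := ContDiffOn ℝ ∞ u {0}ᶜ

/-- `u (λ x) = λ ^ s u x` for all `x ≠ 0` and `λ > 0`. -/
def IsHomogFun (s : ℝ) (u : E n → ℂ) : Prop :=
  ∀ x : E n, x ≠ 0 → ∀ l : ℝ, 0 < l → u (l • x) = ((l ^ s : ℝ) : ℂ) * u x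

/-- Cutoff functions: `χ ∈ C_c^∞(ℝⁿ)`, `0 ≤ χ ≤ 1`, `χ = 1` in a neighbourhood of the origin. -/
structure IsCutoff (χ : E n → ℝ) : Prop where
  smooth : ContDiff ℝ ∞ χ
  compact : HasCompactSupport χ
  nonneg : ∀ x, 0 ≤ χ x
  le_one : ∀ x, χ x ≤ 1
  eq_one : ∀ᶠ x in nhds (0 : E n), χ x = 1

/-- Patch functions: `θ = 1 - χ` with `χ` a cutoff function. -/
def IsPatch (θ : E n → ℝ) : Prop := ∃ χ : E n → ℝ, IsCutoff χ ∧ ∀ x, θ x = 1 - χ x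

/-- The value at `x ∈ ℝⁿ` of a polynomial in `n` variables with complex coefficients. -/
def polyEval (Q : MvPolynomial (Fin n) ℂ) (x : E n) : ℂ :=
  MvPolynomial.eval (fun i => (x i : ℂ)) Q

/-- `Q` is a homogeneous polynomial of degree `s`, for real `s`: every monomial occurring in `Q`
has total degree `s`.  In particular `Q = 0` if `s` is not a nonnegative integer. -/
def IsHomogPoly (s : ℝ) (Q : MvPolynomial (Fin n) ℂ) : Prop :=
  ∀ α : Fin n →₀ ℕ, Q.coeff α ≠ 0 → ((α.degree : ℕ) : ℝ) = s

/-! ### Tempered distributions given by functions -/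

/-- `f` is integrable on `ℝⁿ` against some negative power of `1 + ‖x‖`. -/
def IsTemperedFun (f : E n → ℂ) : Prop :=
  ∃ N : ℕ, Integrable (fun x : E n => (((1 + ‖x‖) ^ (-(N : ℝ)) : ℝ) : ℂ) * f x)

theorem norm_mul_schwartz_le (f : E n → ℂ) (N : ℕ) (φ : 𝓢(E n, ℂ)) (x : E n) :
    ‖f x * φ x‖ ≤ ‖(((1 + ‖x‖) ^ (-(N : ℝ)) : ℝ) : ℂ) * f x‖ *
      (2 ^ N * ((Finset.Iic ((N, 0) : ℕ × ℕ)).sup (schwartzSeminormFamily ℂ (E n) ℂ)) φ) := by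
  have h := one_add_le_sup_seminorm_apply (𝕜 := ℂ) (m := (N, 0)) (k := N) (n := 0) le_rfl le_rfl
    φ x
  simp only [norm_iteratedFDeriv_zero] at h
  have hp : (0 : ℝ) < 1 + ‖x‖ := by positivity
  have hpN : (0 : ℝ) < (1 + ‖x‖) ^ N := by positivity
  rw [norm_mul, norm_mul, Complex.norm_real, Real.norm_of_nonneg (by positivity),
    Real.rpow_neg hp.le, Real.rpow_natCast]
  calc ‖f x‖ * ‖φ x‖ = ((1 + ‖x‖) ^ N)⁻¹ * ‖f x‖ * ((1 + ‖x‖) ^ N * ‖φ x‖) := by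
        field_simp
    _ ≤ _ := by
        exact mul_le_mul_of_nonneg_left h (by positivity)

theorem IsTemperedFun.integrable_mul {f : E n → ℂ} (hf : IsTemperedFun f) (φ : 𝓢(E n, ℂ)) :
    Integrable (fun x => f x * φ x) := by
  obtain ⟨N, hN⟩ := hf
  have hm : AEStronglyMeasurable f (volume : Measure (E n)) := by
    have h1 : Continuous fun x : E n => (((1 + ‖x‖) ^ (N : ℝ) : ℝ) : ℂ) := by
      refine Complex.continuous_ofReal.comp ?_
      exact (continuous_const.add continuous_norm).rpow_const fun x => Or.inr (by positivity)
    refine (h1.aestronglyMeasurable.mul hN.aestronglyMeasurable).congr (.of_forall fun x => ?_)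
    have hp : (0 : ℝ) < 1 + ‖x‖ := by positivity
    simp only [Pi.mul_apply, ← mul_assoc, ← Complex.ofReal_mul, ← Real.rpow_add hp]
    simp
  refine (hN.norm.mul_const _).mono' (hm.mul φ.continuous.aestronglyMeasurable)
    (.of_forall fun x => norm_mul_schwartz_le f N φ x)

/-- The tempered distribution `φ ↦ ∫ f φ` given by a function `f`. -/
def ofFun (f : E n → ℂ) (hf : IsTemperedFun f) : 𝓢'(E n, ℂ) :=
  ContinuousLinearMap.toPointwiseConvergenceCLM _ _ _ _ <|
    mkCLMtoNormedSpace (𝕜 := ℂ) (fun φ : 𝓢(E n, ℂ) => ∫ x, f x * φ x)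
      (fun φ ψ => by
        simp only [add_apply, mul_add]
        exact integral_add (hf.integrable_mul φ) (hf.integrable_mul ψ))
      (fun a φ => by
        simp only [smul_apply, smul_eq_mul, RingHom.id_apply, mul_left_comm _ a]
        exact integral_const_mul a _)
      (by
        obtain ⟨N, hN⟩ := id hf
        refine ⟨Finset.Iic ((N, 0) : ℕ × ℕ),
          (∫ x : E n, ‖(((1 + ‖x‖) ^ (-(N : ℝ)) : ℝ) : ℂ) * f x‖) * 2 ^ N, ?_, fun φ => ?_⟩
        · exact mul_nonneg (integral_nonneg fun x => norm_nonneg _) (by positivity)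
        · refine (norm_integral_le_integral_norm _).trans ?_
          refine (integral_mono (hf.integrable_mul φ).norm (hN.norm.mul_const _)
            fun x => norm_mul_schwartz_le f N φ x).trans ?_
          rw [integral_mul_const, mul_assoc])

theorem ofFun_apply (f : E n → ℂ) (hf : IsTemperedFun f) (φ : 𝓢(E n, ℂ)) :
    ofFun f hf φ = ∫ x, f x * φ x := rfl

/-- The tempered distribution given by a Schwartz function. -/
def ofSchwartz (g : 𝓢(E n, ℂ)) : 𝓢'(E n, ℂ) := toTemperedDistributionCLM (E n) ℂ volume g

theorem ofSchwartz_apply (g φ : 𝓢(E n, ℂ)) : ofSchwartz g φ = ∫ x, φ x * g x := by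
  simp [ofSchwartz]

/-- The function `log ‖x‖` is tempered. -/
theorem isTemperedFun_log : IsTemperedFun (fun x : E n => (Real.log ‖x‖ : ℂ)) := by
  rcases Nat.eq_zero_or_pos n with rfl | hn
  · refine ⟨0, (integrable_zero _ _ _).congr (.of_forall fun x => ?_)⟩
    rw [Subsingleton.elim x 0]
    simp
  have : Nonempty (Fin n) := ⟨⟨0, hn⟩⟩
  have : Nontrivial (E n) := inferInstance
  refine ⟨n + 2, ?_⟩
  have hb : IntegrableOn (fun x : E n => Real.log ‖x‖) (Metric.ball 0 1) := by
    rw [integrableOn_fun_norm_addHaar volume (f := Real.log)]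
    have h1 : IntegrableOn Real.log (Set.Ioc 0 1) :=
      (intervalIntegrable_iff_integrableOn_Ioc_of_le zero_le_one).1
        intervalIntegral.intervalIntegrable_log'
    refine Integrable.mono (h1.mono_set Set.Ioo_subset_Ioc_self) ?_ ?_
    · exact ((measurable_id.pow_const _).smul Real.measurable_log).aestronglyMeasurable
    · refine (ae_restrict_mem measurableSet_Ioo).mono fun y hy => ?_
      rw [norm_smul, norm_pow, Real.norm_of_nonneg hy.1.le]
      exact mul_le_of_le_one_left (norm_nonneg _) (pow_le_one₀ hy.1.le hy.2.le)
  have hj : Integrable (fun x : E n => (1 + ‖x‖) ^ (-((n : ℝ) + 1))) :=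
    integrable_one_add_norm (by simp)
  refine (((integrable_indicator_iff measurableSet_ball).2 hb.norm).add hj).mono' ?_
    (.of_forall fun x => ?_)
  · refine Measurable.aestronglyMeasurable ?_
    fun_prop
  have hp : (0 : ℝ) < 1 + ‖x‖ := by positivity
  rw [norm_mul, Complex.norm_real, Complex.norm_real, Real.norm_of_nonneg (by positivity)]
  by_cases hx : x ∈ Metric.ball (0 : E n) 1
  · simp only [Pi.add_apply, Set.indicator_of_mem hx]
    have h1 : (1 + ‖x‖) ^ (-((n + 2 : ℕ) : ℝ)) ≤ 1 :=
      Real.rpow_le_one_of_one_le_of_nonpos (by simp) (neg_nonpos.2 (Nat.cast_nonneg _))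
    have h2 : 0 ≤ (1 + ‖x‖) ^ (-((n : ℝ) + 1)) := by positivity
    exact (mul_le_of_le_one_left (norm_nonneg _) h1).trans (le_add_of_nonneg_right h2)
  · simp only [Pi.add_apply, Set.indicator_of_notMem hx, zero_add]
    have hx1 : 1 ≤ ‖x‖ := by simpa using hx
    have h3 : ‖Real.log ‖x‖‖ ≤ 1 + ‖x‖ := by
      rw [Real.norm_of_nonneg (Real.log_nonneg hx1)]
      linarith [Real.log_le_sub_one_of_pos (zero_lt_one.trans_le hx1)]
    calc (1 + ‖x‖) ^ (-((n + 2 : ℕ) : ℝ)) * ‖Real.log ‖x‖‖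
        ≤ (1 + ‖x‖) ^ (-((n + 2 : ℕ) : ℝ)) * (1 + ‖x‖) ^ (1 : ℝ) := by
          rw [Real.rpow_one]; gcongr
      _ = (1 + ‖x‖) ^ (-((n : ℝ) + 1)) := by
          rw [← Real.rpow_add hp]; congr 1; push_cast; ring

/-- The tempered distribution `log |·|`. -/
def logDist : 𝓢'(E n, ℂ) := ofFun _ isTemperedFun_log

/-- Multiplication of a tempered distribution by a smooth real function `χ` with all derivatives
of polynomial growth. -/
def mulDist (χ : E n → ℝ) (T : 𝓢'(E n, ℂ)) : 𝓢'(E n, ℂ) :=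
  TemperedDistribution.smulLeftCLM ℂ (fun x => (χ x : ℂ)) T

/-- The tempered distribution `Q log |·|` for a polynomial `Q`. -/
def polyLog (Q : MvPolynomial (Fin n) ℂ) : 𝓢'(E n, ℂ) :=
  TemperedDistribution.smulLeftCLM ℂ (polyEval Q) logDist

/-! ### Constant coefficient differential operators, dilations, Fourier transform -/

/-- `D_j = -i ∂_j` on tempered distributions. -/
def dOp (j : Fin n) (T : 𝓢'(E n, ℂ)) : 𝓢'(E n, ℂ) :=
  (-Complex.I) • ∂_{(EuclideanSpace.single j (1 : ℝ) : E n)} T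

/-- `D^α = D_1^{α_1} ⋯ D_n^{α_n}` on tempered distributions. -/
def dPow (α : Fin n →₀ ℕ) (T : 𝓢'(E n, ℂ)) : 𝓢'(E n, ℂ) :=
  (List.finRange n).foldr (fun j S => (dOp j)^[α j] S) T

/-- `P(D) δ₀ = ∑_α P_α D^α δ₀`. -/
def polyDelta (P : MvPolynomial (Fin n) ℂ) : 𝓢'(E n, ℂ) :=
  ∑ α ∈ P.support, P.coeff α • dPow α (TemperedDistribution.delta (0 : E n))

/-- `φ ↦ φ(t ·)` on Schwartz functions, for `t ≠ 0`. -/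
def dilS (t : ℝ) (ht : t ≠ 0) : 𝓢(E n, ℂ) →L[ℂ] 𝓢(E n, ℂ) :=
  compCLMOfContinuousLinearEquiv ℂ (ContinuousLinearEquiv.smulLeft (Units.mk0 t ht))

theorem dilS_apply (t : ℝ) (ht : t ≠ 0) (φ : 𝓢(E n, ℂ)) (x : E n) :
    dilS t ht φ x = φ (t • x) := rfl

/-- `T ↦ T(t ·)` on tempered distributions, for `t > 0`:
`⟨T(t ·), φ⟩ = t⁻ⁿ ⟨T, φ(t⁻¹ ·)⟩`. -/
def dil (t : ℝ) (ht : 0 < t) (T : 𝓢'(E n, ℂ)) : 𝓢'(E n, ℂ) :=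
  ((t ^ n : ℝ) : ℂ)⁻¹ • PointwiseConvergenceCLM.precomp ℂ (dilS t⁻¹ (inv_ne_zero ht.ne')) T

theorem dil_apply (t : ℝ) (ht : 0 < t) (T : 𝓢'(E n, ℂ)) (φ : 𝓢(E n, ℂ)) :
    dil t ht T φ = ((t ^ n : ℝ) : ℂ)⁻¹ * T (dilS t⁻¹ (inv_ne_zero ht.ne') φ) := rfl

/-- The Fourier transform `φ̂(ξ) = ∫ φ(x) exp(-i x·ξ) dx` on Schwartz functions. -/
def fourierS : 𝓢(E n, ℂ) →L[ℂ] 𝓢(E n, ℂ) :=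
  (dilS (2 * Real.pi)⁻¹ (by positivity)).comp (fourierCLM ℂ 𝓢(E n, ℂ))

theorem fourierS_apply (φ : 𝓢(E n, ℂ)) (ξ : E n) :
    fourierS φ ξ = ∫ x, φ x * Complex.exp (-Complex.I * (inner ℝ x ξ : ℝ)) := by
  have : fourierS φ ξ = 𝓕 (φ : E n → ℂ) ((2 * Real.pi)⁻¹ • ξ) := rfl
  rw [this, Real.fourier_eq']
  refine integral_congr_ae (.of_forall fun x => ?_)
  simp only [smul_eq_mul, inner_smul_right]
  rw [mul_comm]
  congr 2
  have : (Real.pi : ℂ) ≠ 0 := by exact_mod_cast Real.pi_ne_zero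
  push_cast
  field_simp

/-- The Fourier transform on tempered distributions, `⟨T̂, φ⟩ = ⟨T, φ̂⟩`. -/
def fourierD (T : 𝓢'(E n, ℂ)) : 𝓢'(E n, ℂ) := PointwiseConvergenceCLM.precomp ℂ fourierS T

theorem fourierD_apply (T : 𝓢'(E n, ℂ)) (φ : 𝓢(E n, ℂ)) : fourierD T φ = T (fourierS φ) := rfl

/-! ### Homogeneous distributions -/

/-- The restriction of the tempered distribution `T` to `ℝⁿ ∖ {0}` is the function `u`. -/
def AgreesOffZero (T : 𝓢'(E n, ℂ)) (u : E n → ℂ) : Prop :=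
  ∀ φ : 𝓢(E n, ℂ), HasCompactSupport φ → (0 : E n) ∉ tsupport φ → T φ = ∫ x, u x * φ x

/-- `T` is a homogeneous distribution on `ℝⁿ` of degree `s`. -/
def IsHomogDist (s : ℝ) (T : 𝓢'(E n, ℂ)) : Prop :=
  ∀ (t : ℝ) (ht : 0 < t), dil t ht T = ((t ^ s : ℝ) : ℂ) • T

/-- `T` is a prolongation to `ℝⁿ` of the function `u` on `ℝⁿ ∖ {0}`, homogeneous of degree `s`.
Its homogeneity on `ℝⁿ` may fail only by terms `P(D) δ₀` with `P` a homogeneous polynomial of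
degree `-n-s`: so `T` is homogeneous if `-n-s` is not a nonnegative integer, while for
`s = -n-k` logarithmic terms `t ^ s log t P(D) δ₀` may appear in `T(t ·) - t ^ s T`. -/
structure IsProlongation (s : ℝ) (u : E n → ℂ) (T : 𝓢'(E n, ℂ)) : Prop where
  agrees : AgreesOffZero T u
  homog : ∀ (t : ℝ) (ht : 0 < t), ∃ P : MvPolynomial (Fin n) ℂ,
    IsHomogPoly (-(n : ℝ) - s) P ∧ dil t ht T - ((t ^ s : ℝ) : ℂ) • T = polyDelta P

/-- The space `ℋ_s` of all distributions `U̇ + Q log |·| + P(D) δ₀` where `U̇` is a prolongation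
of a function `U ∈ C^∞(ℝⁿ ∖ {0})` homogeneous of degree `s`, and `Q`, `P` are homogeneous
polynomials of degrees `s` and `-n-s`, respectively. -/
def homogSpace (n : ℕ) (s : ℝ) : Set 𝓢'(E n, ℂ) :=
  {T | ∃ (U : E n → ℂ) (V : 𝓢'(E n, ℂ)) (Q P : MvPolynomial (Fin n) ℂ),
    SmoothOffZero U ∧ IsHomogFun s U ∧ IsProlongation s U V ∧
    IsHomogPoly s Q ∧ IsHomogPoly (-(n : ℝ) - s) P ∧ T = V + polyLog Q + polyDelta P}

/-- `χ ℋ_s + 𝒮 = {χ u + g : u ∈ ℋ_s, g ∈ 𝒮}`. -/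
def mulHomogSpace (n : ℕ) (χ : E n → ℝ) (s : ℝ) : Set 𝓢'(E n, ℂ) :=
  {T | ∃ u ∈ homogSpace n s, ∃ g : 𝓢(E n, ℂ), T = mulDist χ u + ofSchwartz g}

/-- `∫_{S^{n-1}} (-i x·ξ)^k u(x) / k! dx` with respect to the surface measure. -/
def sphereInt (k : ℕ) (u : E n → ℂ) (ξ : E n) : ℂ :=
  ∫ x : Metric.sphere (0 : E n) 1,
    (-Complex.I * (inner ℝ (x : E n) ξ : ℝ)) ^ k * u x / (k.factorial : ℂ)
    ∂(volume : Measure (E n)).toSphere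

end HomogDistr

end

open HomogDistr

/-!
The space `ℋ_s` consists of the distributions `T`, smooth on `ℝⁿ ∖ {0}`, with
`T(t ·) = t ^ s (T + log t S)` for all `t > 0`, where `S` is the sum of a homogeneous polynomial of
degree `s` and of `P(D) δ₀` with `P` homogeneous of degree `-n - s`. The Fourier transform exchanges
the two kinds of `S` and the degrees `s` and `-n - s`, so it maps `ℋ_s` to `ℋ_{-n-s}` as soon as it
preserves smoothness off the origin; its fourth power is a nonzero multiple of the identity, which
makes the map bijective.

Smoothness of `T̂` off the origin: split `T = θ T + χ T`. The function `θ T` is a symbol, so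
applying a high power of `-Δ` makes it integrable together with many moments, and `(θ T)^` is a
Schwartz function away from `0`. The distribution `χ T` has compact support; the localizations of
its Fourier transform are `L²` functions by the Riesz representation theorem, and so are all their
derivatives, hence they are test functions. Modulo `𝒮`, therefore, `(θ T)^` is `χ T̂`.

Prolongations: for `s > -n`, `u` is locally integrable. For `s < -n`, Euler's relation
`∑ⱼ ∂ⱼ (xⱼ u) = (n + s) u` reduces `s` to `s + 1`. For `s = -n` it fails to determine `u`, and one
uses `u = ∑ⱼ ∂ⱼ (xⱼ u log |x|)` instead; the logarithm produces the multiple of `δ₀` that is carried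
along to the moments `Q` in the lower degrees.
-/

noncomputable section

namespace HomogDistr

variable {n : ℕ}

/-! ### Multipliers -/

/-- Multiplication of a Schwartz function by a function `g` of temperate growth (`0` if `g` is not
of temperate growth). -/
abbrev mulS (g : E n → ℂ) : 𝓢(E n, ℂ) →L[ℂ] 𝓢(E n, ℂ) := SchwartzMap.smulLeftCLM ℂ g

theorem mulS_apply {g : E n → ℂ} (hg : g.HasTemperateGrowth) (φ : 𝓢(E n, ℂ)) (x : E n) :
    mulS g φ x = g x * φ x := by
  simp [smulLeftCLM_apply_apply hg]

theorem coe_mulS {g : E n → ℂ} (hg : g.HasTemperateGrowth) (φ : 𝓢(E n, ℂ)) :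
    (mulS g φ : E n → ℂ) = fun x => g x * φ x := funext (mulS_apply hg φ)

theorem hasTemperateGrowth_coord (j : Fin n) :
    (fun x : E n => (x j : ℂ)).HasTemperateGrowth :=
  (Complex.ofRealCLM.comp (EuclideanSpace.proj (𝕜 := ℝ) j : E n →L[ℝ] ℝ)).hasTemperateGrowth

theorem hasTemperateGrowth_polyEval (Q : MvPolynomial (Fin n) ℂ) :
    (polyEval Q).HasTemperateGrowth := by
  induction Q using MvPolynomial.induction_on with
  | C a =>
    convert Function.HasTemperateGrowth.const (E := E n) a
    simp [polyEval]
  | add p q hp hq =>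
    have h : polyEval (p + q) = polyEval p + polyEval q := by ext; simp [polyEval]
    exact h ▸ hp.add hq
  | mul_X p i hp =>
    have h : polyEval (p * MvPolynomial.X i) = polyEval p * fun x => (x i : ℂ) := by
      ext; simp [polyEval]
    exact h ▸ hp.mul (hasTemperateGrowth_coord i)

/-- Real-valued test functions; `mulDist` multiplies distributions by real-valued functions. -/
structure IsTestFun (ρ : E n → ℝ) : Prop where
  smooth : ContDiff ℝ ∞ ρ
  compact : HasCompactSupport ρ

theorem IsTestFun.ofReal_smooth {ρ : E n → ℝ} (hρ : IsTestFun ρ) :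
    ContDiff ℝ ∞ (fun x => (ρ x : ℂ)) :=
  Complex.ofRealCLM.contDiff.comp hρ.smooth

theorem IsTestFun.ofReal_compact {ρ : E n → ℝ} (hρ : IsTestFun ρ) :
    HasCompactSupport (fun x => (ρ x : ℂ)) :=
  hρ.compact.comp_left (g := Complex.ofReal) Complex.ofReal_zero

theorem IsTestFun.hasTemperateGrowth {ρ : E n → ℝ} (hρ : IsTestFun ρ) :
    (fun x => (ρ x : ℂ)).HasTemperateGrowth :=
  hρ.ofReal_compact.hasTemperateGrowth hρ.ofReal_smooth

theorem IsCutoff.isTestFun {χ : E n → ℝ} (hχ : IsCutoff χ) : IsTestFun χ :=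
  ⟨hχ.smooth, hχ.compact⟩

theorem IsCutoff.hasTemperateGrowth {χ : E n → ℝ} (hχ : IsCutoff χ) :
    (fun x => (χ x : ℂ)).HasTemperateGrowth :=
  hχ.isTestFun.hasTemperateGrowth

theorem IsCutoff.isPatch {χ : E n → ℝ} (hχ : IsCutoff χ) : IsPatch fun x => 1 - χ x :=
  ⟨χ, hχ, fun _ => rfl⟩

theorem IsPatch.hasTemperateGrowth {θ : E n → ℝ} (hθ : IsPatch θ) :
    (fun x => (θ x : ℂ)).HasTemperateGrowth := by
  obtain ⟨χ, hχ, h⟩ := hθ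
  simpa [h, Pi.sub_def] using (Function.HasTemperateGrowth.const 1).sub hχ.hasTemperateGrowth

theorem IsPatch.eventually_eq_zero {θ : E n → ℝ} (hθ : IsPatch θ) :
    ∀ᶠ x in nhds (0 : E n), θ x = 0 := by
  obtain ⟨χ, hχ, h⟩ := hθ
  filter_upwards [hχ.eq_one] with x hx
  rw [h, hx, sub_self]

theorem mulDist_apply (χ : E n → ℝ) (T : 𝓢'(E n, ℂ)) (φ : 𝓢(E n, ℂ)) :
    mulDist χ T φ = T (mulS (fun x => (χ x : ℂ)) φ) := rfl

theorem isLinearMap_mulDist (χ : E n → ℝ) : IsLinearMap ℂ (mulDist χ) where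
  map_add := map_add (TemperedDistribution.smulLeftCLM ℂ fun x => (χ x : ℂ))
  map_smul := map_smul (TemperedDistribution.smulLeftCLM ℂ fun x => (χ x : ℂ))

/-! ### Dilations -/

theorem isLinearMap_dil (t : ℝ) (ht : 0 < t) : IsLinearMap ℂ (dil (n := n) t ht) where
  map_add S T := by ext φ; simp [dil_apply, mul_add]
  map_smul c T := by ext φ; simp [dil_apply, mul_left_comm]

theorem integral_comp_smul_of_pos {F : Type*} [NormedAddCommGroup F] [NormedSpace ℝ F]
    (f : E n → F) {t : ℝ} (ht : 0 < t) : ∫ x, f (t • x) = (t ^ n)⁻¹ • ∫ x, f x := by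
  rw [Measure.integral_comp_smul]
  simp [abs_of_pos ht]

theorem integral_mul_dilS (f : E n → ℂ) {t : ℝ} (ht : 0 < t) (φ : 𝓢(E n, ℂ)) :
    ((t ^ n : ℝ) : ℂ)⁻¹ * ∫ x, f x * dilS t⁻¹ (inv_ne_zero ht.ne') φ x =
      ∫ x, f (t • x) * φ x := by
  have h := integral_comp_smul_of_pos (fun x => f x * dilS t⁻¹ (inv_ne_zero ht.ne') φ x) ht
  rw [Complex.real_smul, Complex.ofReal_inv] at h
  rw [← h]
  simp only [dilS_apply, inv_smul_smul₀ ht.ne']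

theorem dilS_dilS (a b : ℝ) (ha : a ≠ 0) (hb : b ≠ 0) (φ : 𝓢(E n, ℂ)) :
    dilS a ha (dilS b hb φ) = dilS (b * a) (mul_ne_zero hb ha) φ := by
  ext x; simp [dilS_apply, smul_smul]

theorem rpow_neg_sub_eq {t : ℝ} (ht : 0 < t) (s : ℝ) :
    ((t ^ (-(n : ℝ) - s) : ℝ) : ℂ) = ((t ^ n : ℝ) : ℂ)⁻¹ * ((t⁻¹ ^ s : ℝ) : ℂ) := by
  rw [Real.inv_rpow ht.le, ← Real.rpow_neg ht.le, ← Complex.ofReal_inv, ← Real.rpow_natCast,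
    ← Real.rpow_neg ht.le, ← Complex.ofReal_mul, ← Real.rpow_add ht, sub_eq_add_neg]

/-! ### The Fourier transform -/

theorem isLinearMap_fourierD : IsLinearMap ℂ (fourierD (n := n)) where
  map_add _ _ := rfl
  map_smul _ _ := rfl

theorem fourierS_eq (φ : 𝓢(E n, ℂ)) (ξ : E n) :
    fourierS φ ξ = 𝓕 φ ((2 * Real.pi)⁻¹ • ξ) := rfl

theorem fourierS_dilS (t : ℝ) (ht : 0 < t) (φ : 𝓢(E n, ℂ)) :
    fourierS (dilS t ht.ne' φ) =
      ((t ^ n : ℝ) : ℂ)⁻¹ • dilS t⁻¹ (inv_ne_zero ht.ne') (fourierS φ) := by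
  ext ξ
  rw [smul_apply, dilS_apply, fourierS_apply, fourierS_apply]
  have h := integral_comp_smul_of_pos
    (fun x => φ x * Complex.exp (-Complex.I * (inner ℝ x (t⁻¹ • ξ) : ℝ))) ht
  rw [Complex.real_smul, Complex.ofReal_inv] at h
  rw [smul_eq_mul, ← h]
  simp [dilS_apply, inner_smul_left, inner_smul_right, ht.ne']

theorem fourierS_fourierS (φ : 𝓢(E n, ℂ)) :
    fourierS (fourierS φ) =
      (((2 * Real.pi) ^ n : ℝ) : ℂ) • dilS (-1) (by norm_num) φ := by
  have hpi : 0 < (2 * Real.pi)⁻¹ := by positivity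
  have hS : fourierS φ = dilS (2 * Real.pi)⁻¹ hpi.ne' (𝓕 φ) := rfl
  have hinv (ξ : E n) : 𝓕 (𝓕 φ) ξ = φ (-ξ) := by
    have h : (𝓕⁻ (𝓕 φ) : 𝓢(E n, ℂ)) (-ξ) = φ (-ξ) := by simp
    rw [SchwartzMap.fourierInv_apply_eq] at h
    simpa using h
  rw [hS, fourierS_dilS _ hpi]
  ext ξ
  simp only [smul_apply, dilS_apply, fourierS_eq, hinv, inv_inv, inv_pow, neg_one_smul,
    Complex.ofReal_inv, inv_smul_smul₀ (by positivity : 2 * Real.pi ≠ 0)]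

theorem fourierD_fourierD_apply (T : 𝓢'(E n, ℂ)) (φ : 𝓢(E n, ℂ)) :
    fourierD (fourierD T) φ =
      (((2 * Real.pi) ^ n : ℝ) : ℂ) * T (dilS (-1) (by norm_num) φ) := by
  rw [fourierD_apply, fourierD_apply, fourierS_fourierS, map_smul, smul_eq_mul]

theorem fourierD_four (T : 𝓢'(E n, ℂ)) :
    fourierD (fourierD (fourierD (fourierD T))) =
      ((((2 * Real.pi) ^ n : ℝ) : ℂ) ^ 2) • T := by
  ext φ
  have hφ : dilS 1 one_ne_zero φ = φ := by ext x; simp [dilS_apply]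
  simp [fourierD_fourierD_apply, dilS_dilS, hφ, sq, mul_assoc]

theorem two_pi_pow_ne_zero : (((2 * Real.pi) ^ n : ℝ) : ℂ) ≠ 0 := by
  exact_mod_cast (by positivity : (2 * Real.pi) ^ n ≠ 0)

theorem fourierD_injective : Function.Injective (fourierD (n := n)) := by
  intro S T h
  have h4 := fourierD_four S
  rw [h, fourierD_four] at h4
  exact (smul_right_injective _ (pow_ne_zero 2 two_pi_pow_ne_zero) h4).symm

theorem fourierD_surjective : Function.Surjective (fourierD (n := n)) := fun T =>
  ⟨((((2 * Real.pi) ^ n : ℝ) : ℂ) ^ 2)⁻¹ • fourierD (fourierD (fourierD T)), by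
    rw [isLinearMap_fourierD.map_smul, fourierD_four,
      inv_smul_smul₀ (pow_ne_zero 2 two_pi_pow_ne_zero)]⟩

theorem fourierS_eq_smul_fourier_dilS (g : 𝓢(E n, ℂ)) :
    fourierS g = (((2 * Real.pi) ^ n : ℝ) : ℂ) • 𝓕 (dilS (2 * Real.pi) (by positivity) g) := by
  have h : (𝓕 (dilS (2 * Real.pi) (by positivity) g) : 𝓢(E n, ℂ)) =
      dilS (2 * Real.pi) (by positivity) (fourierS (dilS (2 * Real.pi) (by positivity) g)) := by
    ext ξ
    rw [dilS_apply, fourierS_eq, inv_smul_smul₀ (by positivity)]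
  rw [h, fourierS_dilS _ (by positivity), map_smul, dilS_dilS, smul_smul,
    mul_inv_cancel₀ two_pi_pow_ne_zero, one_smul]
  ext x
  rw [dilS_apply, inv_mul_cancel₀ (by positivity), one_smul]

/-- The Fourier transform `∫ f(x) exp(-i x·ξ) dx` of an integrable function. -/
def fourierFun (f : E n → ℂ) (ξ : E n) : ℂ := 𝓕 f ((2 * Real.pi)⁻¹ • ξ)

theorem coe_fourierS (φ : 𝓢(E n, ℂ)) : (fourierS φ : E n → ℂ) = fourierFun φ := rfl

theorem integral_fourierFun_mul {f : E n → ℂ} (hf : Integrable f) (g : 𝓢(E n, ℂ)) :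
    ∫ x, fourierFun f x * g x = ∫ x, f x * fourierS g x := by
  have hpi : 0 < (2 * Real.pi)⁻¹ := by positivity
  have h := integral_comp_smul_of_pos
    (fun x => 𝓕 f x * (dilS (2 * Real.pi) (by positivity) g) x) hpi
  have hflip : ∫ x, 𝓕 f x * (dilS (2 * Real.pi) (by positivity) g) x =
      ∫ x, f x * (𝓕 (dilS (2 * Real.pi) (by positivity) g) : 𝓢(E n, ℂ)) x := by
    have h := VectorFourier.integral_fourierIntegral_smul_eq_flip (L := innerₗ (E n))
      Real.continuous_fourierChar continuous_inner hf
      ((dilS (2 * Real.pi) (by positivity) g).integrable (μ := volume))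
    rwa [flip_innerₗ] at h
  rw [hflip, inv_pow, inv_inv, Complex.real_smul, ← integral_const_mul] at h
  simp only [dilS_apply, smul_inv_smul₀ (by positivity : 2 * Real.pi ≠ 0)] at h
  refine h.trans (integral_congr_ae (.of_forall fun x => ?_))
  simp only [fourierS_eq_smul_fourier_dilS g, smul_apply, smul_eq_mul, mul_left_comm]

theorem fourierD_ofSchwartz (g : 𝓢(E n, ℂ)) :
    fourierD (ofSchwartz g) = ofSchwartz (fourierS g) := by
  ext φ
  rw [fourierD_apply, ofSchwartz_apply, ofSchwartz_apply, coe_fourierS,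
    integral_fourierFun_mul φ.integrable]

theorem dil_fourierD (t : ℝ) (ht : 0 < t) (T : 𝓢'(E n, ℂ)) :
    dil t ht (fourierD T) = ((t ^ n : ℝ) : ℂ)⁻¹ • fourierD (dil t⁻¹ (inv_pos.2 ht) T) := by
  ext φ
  rw [smul_apply, dil_apply, fourierD_apply, fourierD_apply, dil_apply,
    fourierS_dilS t⁻¹ (inv_pos.2 ht) φ, map_smul, smul_eq_mul]
  rfl

/-! ### Derivatives -/

theorem dOp_apply (j : Fin n) (T : 𝓢'(E n, ℂ)) (φ : 𝓢(E n, ℂ)) :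
    dOp j T φ = Complex.I * T (∂_{(EuclideanSpace.single j (1 : ℝ) : E n)} φ) := by
  simp [dOp, TemperedDistribution.lineDerivOp_apply_apply]

theorem lineDerivOp_fourierS (j : Fin n) (φ : 𝓢(E n, ℂ)) :
    ∂_{(EuclideanSpace.single j (1 : ℝ) : E n)} (fourierS φ) =
      (-Complex.I) • fourierS (mulS (fun x => (x j : ℂ)) φ) := by
  ext ξ
  have hchain : ∂_{(EuclideanSpace.single j (1 : ℝ) : E n)} (fourierS φ) ξ =
      (2 * Real.pi : ℂ)⁻¹ * (∂_{(EuclideanSpace.single j (1 : ℝ) : E n)} (𝓕 φ))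
        ((2 * Real.pi)⁻¹ • ξ) := by
    have h : (fourierS φ : E n → ℂ) = fun x => (𝓕 φ : 𝓢(E n, ℂ)) ((2 * Real.pi)⁻¹ • x) := rfl
    rw [lineDerivOp_apply_eq_fderiv, lineDerivOp_apply_eq_fderiv, h, fderiv_comp_smul]
    simp
  have hmul : smulLeftCLM ℂ (fun x : E n => inner ℝ x (EuclideanSpace.single j (1 : ℝ))) φ =
      mulS (fun x => (x j : ℂ)) φ := by
    ext x
    rw [mulS_apply (hasTemperateGrowth_coord j), smulLeftCLM_apply_apply (by fun_prop)]
    simp [EuclideanSpace.inner_single_right]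
  have hpi : (Real.pi : ℂ) ≠ 0 := by exact_mod_cast Real.pi_ne_zero
  rw [hchain, SchwartzMap.lineDerivOp_fourier_eq, hmul, smul_apply, fourierS_eq,
    FourierTransform.fourier_smul, smul_apply]
  simp only [smul_eq_mul]
  field_simp

theorem fourierD_dOp (j : Fin n) (T : 𝓢'(E n, ℂ)) (φ : 𝓢(E n, ℂ)) :
    fourierD (dOp j T) φ = fourierD T (mulS (fun x => (x j : ℂ)) φ) := by
  rw [fourierD_apply, dOp_apply, lineDerivOp_fourierS, map_smul, fourierD_apply, smul_eq_mul,
    ← mul_assoc]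
  simp

/-! ### Polynomials and their Fourier transforms -/

theorem integrable_polyEval_mul (Q : MvPolynomial (Fin n) ℂ) (φ : 𝓢(E n, ℂ)) :
    Integrable (fun x => polyEval Q x * φ x) := by
  simpa [coe_mulS (hasTemperateGrowth_polyEval Q)] using (mulS (polyEval Q) φ).integrable

/-- The tempered distribution given by the polynomial `Q`. -/
def polyDist (Q : MvPolynomial (Fin n) ℂ) : 𝓢'(E n, ℂ) :=
  (hasTemperateGrowth_polyEval Q).toTemperedDistribution

theorem polyDist_apply (Q : MvPolynomial (Fin n) ℂ) (φ : 𝓢(E n, ℂ)) :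
    polyDist Q φ = ∫ x, polyEval Q x * φ x := by
  simp [polyDist, Function.HasTemperateGrowth.toTemperedDistribution_apply, mul_comm]

theorem isLinearMap_polyDist : IsLinearMap ℂ (polyDist (n := n)) where
  map_add P Q := by
    ext φ
    simp only [add_apply, polyDist_apply]
    rw [← integral_add (integrable_polyEval_mul _ _) (integrable_polyEval_mul _ _)]
    simp [polyEval, add_mul]
  map_smul c P := by
    ext φ
    simp [polyDist_apply, polyEval, mul_assoc, integral_const_mul]

theorem fourierD_delta : fourierD (TemperedDistribution.delta (0 : E n)) = polyDist 1 := by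
  ext φ
  simp [fourierD_apply, fourierS_apply, polyDist_apply, polyEval]

theorem fourierD_dOp_of_eq_polyDist {T : 𝓢'(E n, ℂ)} {Q : MvPolynomial (Fin n) ℂ}
    (hT : fourierD T = polyDist Q) (j : Fin n) :
    fourierD (dOp j T) = polyDist (MvPolynomial.X j * Q) := by
  ext φ
  simp [fourierD_dOp, hT, polyDist_apply, mulS_apply (hasTemperateGrowth_coord j), polyEval,
    mul_assoc, mul_left_comm]

theorem fourierD_dPow_delta (α : Fin n →₀ ℕ) :
    fourierD (dPow α (TemperedDistribution.delta (0 : E n))) =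
      polyDist (MvPolynomial.monomial α 1) := by
  have hiter (j : Fin n) (m : ℕ) {T : 𝓢'(E n, ℂ)} {Q : MvPolynomial (Fin n) ℂ}
      (hT : fourierD T = polyDist Q) :
      fourierD ((dOp j)^[m] T) = polyDist (MvPolynomial.X j ^ m * Q) := by
    induction m with
    | zero => simpa using hT
    | succ m ih =>
      rw [Function.iterate_succ_apply', fourierD_dOp_of_eq_polyDist ih, pow_succ', mul_assoc]
  have hlist (l : List (Fin n)) :
      fourierD (l.foldr (fun j S => (dOp j)^[α j] S) (TemperedDistribution.delta (0 : E n))) =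
        polyDist (l.map fun i => MvPolynomial.X i ^ α i).prod := by
    induction l with
    | nil => exact fourierD_delta
    | cons j l ih => simpa using hiter j (α j) ih
  rw [dPow, hlist, ← List.ofFn_eq_map, List.prod_ofFn, MvPolynomial.monomial_eq,
    Finsupp.prod_fintype _ _ fun _ => pow_zero _]
  simp

theorem fourierD_polyDelta (P : MvPolynomial (Fin n) ℂ) : fourierD (polyDelta P) = polyDist P := by
  have hP : P = ∑ α ∈ P.support, P.coeff α • MvPolynomial.monomial α 1 := by
    simp [MvPolynomial.smul_monomial]
  conv_rhs => rw [hP]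
  rw [polyDelta, ← isLinearMap_fourierD.mk'_apply, ← isLinearMap_polyDist.mk'_apply, map_sum,
    map_sum]
  simp [IsLinearMap.mk'_apply, fourierD_dPow_delta]

theorem isLinearMap_polyDelta : IsLinearMap ℂ (polyDelta (n := n)) where
  map_add P Q := fourierD_injective <| by
    simp [isLinearMap_fourierD.map_add, fourierD_polyDelta, isLinearMap_polyDist.map_add]
  map_smul c P := fourierD_injective <| by
    simp [isLinearMap_fourierD.map_smul, fourierD_polyDelta, isLinearMap_polyDist.map_smul]

theorem dOp_polyDelta (j : Fin n) (P : MvPolynomial (Fin n) ℂ) :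
    dOp j (polyDelta P) = polyDelta (MvPolynomial.X j * P) :=
  fourierD_injective <| by
    rw [fourierD_dOp_of_eq_polyDist (fourierD_polyDelta P), fourierD_polyDelta]

theorem polyDelta_C (c : ℂ) : polyDelta (MvPolynomial.C c : MvPolynomial (Fin n) ℂ) =
    c • TemperedDistribution.delta (0 : E n) :=
  fourierD_injective <| by
    rw [fourierD_polyDelta, isLinearMap_fourierD.map_smul, fourierD_delta,
      ← isLinearMap_polyDist.map_smul, MvPolynomial.smul_eq_C_mul, mul_one]

/-! ### Homogeneous polynomials -/

/-- The space of homogeneous polynomials of real degree `s`. -/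
def homogPoly (n : ℕ) (s : ℝ) : Submodule ℂ (MvPolynomial (Fin n) ℂ) where
  carrier := {Q | IsHomogPoly s Q}
  zero_mem' α h := absurd (MvPolynomial.coeff_zero α) h
  add_mem' {P Q} hP hQ α h := by
    by_cases hp : P.coeff α = 0
    · exact hQ α fun hq => h (by simp [hp, hq])
    · exact hP α hp
  smul_mem' c P hP α h := hP α fun hp => h (by simp [hp])

theorem isHomogPoly_natCast {k : ℕ} {Q : MvPolynomial (Fin n) ℂ} :
    IsHomogPoly (k : ℝ) Q ↔ Q.IsHomogeneous k := by
  simp only [IsHomogPoly, MvPolynomial.IsHomogeneous, MvPolynomial.IsWeightedHomogeneous,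
    Nat.cast_inj, Finsupp.degree_eq_weight_one]
  rfl

theorem IsHomogPoly.eq_zero {s : ℝ} {P : MvPolynomial (Fin n) ℂ} (hP : IsHomogPoly s P)
    (hs : ∀ k : ℕ, (k : ℝ) ≠ s) : P = 0 := by
  ext α
  by_contra h
  exact hs _ (hP α h)

theorem IsHomogPoly.X_mul {s : ℝ} {P : MvPolynomial (Fin n) ℂ} (hP : IsHomogPoly s P)
    (j : Fin n) : IsHomogPoly (s + 1) (MvPolynomial.X j * P) := by
  by_cases hs : ∃ k : ℕ, (k : ℝ) = s
  · obtain ⟨k, rfl⟩ := hs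
    rw [← Nat.cast_succ, isHomogPoly_natCast, Nat.succ_eq_one_add]
    exact (MvPolynomial.isHomogeneous_X ℂ j).mul (isHomogPoly_natCast.1 hP)
  · push Not at hs
    rw [hP.eq_zero hs, mul_zero]
    exact (homogPoly n _).zero_mem

theorem isHomogPoly_C (c : ℂ) : IsHomogPoly 0 (MvPolynomial.C c : MvPolynomial (Fin n) ℂ) := by
  rw [← Nat.cast_zero, isHomogPoly_natCast]
  exact MvPolynomial.isHomogeneous_C _ c

theorem polyEval_smul_of_isHomogeneous {k : ℕ} {P : MvPolynomial (Fin n) ℂ}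
    (hP : P.IsHomogeneous k) (t : ℝ) (x : E n) :
    polyEval P (t • x) = (t : ℂ) ^ k * polyEval P x := by
  rw [polyEval, polyEval, MvPolynomial.eval_eq', MvPolynomial.eval_eq', Finset.mul_sum]
  refine Finset.sum_congr rfl fun α hα => ?_
  rw [← isHomogPoly_natCast] at hP
  have hα : α.degree = k := by exact_mod_cast hP α (MvPolynomial.mem_support_iff.1 hα)
  simp [mul_pow, Finset.prod_mul_distrib, Finset.prod_pow_eq_pow_sum, ← Finsupp.degree_eq_sum, hα,
    mul_left_comm]

theorem IsHomogPoly.polyEval_smul {s : ℝ} {P : MvPolynomial (Fin n) ℂ} (hP : IsHomogPoly s P)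
    (t : ℝ) (x : E n) : polyEval P (t • x) = ((t ^ s : ℝ) : ℂ) * polyEval P x := by
  by_cases hs : ∃ k : ℕ, (k : ℝ) = s
  · obtain ⟨k, rfl⟩ := hs
    rw [polyEval_smul_of_isHomogeneous (isHomogPoly_natCast.1 hP)]
    simp
  · push Not at hs
    simp [hP.eq_zero hs, polyEval]

theorem dil_polyDist {s : ℝ} {Q : MvPolynomial (Fin n) ℂ} (hQ : IsHomogPoly s Q) (t : ℝ)
    (ht : 0 < t) : dil t ht (polyDist Q) = ((t ^ s : ℝ) : ℂ) • polyDist Q := by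
  ext φ
  rw [dil_apply, polyDist_apply, integral_mul_dilS _ ht]
  simp [hQ.polyEval_smul t, polyDist_apply, mul_assoc, integral_const_mul]

theorem dil_polyDelta {s : ℝ} {P : MvPolynomial (Fin n) ℂ} (hP : IsHomogPoly (-(n : ℝ) - s) P)
    (t : ℝ) (ht : 0 < t) : dil t ht (polyDelta P) = ((t ^ s : ℝ) : ℂ) • polyDelta P := by
  refine fourierD_injective ?_
  have h := dil_fourierD t⁻¹ (inv_pos.2 ht) (polyDelta P)
  rw [fourierD_polyDelta, dil_polyDist hP, rpow_neg_sub_eq (inv_pos.2 ht), ← smul_smul] at h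
  simp only [inv_inv] at h
  have hne : ((t⁻¹ ^ n : ℝ) : ℂ)⁻¹ ≠ 0 := by exact_mod_cast (by positivity : (t⁻¹ ^ n)⁻¹ ≠ 0)
  rw [isLinearMap_fourierD.map_smul, fourierD_polyDelta]
  exact (smul_right_injective _ hne h).symm

theorem fourierD_polyDist {s : ℝ} {Q : MvPolynomial (Fin n) ℂ} (hQ : IsHomogPoly s Q) :
    ∃ c : ℂ, fourierD (polyDist Q) = c • polyDelta Q := by
  by_cases hs : ∃ k : ℕ, (k : ℝ) = s
  · obtain ⟨k, rfl⟩ := hs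
    have hneg (x : E n) : polyEval Q (-x) = (-1) ^ k * polyEval Q x := by
      simpa using polyEval_smul_of_isHomogeneous (isHomogPoly_natCast.1 hQ) (-1) x
    refine ⟨(((2 * Real.pi) ^ n : ℝ) : ℂ) * (-1) ^ k, fourierD_injective ?_⟩
    ext φ
    rw [← fourierD_polyDelta, fourierD_fourierD_apply, fourierD_polyDelta,
      isLinearMap_fourierD.map_smul, fourierD_polyDelta, smul_apply, polyDist_apply,
      ← integral_neg_eq_self]
    simp [hneg, dilS_apply, polyDist_apply, mul_assoc, integral_const_mul]
  · push Not at hs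
    refine ⟨0, ?_⟩
    rw [hQ.eq_zero hs, isLinearMap_polyDist.map_zero, isLinearMap_fourierD.map_zero,
      isLinearMap_polyDelta.map_zero, smul_zero]

theorem polyLog_apply (Q : MvPolynomial (Fin n) ℂ) (φ : 𝓢(E n, ℂ)) :
    polyLog Q φ = ∫ x : E n, (polyEval Q x * Real.log ‖x‖) * φ x := by
  change logDist (mulS (polyEval Q) φ) = _
  simp [logDist, ofFun_apply, mulS_apply (hasTemperateGrowth_polyEval Q), mul_left_comm, mul_assoc]

theorem integrable_polyEval_mul_log_mul (Q : MvPolynomial (Fin n) ℂ) (φ : 𝓢(E n, ℂ)) :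
    Integrable fun x : E n => polyEval Q x * (Real.log ‖x‖ : ℂ) * φ x := by
  simpa [mulS_apply (hasTemperateGrowth_polyEval Q), mul_left_comm, mul_assoc]
    using isTemperedFun_log.integrable_mul (mulS (polyEval Q) φ)

theorem ae_ne_zero [NeZero n] : ∀ᵐ x : E n, x ≠ 0 := by
  have : Nonempty (Fin n) := ⟨0⟩
  simp [ae_iff]

theorem dil_polyLog [NeZero n] {s : ℝ} {Q : MvPolynomial (Fin n) ℂ} (hQ : IsHomogPoly s Q)
    (t : ℝ) (ht : 0 < t) : dil t ht (polyLog Q) =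
      ((t ^ s : ℝ) : ℂ) • (polyLog Q + ((Real.log t : ℝ) : ℂ) • polyDist Q) := by
  ext φ
  simp only [dil_apply, smul_apply, add_apply, smul_eq_mul, polyDist_apply, polyLog_apply]
  rw [integral_mul_dilS _ ht, ← integral_const_mul, ← integral_add
    (integrable_polyEval_mul_log_mul Q φ) ((integrable_polyEval_mul Q φ).const_mul _),
    ← integral_const_mul]
  refine integral_congr_ae ?_
  filter_upwards [ae_ne_zero] with x hx
  rw [hQ.polyEval_smul t, norm_smul, Real.norm_of_nonneg ht.le,
    Real.log_mul ht.ne' (norm_ne_zero_iff.2 hx)]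
  push_cast
  ring

/-! ### Cutoff functions and density of test functions -/

theorem exists_isCutoff_of_mem_nhds {s : Set (E n)} (hs : s ∈ nhds 0) :
    ∃ χ : E n → ℝ, IsCutoff χ ∧ ∀ x ∉ s, χ x = 0 := by
  obtain ⟨r, hr, hrs⟩ := Metric.mem_nhds_iff.1 hs
  let b : ContDiffBump (0 : E n) := ⟨r / 2, r, half_pos hr, half_lt_self hr⟩
  refine ⟨b, ⟨b.contDiff, b.hasCompactSupport, fun x => b.nonneg, fun x => b.le_one,
    b.eventuallyEq_one⟩, fun x hx => b.zero_of_le_dist ?_⟩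
  exact not_lt.1 fun h => hx (hrs h)

theorem exists_isCutoff (n : ℕ) : ∃ χ : E n → ℝ, IsCutoff χ :=
  (exists_isCutoff_of_mem_nhds Filter.univ_mem).imp fun _ h => h.1

theorem exists_isPatch_mulS_eq {φ : 𝓢(E n, ℂ)} (hφ : ∀ᶠ x in nhds (0 : E n), φ x = 0) :
    ∃ θ : E n → ℝ, IsPatch θ ∧ mulS (fun x => (θ x : ℂ)) φ = φ := by
  obtain ⟨χ, hχ, hχφ⟩ := exists_isCutoff_of_mem_nhds hφ
  refine ⟨_, hχ.isPatch, ?_⟩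
  ext x
  rw [mulS_apply hχ.isPatch.hasTemperateGrowth]
  by_cases hx : φ x = 0
  · rw [hx, mul_zero]
  · simp [hχφ x hx]

/-- A test function as a Schwartz function. -/
def IsTestFun.toS {ρ : E n → ℝ} (hρ : IsTestFun ρ) : 𝓢(E n, ℂ) :=
  hρ.ofReal_compact.toSchwartzMap hρ.ofReal_smooth

theorem exists_seminorm_mulS_le (φ : 𝓢(E n, ℂ)) (k l : ℕ) :
    ∃ C : ℝ, ∀ (B : ℝ) (g : E n → ℂ), 0 ≤ B → g.HasTemperateGrowth →
      (∀ j ≤ l, ∀ x, ‖iteratedFDeriv ℝ j g x‖ ≤ B * (1 + ‖x‖)) →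
      SchwartzMap.seminorm ℂ k l (mulS g φ) ≤ C * B := by
  set S : ℝ := 2 ^ (k + 1) *
    ((Finset.Iic ((k + 1, l) : ℕ × ℕ)).sup (schwartzSeminormFamily ℂ (E n) ℂ)) φ
  have _hS : 0 ≤ S := mul_nonneg (by positivity) (apply_nonneg _ _)
  have hφ (j : ℕ) (hj : j ≤ l) (x : E n) : (1 + ‖x‖) ^ (k + 1) * ‖iteratedFDeriv ℝ j φ x‖ ≤ S :=
    one_add_le_sup_seminorm_apply (𝕜 := ℂ) (m := (k + 1, l)) le_rfl hj φ x
  refine ⟨2 ^ l * S, fun B g hB hg hgB => seminorm_le_bound ℂ k l _ (by positivity) fun x => ?_⟩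
  have hterm (i : ℕ) (hi : i ≤ l) : (1 + ‖x‖) ^ k * (‖iteratedFDeriv ℝ i g x‖ *
      ‖iteratedFDeriv ℝ (l - i) φ x‖) ≤ S * B :=
    calc (1 + ‖x‖) ^ k * (‖iteratedFDeriv ℝ i g x‖ * ‖iteratedFDeriv ℝ (l - i) φ x‖)
        ≤ (1 + ‖x‖) ^ k * ((B * (1 + ‖x‖)) * ‖iteratedFDeriv ℝ (l - i) φ x‖) := by
          gcongr
          exact hgB i hi x
      _ = ((1 + ‖x‖) ^ (k + 1) * ‖iteratedFDeriv ℝ (l - i) φ x‖) * B := by ring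
      _ ≤ S * B := by
          gcongr
          exact hφ _ (Nat.sub_le l i) x
  calc ‖x‖ ^ k * ‖iteratedFDeriv ℝ l (mulS g φ) x‖
      ≤ (1 + ‖x‖) ^ k * ∑ i ∈ Finset.range (l + 1), (l.choose i : ℝ) *
          ‖iteratedFDeriv ℝ i g x‖ * ‖iteratedFDeriv ℝ (l - i) φ x‖ := by
        rw [coe_mulS hg]
        gcongr
        · exact le_add_of_nonneg_left zero_le_one
        · exact norm_iteratedFDeriv_mul_le hg.1 (φ.smooth ⊤) x (by exact_mod_cast le_top)
    _ ≤ ∑ i ∈ Finset.range (l + 1), (l.choose i : ℝ) * (S * B) := by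
        rw [Finset.mul_sum]
        refine Finset.sum_le_sum fun i hi => ?_
        rw [mul_assoc, mul_left_comm]
        exact mul_le_mul_of_nonneg_left (hterm i (Nat.lt_succ_iff.1 (Finset.mem_range.1 hi)))
          (Nat.cast_nonneg _)
    _ = 2 ^ l * S * B := by
        rw [← Finset.sum_mul, ← Nat.cast_sum, Nat.sum_range_choose]
        push_cast; ring

theorem IsTestFun.hasTemperateGrowth_comp_smul {ρ : E n → ℝ} (hρ : IsTestFun ρ) {ε : ℝ}
    (hε : ε ≠ 0) : (fun x => (ρ (ε • x) : ℂ)).HasTemperateGrowth :=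
  (hρ.ofReal_compact.comp_smul hε).hasTemperateGrowth
    (hρ.ofReal_smooth.comp (contDiff_const_smul ε))

theorem IsCutoff.exists_norm_iteratedFDeriv_le {χ : E n → ℝ} (hχ : IsCutoff χ) (j : ℕ) :
    ∃ C : ℝ, 0 ≤ C ∧ ∀ ε : ℝ, 0 < ε → ε ≤ 1 → ∀ x,
      ‖iteratedFDeriv ℝ j (fun x => (χ (ε • x) : ℂ) - 1) x‖ ≤ C * ε * (1 + ‖x‖) := by
  rcases j with _ | j
  · obtain ⟨K, hK⟩ := ContDiff.lipschitzWith_of_hasCompactSupport hχ.isTestFun.ofReal_compact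
      hχ.isTestFun.ofReal_smooth (by simp)
    refine ⟨K, K.2, fun ε hε _ x => ?_⟩
    have h := hK.dist_le_mul (ε • x) 0
    rw [hχ.eq_one.self_of_nhds, Complex.ofReal_one, dist_eq_norm, dist_zero_right, norm_smul,
      Real.norm_of_nonneg hε.le] at h
    rw [norm_iteratedFDeriv_zero]
    refine h.trans ?_
    rw [← mul_assoc]
    gcongr
    exact le_add_of_nonneg_left zero_le_one
  · refine ⟨SchwartzMap.seminorm ℂ 0 (j + 1) hχ.isTestFun.toS, apply_nonneg _ _,
      fun ε hε hε1 x => ?_⟩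
    have hscale : ‖iteratedFDeriv ℝ (j + 1) (fun x => (χ (ε • x) : ℂ) - 1) x‖ =
        ‖ε ^ (j + 1) • iteratedFDeriv ℝ (j + 1) hχ.isTestFun.toS (ε • x)‖ := by
      have h : iteratedFDeriv ℝ (j + 1) (fun x => hχ.isTestFun.toS (ε • x)) x =
          ε ^ (j + 1) • iteratedFDeriv ℝ (j + 1) hχ.isTestFun.toS (ε • x) :=
        congrFun (iteratedFDeriv_comp_const_smul ε (hχ.isTestFun.toS.smooth _)) x
      rw [← h, ← norm_iteratedFDeriv_fderiv, ← norm_iteratedFDeriv_fderiv]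
      congr 2
      exact funext fun y => fderiv_sub_const _
    rw [hscale, norm_smul, norm_pow, Real.norm_of_nonneg hε.le, mul_assoc]
    calc ε ^ (j + 1) * ‖iteratedFDeriv ℝ (j + 1) hχ.isTestFun.toS (ε • x)‖
        ≤ ε * SchwartzMap.seminorm ℂ 0 (j + 1) hχ.isTestFun.toS := by
          gcongr
          · exact pow_le_of_le_one hε.le hε1 (Nat.succ_ne_zero j)
          · exact norm_iteratedFDeriv_le_seminorm ℂ hχ.isTestFun.toS (j + 1) _
      _ ≤ SchwartzMap.seminorm ℂ 0 (j + 1) hχ.isTestFun.toS * (ε * (1 + ‖x‖)) := by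
          rw [mul_comm]
          gcongr
          exact le_mul_of_one_le_right hε.le (le_add_of_nonneg_right (norm_nonneg x))

theorem IsCutoff.tendsto_mulS {χ : E n → ℝ} (hχ : IsCutoff χ) (φ : 𝓢(E n, ℂ)) :
    Filter.Tendsto (fun m : ℕ => mulS (fun x => (χ (((m : ℝ) + 1)⁻¹ • x) : ℂ)) φ) Filter.atTop
      (nhds φ) := by
  have hpos (m : ℕ) : 0 < ((m : ℝ) + 1)⁻¹ := by positivity
  have hgrowth (m : ℕ) : (fun x : E n => (χ (((m : ℝ) + 1)⁻¹ • x) : ℂ) - 1).HasTemperateGrowth :=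
    (hχ.isTestFun.hasTemperateGrowth_comp_smul (hpos m).ne').sub
      (Function.HasTemperateGrowth.const 1)
  have hsub (m : ℕ) : mulS (fun x => (χ (((m : ℝ) + 1)⁻¹ • x) : ℂ)) φ - φ =
      mulS (fun x => (χ (((m : ℝ) + 1)⁻¹ • x) : ℂ) - 1) φ := by
    ext x
    rw [mulS_apply (hgrowth m), sub_apply,
      mulS_apply (hχ.isTestFun.hasTemperateGrowth_comp_smul (hpos m).ne'), sub_one_mul]
  rw [(schwartz_withSeminorms ℂ (E n) ℂ).tendsto_nhds]
  rintro ⟨k, l⟩ δ hδ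
  obtain ⟨C, hC⟩ := exists_seminorm_mulS_le φ k l
  choose D hD0 hD using hχ.exists_norm_iteratedFDeriv_le
  set D' : ℝ := ∑ j ∈ Finset.range (l + 1), D j
  have hD' : 0 ≤ D' := Finset.sum_nonneg fun j _ => hD0 j
  have hbound (m : ℕ) : SchwartzMap.seminorm ℂ k l
      (mulS (fun x => (χ (((m : ℝ) + 1)⁻¹ • x) : ℂ) - 1) φ) ≤ C * (D' * ((m : ℝ) + 1)⁻¹) := by
    refine hC _ _ (mul_nonneg hD' (hpos m).le) (hgrowth m) fun j hj x => ?_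
    have hm : ((m : ℝ) + 1)⁻¹ ≤ 1 := inv_le_one_of_one_le₀ (by simp)
    refine (hD j _ (hpos m) hm x).trans ?_
    gcongr
    exact Finset.single_le_sum (fun i _ => hD0 i) (Finset.mem_range.2 (Nat.lt_succ_iff.2 hj))
  have hlim : Filter.Tendsto (fun m : ℕ => C * (D' * ((m : ℝ) + 1)⁻¹)) Filter.atTop (nhds 0) := by
    simpa [mul_assoc] using (tendsto_one_div_add_atTop_nhds_zero_nat (𝕜 := ℝ)).const_mul (C * D')
  filter_upwards [hlim.eventually_lt_const hδ] with m hm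
  rw [hsub]
  exact (hbound m).trans_lt hm

theorem ext_of_hasCompactSupport {S T : 𝓢'(E n, ℂ)}
    (h : ∀ φ : 𝓢(E n, ℂ), HasCompactSupport φ → S φ = T φ) : S = T := by
  ext φ
  obtain ⟨χ, hχ⟩ := exists_isCutoff n
  have hlim (R : 𝓢'(E n, ℂ)) := ((map_continuous R).tendsto φ).comp (hχ.tendsto_mulS φ)
  refine tendsto_nhds_unique (hlim S) ((hlim T).congr fun m => (h _ ?_).symm)
  have hm : ((m : ℝ) + 1)⁻¹ ≠ 0 := by positivity
  rw [coe_mulS (hχ.isTestFun.hasTemperateGrowth_comp_smul hm)]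
  exact (hχ.isTestFun.ofReal_compact.comp_smul hm).mul_right

/-! ### Distributions that are functions off the origin -/

theorem zero_notMem_tsupport_iff (φ : E n → ℂ) :
    (0 : E n) ∉ tsupport φ ↔ ∀ᶠ x in nhds (0 : E n), φ x = 0 :=
  notMem_tsupport_iff_eventuallyEq

theorem zero_notMem_tsupport_mulS {g : E n → ℂ} (hg : g.HasTemperateGrowth)
    (h0 : ∀ᶠ x in nhds (0 : E n), g x = 0) (φ : 𝓢(E n, ℂ)) : (0 : E n) ∉ tsupport (mulS g φ) := by
  rw [zero_notMem_tsupport_iff]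
  filter_upwards [h0] with x hx
  rw [mulS_apply hg, hx, zero_mul]

theorem AgreesOffZero.mulDist_eq_ofFun {T : 𝓢'(E n, ℂ)} {w : E n → ℂ} (hT : AgreesOffZero T w)
    {θ : E n → ℝ} (hθ : IsPatch θ) (hw : IsTemperedFun fun x => (θ x : ℂ) * w x) :
    mulDist θ T = ofFun (fun x => (θ x : ℂ) * w x) hw := by
  refine ext_of_hasCompactSupport fun φ hφ => ?_
  have hg := hθ.hasTemperateGrowth
  rw [mulDist_apply, ofFun_apply, hT]
  · simp only [mulS_apply hg, mul_left_comm, mul_assoc]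
  · rw [coe_mulS hg]
    exact hφ.mul_left
  · exact zero_notMem_tsupport_mulS hg (hθ.eventually_eq_zero.mono fun x hx => by simp [hx]) φ

theorem AgreesOffZero.apply_eq_zero {T : 𝓢'(E n, ℂ)} (hT : AgreesOffZero T 0) {φ : 𝓢(E n, ℂ)}
    (hφ : ∀ᶠ x in nhds (0 : E n), φ x = 0) : T φ = 0 := by
  obtain ⟨θ, hθ, hθφ⟩ := exists_isPatch_mulS_eq hφ
  have h0 : IsTemperedFun fun x => (θ x : ℂ) * (0 : E n → ℂ) x := ⟨0, by simp⟩
  rw [← hθφ, ← mulDist_apply, hT.mulDist_eq_ofFun hθ h0]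
  simp [ofFun_apply]

/-! ### Functions that are homogeneous up to a logarithm -/

section LogHomogFun

variable {F : Type*} [NormedAddCommGroup F] [NormedSpace ℝ F] {s : ℝ} {w q : E n → F}

/-- `w` is homogeneous of degree `s` up to a logarithmic term: `w (t x) = t ^ s (w x + log t q x)`
for `x ≠ 0` and `t > 0`. -/
def IsLogHomogFun (s : ℝ) (w q : E n → F) : Prop :=
  ∀ x : E n, x ≠ 0 → ∀ t : ℝ, 0 < t → w (t • x) = t ^ s • (w x + Real.log t • q x)

theorem IsHomogFun.isLogHomogFun {u : E n → ℂ} (hu : IsHomogFun s u) : IsLogHomogFun s u 0 := by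
  intro x hx t ht
  simp [hu x hx t ht]

theorem IsHomogFun.mul_log {u : E n → ℂ} (hu : IsHomogFun s u) :
    IsLogHomogFun s (fun x => u x * (Real.log ‖x‖ : ℂ)) u := by
  intro x hx t ht
  simp only [hu x hx t ht, norm_smul, Real.norm_of_nonneg ht.le, Complex.real_smul]
  rw [Real.log_mul ht.ne' (norm_ne_zero_iff.2 hx)]
  push_cast
  ring

theorem IsHomogFun.coord_mul {u : E n → ℂ} (hu : IsHomogFun s u) (j : Fin n) :
    IsHomogFun (s + 1) (fun x => (x j : ℂ) * u x) := by
  intro x hx t ht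
  simp only [hu x hx t ht, Real.rpow_add ht, Real.rpow_one, PiLp.smul_apply, smul_eq_mul]
  push_cast
  ring

theorem IsLogHomogFun.isLogHomogFun_fderiv (h : IsLogHomogFun s w q) (hw : ContDiffOn ℝ ∞ w {0}ᶜ)
    (hq : ContDiffOn ℝ ∞ q {0}ᶜ) :
    IsLogHomogFun (s - 1) (fderiv ℝ w) (fderiv ℝ q) := by
  intro x hx t ht
  have hdiff {f : E n → F} (hf : ContDiffOn ℝ ∞ f {0}ᶜ) : DifferentiableAt ℝ f x :=
    ContDiffAt.differentiableAt (hf.contDiffAt (isOpen_compl_singleton.mem_nhds hx)) (by simp)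
  have heq : (fun y => w (t • y)) =ᶠ[nhds x] fun y => t ^ s • (w y + Real.log t • q y) := by
    filter_upwards [isOpen_compl_singleton.mem_nhds hx] with y hy
    exact h y hy t ht
  have hfd := heq.fderiv_eq (𝕜 := ℝ)
  have hlog : DifferentiableAt ℝ (fun y => Real.log t • q y) x :=
    (hdiff hq).const_smul (Real.log t)
  rw [fderiv_comp_smul, fderiv_fun_const_smul ((hdiff hw).fun_add hlog),
    fderiv_fun_add (hdiff hw) hlog, fderiv_fun_const_smul (hdiff hq)] at hfd
  rw [Real.rpow_sub_one ht.ne', div_eq_inv_mul, mul_smul, ← hfd, inv_smul_smul₀ ht.ne']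

theorem abs_log_le_rpow_add_rpow_neg {r ε : ℝ} (hr : 0 < r) (hε : 0 < ε) :
    |Real.log r| ≤ (r ^ ε + r ^ (-ε)) / ε := by
  have h1 := Real.log_le_rpow_div hr.le hε
  have h2 := Real.log_le_rpow_div (inv_pos.2 hr).le hε
  rw [Real.log_inv, Real.inv_rpow hr.le, ← Real.rpow_neg hr.le] at h2
  rw [abs_le', add_div]
  have h3 : 0 < r ^ ε / ε := by positivity
  have h4 : 0 < r ^ (-ε) / ε := by positivity
  constructor <;> linarith

theorem one_le_rpow_add_rpow_neg {r : ℝ} (hr : 0 < r) (ε : ℝ) : 1 ≤ r ^ ε + r ^ (-ε) := by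
  have h : r ^ ε * r ^ (-ε) = 1 := by rw [← Real.rpow_add hr, add_neg_cancel, Real.rpow_zero]
  nlinarith [sq_nonneg (r ^ ε - r ^ (-ε)), Real.rpow_pos_of_pos hr ε, Real.rpow_pos_of_pos hr (-ε)]

theorem IsLogHomogFun.exists_norm_le (h : IsLogHomogFun s w q) (hw : ContinuousOn w {0}ᶜ)
    (hq : ContinuousOn q {0}ᶜ) {ε : ℝ} (hε : 0 < ε) :
    ∃ C : ℝ, 0 ≤ C ∧ ∀ x, x ≠ 0 → ‖w x‖ ≤ C * (‖x‖ ^ (s - ε) + ‖x‖ ^ (s + ε)) := by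
  have hsub : Metric.sphere (0 : E n) 1 ⊆ {0}ᶜ := fun x hx h0 => by
    simp [Set.mem_singleton_iff.1 h0] at hx
  have hK := isCompact_sphere (0 : E n) 1
  obtain ⟨A, hA⟩ := hK.exists_bound_of_continuousOn (hw.mono hsub)
  obtain ⟨B, hB⟩ := hK.exists_bound_of_continuousOn (hq.mono hsub)
  refine ⟨|A| + |B| / ε, by positivity, fun x hx => ?_⟩
  set r := ‖x‖ with hrdef
  have hr : 0 < r := norm_pos_iff.2 hx
  have hmem : r⁻¹ • x ∈ Metric.sphere (0 : E n) 1 := by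
    simp [norm_smul, ← hrdef, hr.ne', abs_of_pos hr]
  have hval := h (r⁻¹ • x) (hsub hmem) r hr
  rw [smul_inv_smul₀ hr.ne'] at hval
  calc ‖w x‖ = r ^ s * ‖w (r⁻¹ • x) + Real.log r • q (r⁻¹ • x)‖ := by
        rw [hval, norm_smul, Real.norm_of_nonneg (by positivity)]
    _ ≤ r ^ s * (|A| * 1 + (r ^ ε + r ^ (-ε)) / ε * |B|) := by
        gcongr
        refine norm_add_le_of_le ?_ ?_
        · rw [mul_one]
          exact (hA _ hmem).trans (le_abs_self A)
        · rw [norm_smul, Real.norm_eq_abs]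
          gcongr
          · exact abs_log_le_rpow_add_rpow_neg hr hε
          · exact (hB _ hmem).trans (le_abs_self B)
    _ ≤ r ^ s * (|A| * (r ^ ε + r ^ (-ε)) + (r ^ ε + r ^ (-ε)) / ε * |B|) := by
        gcongr
        exact one_le_rpow_add_rpow_neg hr ε
    _ = (|A| + |B| / ε) * (r ^ (s - ε) + r ^ (s + ε)) := by
        rw [sub_eq_add_neg, Real.rpow_add hr, Real.rpow_add hr]
        ring

end LogHomogFun

theorem IsLogHomogFun.fderiv_self {s : ℝ} {w q : E n → ℂ} (h : IsLogHomogFun s w q) {x : E n}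
    (hw : DifferentiableAt ℝ w x) (hx : x ≠ 0) : fderiv ℝ w x x = s * w x + q x := by
  have hray : HasDerivAt (fun t : ℝ => w (t • x)) (fderiv ℝ w x x) 1 := by
    have hd : HasFDerivAt w (fderiv ℝ w x) ((1 : ℝ) • x) := by
      rw [one_smul]
      exact hw.hasFDerivAt
    simpa [Function.comp_def] using
      hd.comp_hasDerivAt (1 : ℝ) ((hasDerivAt_id (1 : ℝ)).smul_const x)
  have hlaw : HasDerivAt (fun t : ℝ => t ^ s • (w x + Real.log t • q x)) (s * w x + q x) 1 := by
    have hpow := Real.hasDerivAt_rpow_const (x := 1) (p := s) (Or.inl one_ne_zero)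
    have hlog := ((Real.hasDerivAt_log one_ne_zero).smul_const (q x)).const_add (w x)
    simpa [add_comm] using hpow.fun_smul hlog
  refine hray.unique (hlaw.congr_of_eventuallyEq ?_)
  filter_upwards [lt_mem_nhds (zero_lt_one (α := ℝ))] with t ht
  exact h x hx t ht

theorem sum_smul_single (x : E n) :
    ∑ j, x j • (EuclideanSpace.single j (1 : ℝ) : E n) = x := by
  ext i
  simp [Finset.sum_apply, Pi.single_apply]

theorem IsLogHomogFun.sum_fderiv_coord_mul {s : ℝ} {w q : E n → ℂ} (h : IsLogHomogFun s w q)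
    {x : E n} (hw : DifferentiableAt ℝ w x) (hx : x ≠ 0) :
    ∑ j, fderiv ℝ (fun y => (y j : ℂ) * w y) x (EuclideanSpace.single j (1 : ℝ)) =
      (n + s : ℝ) * w x + q x := by
  have hterm (j : Fin n) : fderiv ℝ (fun y => (y j : ℂ) * w y) x (EuclideanSpace.single j 1) =
      (x j : ℂ) * fderiv ℝ w x (EuclideanSpace.single j 1) + w x := by
    have hc : HasFDerivAt (fun y : E n => (y j : ℂ))
        (Complex.ofRealCLM.comp (EuclideanSpace.proj (𝕜 := ℝ) j : E n →L[ℝ] ℝ)) x :=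
      (Complex.ofRealCLM.comp (EuclideanSpace.proj (𝕜 := ℝ) j : E n →L[ℝ] ℝ)).hasFDerivAt
    rw [(hc.fun_mul hw.hasFDerivAt).fderiv]
    simp
  have hsum : ∑ j, (x j : ℂ) * fderiv ℝ w x (EuclideanSpace.single j (1 : ℝ)) =
      fderiv ℝ w x x := by
    conv_rhs => rw [← sum_smul_single x]
    simp only [map_sum, map_smul, Complex.real_smul]
    rw [sum_smul_single x]
  simp only [hterm, Finset.sum_add_distrib, hsum, h.fderiv_self hw hx]
  simp
  ring

/-! ### Tempered functions -/

theorem IsTemperedFun.mono {f w : E n → ℂ} (hf : IsTemperedFun f)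
    (hw : AEStronglyMeasurable w) (h : ∀ᵐ x, ‖w x‖ ≤ ‖f x‖) : IsTemperedFun w := by
  obtain ⟨N, hN⟩ := hf
  have hweight : Continuous fun x : E n => (((1 + ‖x‖) ^ (-(N : ℝ)) : ℝ) : ℂ) := by
    refine Complex.continuous_ofReal.comp ?_
    exact (continuous_const.add continuous_norm).rpow_const
      fun x => Or.inl (by positivity : 0 < 1 + ‖x‖).ne'
  refine ⟨N, hN.mono (hweight.aestronglyMeasurable.mul hw) (h.mono fun x hx => ?_)⟩
  rw [norm_mul, norm_mul]
  gcongr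

theorem isTemperedFun_norm_rpow [NeZero n] {a : ℝ} (ha : -(n : ℝ) < a) :
    IsTemperedFun fun x : E n => ((‖x‖ ^ a : ℝ) : ℂ) := by
  have : Nonempty (Fin n) := ⟨0⟩
  obtain ⟨N, hN⟩ := exists_nat_gt (n + a)
  refine ⟨N, ?_⟩
  simp only [← Complex.ofReal_mul]
  suffices h : Integrable fun x : E n => (1 + ‖x‖) ^ (-(N : ℝ)) * ‖x‖ ^ a from h.ofReal
  rw [integrable_fun_norm_addHaar volume (f := fun r => (1 + r) ^ (-(N : ℝ)) * r ^ a),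
    ← Set.Ioc_union_Ioi_eq_Ioi zero_le_one]
  set g : ℝ → ℝ := fun r => r ^ (Module.finrank ℝ (E n) - 1) • ((1 + r) ^ (-(N : ℝ)) * r ^ a)
  have hg : Measurable g := by fun_prop
  have hval {r : ℝ} (hr : 0 < r) : ‖g r‖ = (1 + r) ^ (-(N : ℝ)) * r ^ (n - 1 + a) := by
    have h1 : ((n - 1 : ℕ) : ℝ) = n - 1 := by
      rw [Nat.cast_sub NeZero.one_le, Nat.cast_one]
    rw [Real.norm_of_nonneg (by positivity), Real.rpow_add hr, ← h1, Real.rpow_natCast]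
    simp only [finrank_euclideanSpace, Fintype.card_fin, smul_eq_mul, g]
    ring
  refine IntegrableOn.union ?_ ?_
  · refine Integrable.mono' (g := fun r => r ^ (n - 1 + a)) ?_ hg.aestronglyMeasurable ?_
    · exact (intervalIntegral.intervalIntegrable_rpow' (a := 0) (b := 1) (by linarith)).1
    · filter_upwards [ae_restrict_mem measurableSet_Ioc] with r hr
      rw [hval hr.1]
      have := hr.1
      exact mul_le_of_le_one_left (by positivity)
        (Real.rpow_le_one_of_one_le_of_nonpos (by linarith) (by simp))
  · refine Integrable.mono' (g := fun r => r ^ (-(N : ℝ) + (n - 1 + a))) ?_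
      hg.aestronglyMeasurable ?_
    · exact integrableOn_Ioi_rpow_of_lt (by linarith) one_pos
    · filter_upwards [ae_restrict_mem measurableSet_Ioi] with r hr
      have hr0 : 0 < r := one_pos.trans hr
      rw [hval hr0, Real.rpow_add hr0 (-(N : ℝ))]
      exact mul_le_mul_of_nonneg_right
        (Real.rpow_le_rpow_of_nonpos hr0 (by linarith) (by simp)) (by positivity)

theorem integrable_rpow_neg_mul_mono {f : E n → ℂ} {N M : ℕ} (h : N ≤ M)
    (hN : Integrable fun x : E n => (((1 + ‖x‖) ^ (-(N : ℝ)) : ℝ) : ℂ) * f x) :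
    Integrable fun x : E n => (((1 + ‖x‖) ^ (-(M : ℝ)) : ℝ) : ℂ) * f x := by
  have hcont : Continuous fun x : E n => (((1 + ‖x‖) ^ ((N : ℝ) - M) : ℝ) : ℂ) :=
    Complex.continuous_ofReal.comp ((continuous_const.add continuous_norm).rpow_const
      fun x => Or.inl (by positivity : 0 < 1 + ‖x‖).ne')
  refine (hN.bdd_mul (c := 1) hcont.aestronglyMeasurable (.of_forall fun x => ?_)).congr
    (.of_forall fun x => ?_)
  · rw [Complex.norm_real, Real.norm_of_nonneg (by positivity)]
    exact Real.rpow_le_one_of_one_le_of_nonpos (by simp) (by simpa using h)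
  · simp only [← mul_assoc, ← Complex.ofReal_mul]
    rw [← Real.rpow_add (by positivity), sub_add_eq_add_sub, add_neg_cancel, zero_sub]

theorem IsTemperedFun.add {f g : E n → ℂ} (hf : IsTemperedFun f) (hg : IsTemperedFun g) :
    IsTemperedFun (f + g) := by
  obtain ⟨N, hN⟩ := hf
  obtain ⟨M, hM⟩ := hg
  refine ⟨max N M, ?_⟩
  simp only [Pi.add_apply, mul_add]
  exact (integrable_rpow_neg_mul_mono (le_max_left N M) hN).add
    (integrable_rpow_neg_mul_mono (le_max_right N M) hM)

theorem IsTemperedFun.const_mul {f : E n → ℂ} (hf : IsTemperedFun f) (c : ℂ) :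
    IsTemperedFun fun x => c * f x :=
  hf.imp fun N hN => by simpa only [mul_left_comm] using hN.const_mul c

theorem SmoothOffZero.aestronglyMeasurable [NeZero n] {w : E n → ℂ} (hw : SmoothOffZero w) :
    AEStronglyMeasurable w := by
  rw [← Measure.restrict_eq_self_of_ae_mem (s := {0}ᶜ) ae_ne_zero]
  exact hw.continuousOn.aestronglyMeasurable (measurableSet_singleton _).compl

theorem IsLogHomogFun.isTemperedFun [NeZero n] {s : ℝ} (hs : -(n : ℝ) < s) {w q : E n → ℂ}
    (h : IsLogHomogFun s w q) (hw : SmoothOffZero w) (hq : SmoothOffZero q) :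
    IsTemperedFun w := by
  have hε : 0 < (s + n) / 2 := by linarith
  obtain ⟨C, hC0, hC⟩ := h.exists_norm_le hw.continuousOn hq.continuousOn hε
  have hsum := ((isTemperedFun_norm_rpow (n := n) (a := s - (s + n) / 2) (by linarith)).add
    (isTemperedFun_norm_rpow (n := n) (a := s + (s + n) / 2) (by linarith))).const_mul C
  refine hsum.mono hw.aestronglyMeasurable (ae_ne_zero.mono fun x hx => (hC x hx).trans_eq ?_)
  rw [Pi.add_apply, ← Complex.ofReal_add, ← Complex.ofReal_mul, Complex.norm_real,
    Real.norm_of_nonneg (by positivity)]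

theorem smoothOffZero_log : SmoothOffZero (fun x : E n => (Real.log ‖x‖ : ℂ)) := fun _ hx =>
  (Complex.ofRealCLM.contDiff.contDiffAt.comp _
    ((contDiffAt_norm ℝ hx).log (norm_ne_zero_iff.2 hx))).contDiffWithinAt

theorem smoothOffZero_polyEval_mul_log (Q : MvPolynomial (Fin n) ℂ) :
    SmoothOffZero (fun x : E n => polyEval Q x * (Real.log ‖x‖ : ℂ)) :=
  (hasTemperateGrowth_polyEval Q).1.contDiffOn.mul smoothOffZero_log

/-! ### Restrictions to the complement of the origin -/

theorem SmoothOffZero.contDiff_mul {w φ : E n → ℂ} (hw : SmoothOffZero w) (hφ : ContDiff ℝ ∞ φ)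
    (h0 : ∀ᶠ x in nhds (0 : E n), φ x = 0) : ContDiff ℝ ∞ fun x => w x * φ x := by
  refine contDiff_iff_contDiffAt.2 fun x => ?_
  rcases eq_or_ne x 0 with rfl | hx
  · exact (contDiffAt_const (c := 0)).congr_of_eventuallyEq (h0.mono fun y hy => by simp [hy])
  · exact (hw.contDiffAt (isOpen_compl_singleton.mem_nhds hx)).mul hφ.contDiffAt

theorem SmoothOffZero.integrable_mul {w φ : E n → ℂ} (hw : SmoothOffZero w)
    (hφ : ContDiff ℝ ∞ φ) (hc : HasCompactSupport φ) (h0 : (0 : E n) ∉ tsupport φ) :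
    Integrable (fun x => w x * φ x) :=
  (hw.contDiff_mul hφ ((zero_notMem_tsupport_iff φ).1
    h0)).continuous.integrable_of_hasCompactSupport hc.mul_left

theorem SmoothOffZero.fderiv_apply {w : E n → ℂ} (hw : SmoothOffZero w) (v : E n) :
    SmoothOffZero (fun x => fderiv ℝ w x v) :=
  (hw.fderiv_of_isOpen isOpen_compl_singleton (by simp)).clm_apply contDiffOn_const

theorem SmoothOffZero.coord_mul {w : E n → ℂ} (hw : SmoothOffZero w) (j : Fin n) :
    SmoothOffZero (fun x => (x j : ℂ) * w x) :=
  (hasTemperateGrowth_coord j).1.contDiffOn.mul hw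

theorem AgreesOffZero.congr {T : 𝓢'(E n, ℂ)} {v w : E n → ℂ} (hT : AgreesOffZero T v)
    (h : ∀ x, x ≠ 0 → v x = w x) : AgreesOffZero T w := by
  intro φ hc h0
  rw [hT φ hc h0]
  refine integral_congr_ae (.of_forall fun x => ?_)
  rcases eq_or_ne x 0 with rfl | hx
  · simp [image_eq_zero_of_notMem_tsupport h0]
  · simp [h x hx]

theorem AgreesOffZero.const_smul {T : 𝓢'(E n, ℂ)} {w : E n → ℂ} (hT : AgreesOffZero T w) (c : ℂ) :
    AgreesOffZero (c • T) (fun x => c * w x) := by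
  intro φ hc h0
  simp only [smul_apply, hT φ hc h0, smul_eq_mul, mul_assoc, integral_const_mul]

theorem agreesOffZero_sum {ι : Type*} (s : Finset ι) {T : ι → 𝓢'(E n, ℂ)} {w : ι → E n → ℂ}
    (hT : ∀ i ∈ s, AgreesOffZero (T i) (w i)) (hw : ∀ i ∈ s, SmoothOffZero (w i)) :
    AgreesOffZero (∑ i ∈ s, T i) (fun x => ∑ i ∈ s, w i x) := by
  intro φ hc h0
  simp only [sum_apply, Finset.sum_mul]
  rw [integral_finsetSum _ fun i hi => (hw i hi).integrable_mul (φ.smooth ⊤) hc h0]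
  exact Finset.sum_congr rfl fun i hi => hT i hi φ hc h0

theorem AgreesOffZero.add {S T : 𝓢'(E n, ℂ)} {v w : E n → ℂ} (hS : AgreesOffZero S v)
    (hT : AgreesOffZero T w) (hv : SmoothOffZero v) (hw : SmoothOffZero w) :
    AgreesOffZero (S + T) (v + w) := by
  intro φ hc h0
  simp only [add_apply, Pi.add_apply, add_mul, hS φ hc h0, hT φ hc h0]
  exact (integral_add (hv.integrable_mul (φ.smooth ⊤) hc h0)
    (hw.integrable_mul (φ.smooth ⊤) hc h0)).symm

theorem AgreesOffZero.lineDerivOp {T : 𝓢'(E n, ℂ)} {w : E n → ℂ} (hT : AgreesOffZero T w)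
    (hw : SmoothOffZero w) (v : E n) : AgreesOffZero (∂_{v} T) (fun x => fderiv ℝ w x v) := by
  intro φ hc h0
  have hsub : tsupport (∂_{v} φ : 𝓢(E n, ℂ)) ⊆ tsupport φ := tsupport_lineDerivOp_subset v φ
  have hc' : HasCompactSupport (∂_{v} φ : 𝓢(E n, ℂ)) :=
    hc.of_isClosed_subset (isClosed_tsupport _) hsub
  have h0' : (0 : E n) ∉ tsupport (∂_{v} φ : 𝓢(E n, ℂ)) := fun h => h0 (hsub h)
  rw [TemperedDistribution.lineDerivOp_apply_apply, map_neg, hT _ hc' h0']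
  refine neg_eq_iff_eq_neg.2 (integral_mul_fderiv_eq_neg_fderiv_mul_of_integrable (v := v)
    ((hw.fderiv_apply v).integrable_mul (φ.smooth ⊤) hc h0)
    (hw.integrable_mul ((∂_{v} φ : 𝓢(E n, ℂ)).smooth ⊤) hc' h0')
    (hw.integrable_mul (φ.smooth ⊤) hc h0) (fun x hx => ?_) fun x _ => φ.differentiableAt)
  have hx0 : x ≠ 0 := fun h => h0 (h ▸ hx)
  exact (ContDiffOn.contDiffAt hw (isOpen_compl_singleton.mem_nhds hx0)).differentiableAt (by simp)

theorem agreesOffZero_ofFun {w : E n → ℂ} (hw : IsTemperedFun w) : AgreesOffZero (ofFun w hw) w :=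
  fun φ _ _ => ofFun_apply w hw φ

theorem agreesOffZero_polyDist (Q : MvPolynomial (Fin n) ℂ) :
    AgreesOffZero (polyDist Q) (polyEval Q) :=
  fun φ _ _ => polyDist_apply Q φ

theorem agreesOffZero_polyLog (Q : MvPolynomial (Fin n) ℂ) :
    AgreesOffZero (polyLog Q) (fun x => polyEval Q x * (Real.log ‖x‖ : ℂ)) :=
  fun φ _ _ => polyLog_apply Q φ

theorem AgreesOffZero.dOp {T : 𝓢'(E n, ℂ)} (hT : AgreesOffZero T 0) (j : Fin n) :
    AgreesOffZero (dOp j T) 0 :=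
  ((hT.lineDerivOp contDiffOn_const _).const_smul _).congr fun x _ => by simp

theorem agreesOffZero_polyDelta (P : MvPolynomial (Fin n) ℂ) : AgreesOffZero (polyDelta P) 0 := by
  have hdelta : AgreesOffZero (TemperedDistribution.delta (0 : E n)) 0 := fun φ _ h0 => by
    simp [image_eq_zero_of_notMem_tsupport h0]
  induction P using MvPolynomial.induction_on with
  | C c =>
    rw [polyDelta_C]
    exact (hdelta.const_smul c).congr fun x _ => by simp
  | add p q hp hq =>
    rw [isLinearMap_polyDelta.map_add]
    exact (hp.add hq contDiffOn_const contDiffOn_const).congr fun x _ => by simp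
  | mul_X p j hp =>
    rw [mul_comm, ← dOp_polyDelta]
    exact hp.dOp j

theorem AgreesOffZero.dil {T : 𝓢'(E n, ℂ)} {w : E n → ℂ} (hT : AgreesOffZero T w) {t : ℝ}
    (ht : 0 < t) : AgreesOffZero (dil t ht T) (fun x => w (t • x)) := by
  intro φ hc h0
  have hcoe : (dilS t⁻¹ (inv_ne_zero ht.ne') φ : E n → ℂ) = fun x => φ (t⁻¹ • x) := rfl
  rw [dil_apply, hT, integral_mul_dilS _ ht]
  · rw [hcoe]
    exact HasCompactSupport.comp_smul (f := (φ : E n → ℂ)) hc (inv_ne_zero ht.ne')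
  · rw [zero_notMem_tsupport_iff] at h0 ⊢
    have hlim : Filter.Tendsto (fun x : E n => t⁻¹ • x) (nhds 0) (nhds 0) :=
      (continuous_const_smul t⁻¹).tendsto' 0 0 (smul_zero _)
    exact hlim.eventually h0

theorem eqOn_of_integral_mul_schwartz_eq {U : Set (E n)} (hU : IsOpen U) {v w : E n → ℂ}
    (hv : ContinuousOn v U) (hw : ContinuousOn w U)
    (h : ∀ φ : 𝓢(E n, ℂ), HasCompactSupport φ → tsupport φ ⊆ U →
      ∫ x, v x * φ x = ∫ x, w x * φ x) : Set.EqOn v w U := by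
  have hint {u : E n → ℂ} (hu : ContinuousOn u U) (φ : 𝓢(E n, ℂ)) (hc : HasCompactSupport φ)
      (hs : tsupport φ ⊆ U) : Integrable fun x => u x * φ x := by
    rw [← integrableOn_iff_integrable_of_support_subset
      ((Function.support_mul_subset_right u φ).trans (subset_tsupport φ))]
    exact ((hu.mono hs).mul φ.continuous.continuousOn).integrableOn_compact hc
  have hae : ∀ᵐ x : E n, x ∈ U → v x - w x = 0 := by
    refine hU.ae_eq_zero_of_integral_contDiff_smul_eq_zero
      ((hv.sub hw).locallyIntegrableOn hU.measurableSet) fun g hg hc hs => ?_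
    have hcs : HasCompactSupport (fun x => (g x : ℂ)) :=
      hc.comp_left (g := fun r : ℝ => (r : ℂ)) Complex.ofReal_zero
    let φ : 𝓢(E n, ℂ) := hcs.toSchwartzMap (Complex.ofRealCLM.contDiff.comp hg)
    have hφU : tsupport φ ⊆ U := (tsupport_comp_subset Complex.ofReal_zero g).trans hs
    calc ∫ x, g x • (v x - w x) = ∫ x, (v x * φ x - w x * φ x) := by
          refine integral_congr_ae (.of_forall fun x => ?_)
          change g x • (v x - w x) = v x * g x - w x * g x
          rw [Complex.real_smul]
          ring
      _ = 0 := by rw [integral_sub (hint hv φ hcs hφU) (hint hw φ hcs hφU), h φ hcs hφU, sub_self]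
  have heq := Measure.eqOn_open_of_ae_eq (μ := (volume : Measure (E n)))
    ((ae_restrict_iff' hU.measurableSet).2 hae) hU (hv.sub hw) continuousOn_const
  exact fun x hx => sub_eq_zero.1 (heq hx)

theorem AgreesOffZero.eq_of_ne_zero {T : 𝓢'(E n, ℂ)} {v w : E n → ℂ} (hv : AgreesOffZero T v)
    (hw : AgreesOffZero T w) (hv' : SmoothOffZero v) (hw' : SmoothOffZero w) {x : E n}
    (hx : x ≠ 0) : v x = w x :=
  eqOn_of_integral_mul_schwartz_eq isOpen_compl_singleton hv'.continuousOn hw'.continuousOn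
    (fun φ hc hs => by
      have h0 : (0 : E n) ∉ tsupport φ := fun h => hs h rfl
      rw [← hv φ hc h0, ← hw φ hc h0]) hx

/-! ### Distributions that are homogeneous up to a logarithm -/

/-- `T` is homogeneous of degree `s` up to a logarithmic term: `T(t ·) = t ^ s (T + log t S)` for
`t > 0`; the distributional version of `IsLogHomogFun`. The elements of `ℋ_s` are such
distributions `T`. -/
def IsLogHomogDist (s : ℝ) (T S : 𝓢'(E n, ℂ)) : Prop :=
  ∀ (t : ℝ) (ht : 0 < t), dil t ht T = ((t ^ s : ℝ) : ℂ) • (T + (Real.log t : ℂ) • S)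

section IsLogHomogDist

variable {s : ℝ} {T T' S S' : 𝓢'(E n, ℂ)}

theorem IsHomogDist.isLogHomogDist (h : IsHomogDist s T) : IsLogHomogDist s T 0 := fun t ht => by
  rw [h t ht]
  module

theorem IsLogHomogDist.isHomogDist (h : IsLogHomogDist s T 0) : IsHomogDist s T := fun t ht => by
  rw [h t ht]
  module

theorem IsLogHomogDist.add (h : IsLogHomogDist s T S) (h' : IsLogHomogDist s T' S') :
    IsLogHomogDist s (T + T') (S + S') := fun t ht => by
  rw [(isLinearMap_dil t ht).map_add, h t ht, h' t ht]
  module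

theorem IsLogHomogDist.const_smul (h : IsLogHomogDist s T S) (c : ℂ) :
    IsLogHomogDist s (c • T) (c • S) := fun t ht => by
  rw [(isLinearMap_dil t ht).map_smul, h t ht]
  module

theorem IsLogHomogDist.fourierD (h : IsLogHomogDist s T S) :
    IsLogHomogDist (-(n : ℝ) - s) (fourierD T) (-fourierD S) := fun t ht => by
  rw [dil_fourierD, h t⁻¹ (inv_pos.2 ht), isLinearMap_fourierD.map_smul,
    isLinearMap_fourierD.map_add, isLinearMap_fourierD.map_smul, Real.log_inv, rpow_neg_sub_eq ht]
  push_cast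
  module

theorem isLogHomogDist_ofFun [NeZero n] {w q : E n → ℂ} (h : IsLogHomogFun s w q)
    (hw : IsTemperedFun w) (hq : IsTemperedFun q) :
    IsLogHomogDist s (ofFun w hw) (ofFun q hq) := by
  intro t ht
  ext φ
  rw [dil_apply, ofFun_apply, integral_mul_dilS _ ht]
  simp only [smul_apply, add_apply, ofFun_apply, smul_eq_mul]
  rw [← integral_const_mul, ← integral_add (hw.integrable_mul φ)
    ((hq.integrable_mul φ).const_mul _), ← integral_const_mul]
  refine integral_congr_ae (ae_ne_zero.mono fun x hx => ?_)
  simp only [h x hx t ht, Complex.real_smul]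
  ring

theorem isLogHomogDist_polyLog [NeZero n] {Q : MvPolynomial (Fin n) ℂ} (hQ : IsHomogPoly s Q) :
    IsLogHomogDist s (polyLog Q) (polyDist Q) := dil_polyLog hQ

/-- The divergence `∑ⱼ ∂ⱼ Vⱼ`. By Euler's relation it recovers a homogeneous function `w` from the
fields `xⱼ w`, which are of one degree higher. -/
def divergence (V : Fin n → 𝓢'(E n, ℂ)) : 𝓢'(E n, ℂ) :=
  ∑ j, ∂_{(EuclideanSpace.single j (1 : ℝ) : E n)} (V j)

theorem divergence_polyDelta (P : Fin n → MvPolynomial (Fin n) ℂ) :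
    divergence (fun j => polyDelta (P j)) =
      polyDelta (∑ j, Complex.I • (MvPolynomial.X j * P j)) := by
  refine Eq.symm ((map_sum (isLinearMap_polyDelta.mk' _) _ _).trans
    (Finset.sum_congr rfl fun j _ => ?_))
  rw [IsLinearMap.mk'_apply, isLinearMap_polyDelta.map_smul, ← dOp_polyDelta, dOp, smul_smul]
  simp

theorem agreesOffZero_divergence {w q : E n → ℂ} (h : IsLogHomogFun s w q)
    (hw : SmoothOffZero w) {V : Fin n → 𝓢'(E n, ℂ)}
    (hV : ∀ j, AgreesOffZero (V j) (fun x => (x j : ℂ) * w x)) :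
    AgreesOffZero (divergence V) (fun x => (n + s : ℝ) * w x + q x) := by
  refine (agreesOffZero_sum Finset.univ (fun j _ => (hV j).lineDerivOp (hw.coord_mul j) _)
    fun j _ => (hw.coord_mul j).fderiv_apply _).congr fun x hx => ?_
  exact h.sum_fderiv_coord_mul
    ((ContDiffOn.contDiffAt hw (isOpen_compl_singleton.mem_nhds hx)).differentiableAt (by simp)) hx

theorem dil_lineDerivOp {t : ℝ} (ht : 0 < t) (v : E n) (T : 𝓢'(E n, ℂ)) :
    dil t ht (∂_{v} T) = ((t⁻¹ : ℝ) : ℂ) • ∂_{v} (dil t ht T) := by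
  ext φ
  have hS : ∂_{v} (dilS t⁻¹ (inv_ne_zero ht.ne') φ) =
      ((t⁻¹ : ℝ) : ℂ) • dilS t⁻¹ (inv_ne_zero ht.ne') (∂_{v} φ) := by
    ext x
    have hcoe : (dilS t⁻¹ (inv_ne_zero ht.ne') φ : E n → ℂ) = fun x => φ (t⁻¹ • x) := rfl
    rw [smul_apply, dilS_apply, lineDerivOp_apply_eq_fderiv, lineDerivOp_apply_eq_fderiv, hcoe,
      fderiv_comp_smul]
    simp
  simp only [smul_apply, dil_apply, TemperedDistribution.lineDerivOp_apply_apply, map_neg, hS,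
    map_smul, smul_eq_mul]
  ring

theorem IsLogHomogDist.divergence {V W : Fin n → 𝓢'(E n, ℂ)}
    (h : ∀ j, IsLogHomogDist (s + 1) (V j) (W j)) :
    IsLogHomogDist s (divergence V) (divergence W) := by
  intro t ht
  have hpow : ((t⁻¹ : ℝ) : ℂ) * ((t ^ (s + 1) : ℝ) : ℂ) = ((t ^ s : ℝ) : ℂ) := by
    rw [← Complex.ofReal_mul, Real.rpow_add_one ht.ne', mul_comm (t ^ s),
      inv_mul_cancel_left₀ ht.ne']
  refine (map_sum ((isLinearMap_dil t ht).mk' _) _ _).trans ?_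
  simp only [IsLinearMap.mk'_apply, HomogDistr.divergence, dil_lineDerivOp, h _ t ht,
    lineDerivOp_add, lineDerivOp_smul, smul_smul, hpow, ← Finset.smul_sum, Finset.sum_add_distrib]

end IsLogHomogDist

/-! ### Existence of prolongations -/

theorem integral_eq_integral_sphere_integral_Ioi [NeZero n] {F : E n → ℂ} (hF : Integrable F) :
    ∫ x, F x = ∫ y : Metric.sphere (0 : E n) 1,
      (∫ r in Set.Ioi (0 : ℝ), ((r ^ (n - 1) : ℝ) : ℂ) * F (r • (y : E n)))
        ∂(volume : Measure (E n)).toSphere := by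
  have : Nonempty (Fin n) := ⟨0⟩
  set e := homeomorphUnitSphereProd (E n)
  have hs : MeasurableSet ({0}ᶜ : Set (E n)) := (measurableSet_singleton _).compl
  have hmp := (volume : Measure (E n)).measurePreserving_homeomorphUnitSphereProd.symm
    e.toMeasurableEquiv
  have hint : Integrable (fun x : ({0}ᶜ : Set (E n)) => F x) ((volume : Measure (E n)).comap (↑)) :=
    (integrableOn_iff_comap_subtypeVal hs (f := F) (μ := volume)).1 hF.integrableOn
  calc ∫ x, F x = ∫ x : ({0}ᶜ : Set (E n)), F x ∂((volume : Measure (E n)).comap (↑)) := by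
        rw [integral_subtype_comap hs F, restrict_compl_singleton]
    _ = _ := (hmp.integral_comp e.symm.measurableEmbedding fun x => F x).symm
    _ = _ := integral_prod _ ((hmp.integrable_comp_emb e.symm.measurableEmbedding).2 hint)
    _ = _ := integral_congr_ae (.of_forall fun y => ?_)
  simp only [Measure.volumeIoiPow, ENNReal.ofReal]
  rw [integral_withDensity_eq_integral_smul (measurable_subtype_coe.pow_const _).real_toNNReal,
    ← integral_subtype_comap measurableSet_Ioi
      fun r : ℝ => ((r ^ (n - 1) : ℝ) : ℂ) * F (r • (y : E n))]
  refine integral_congr_ae (.of_forall fun r => ?_)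
  have hr : (0 : ℝ) < r := r.2
  have hcoe : ((e.toMeasurableEquiv.symm (y, r) : ({0}ᶜ : Set (E n))) : E n) =
      (r : ℝ) • (y : E n) := homeomorphUnitSphereProd_symm_apply_coe _ (y, r)
  simp only [hcoe, NNReal.smul_def, finrank_euclideanSpace, Fintype.card_fin]
  rw [Real.coe_toNNReal _ (pow_nonneg hr.le _), Complex.real_smul]

theorem integral_Ioi_deriv_schwartz (g : 𝓢(ℝ, ℂ)) (a : ℝ) :
    ∫ r in Set.Ioi a, deriv g r = -g a := by
  have hlim : Filter.Tendsto g Filter.atTop (nhds 0) :=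
    (zero_at_infty g.toZeroAtInfty).mono_left atTop_le_cocompact
  rw [integral_Ioi_of_hasDerivAt_of_tendsto' (fun r _ => g.differentiableAt.hasDerivAt)
    (derivCLM ℝ ℂ g).integrable.integrableOn hlim, zero_sub]

theorem integral_Ioi_fderiv_smul (φ : 𝓢(E n, ℂ)) {y : E n} (hy : ‖y‖ = 1) :
    ∫ r in Set.Ioi (0 : ℝ), fderiv ℝ φ (r • y) y = -φ 0 := by
  let ray : ℝ →L[ℝ] E n := ContinuousLinearMap.toSpanSingleton ℝ y
  have hray : AntilipschitzWith 1 ray := by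
    refine AddMonoidHomClass.antilipschitz_of_bound _ fun r => ?_
    simp [ray, norm_smul, hy]
  let g : 𝓢(ℝ, ℂ) := compCLMOfAntilipschitz ℝ ray.hasTemperateGrowth hray φ
  have hg : (g : ℝ → ℂ) = φ ∘ ray := rfl
  have hderiv (r : ℝ) : deriv g r = fderiv ℝ φ (r • y) y := by
    rw [hg, fderiv_comp_deriv r φ.differentiableAt ray.differentiableAt]
    simp [ray]
  simp only [← hderiv]
  rw [integral_Ioi_deriv_schwartz, hg]
  simp

theorem divergence_ofFun_coord_mul [NeZero n] {u : E n → ℂ} (hu : IsHomogFun (-(n : ℝ)) u)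
    (hW : ∀ j, IsTemperedFun fun x : E n => (x j : ℂ) * u x) :
    divergence (fun j => ofFun _ (hW j)) =
      (∫ y : Metric.sphere (0 : E n) 1, u y ∂(volume : Measure (E n)).toSphere) •
        TemperedDistribution.delta (0 : E n) := by
  ext φ
  have hint (j : Fin n) := (hW j).integrable_mul (∂_{(EuclideanSpace.single j (1 : ℝ) : E n)} φ)
  have hradial (x : E n) : ∑ j, (x j : ℂ) * u x *
      (∂_{(EuclideanSpace.single j (1 : ℝ) : E n)} φ : 𝓢(E n, ℂ)) x = u x * fderiv ℝ φ x x := by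
    have hfderiv : fderiv ℝ φ x x =
        ∑ j, (x j : ℂ) * fderiv ℝ φ x (EuclideanSpace.single j (1 : ℝ)) := by
      simp only [← Complex.real_smul, ← map_smul, ← map_sum, sum_smul_single x]
    rw [hfderiv, Finset.mul_sum]
    exact Finset.sum_congr rfl fun j _ => by
      rw [lineDerivOp_apply_eq_fderiv]
      ring
  have hdiv : divergence (fun j => ofFun _ (hW j)) φ = -∫ x, u x * fderiv ℝ φ x x := by
    simp only [divergence, sum_apply, TemperedDistribution.lineDerivOp_apply_apply, map_neg,
      ofFun_apply, Finset.sum_neg_distrib]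
    rw [← integral_finsetSum _ fun j _ => hint j]
    simp only [hradial]
  have hray (y : Metric.sphere (0 : E n) 1) (r : ℝ) (hr : r ∈ Set.Ioi 0) :
      ((r ^ (n - 1) : ℝ) : ℂ) * (u (r • (y : E n)) * fderiv ℝ φ (r • (y : E n)) (r • (y : E n))) =
        u y * fderiv ℝ φ (r • (y : E n)) y := by
    have hr0 : 0 < r := hr
    have hpow : ((r ^ (n - 1) : ℝ) : ℂ) * ((r ^ (-(n : ℝ)) : ℝ) : ℂ) * r = 1 := by
      rw [Real.rpow_neg hr0.le, Real.rpow_natCast, ← Complex.ofReal_mul, ← Complex.ofReal_mul,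
        mul_right_comm, pow_sub_one_mul (NeZero.ne n), mul_inv_cancel₀ (by positivity),
        Complex.ofReal_one]
    rw [hu y (ne_zero_of_mem_unit_sphere y) r hr0, map_smul, Complex.real_smul]
    linear_combination (u y * fderiv ℝ φ (r • (y : E n)) y) * hpow
  rw [hdiv, integral_eq_integral_sphere_integral_Ioi
    ((integrable_finsetSum Finset.univ fun j _ => hint j).congr (.of_forall hradial))]
  simp only [setIntegral_congr_fun measurableSet_Ioi (hray _), integral_const_mul,
    integral_Ioi_fderiv_smul φ (norm_eq_of_mem_sphere _), smul_apply,
    TemperedDistribution.delta_apply, smul_eq_mul, mul_neg, integral_neg, neg_neg,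
    integral_mul_const]

/-- `P` is the polynomial `ξ ↦ ∫ (-i x·ξ) ^ k u(x) / k! dx` over the unit sphere if
`-n - s = k` is a natural number, and `P = 0` otherwise. -/
structure IsSphereMoment (s : ℝ) (u : E n → ℂ) (P : MvPolynomial (Fin n) ℂ) : Prop where
  isHomogPoly : IsHomogPoly (-(n : ℝ) - s) P
  eval_eq : ∀ k : ℕ, (k : ℝ) = -(n : ℝ) - s → ∀ ξ : E n, polyEval P ξ = sphereInt k u ξ

theorem isSphereMoment_zero {s : ℝ} (hs : -(n : ℝ) < s) (u : E n → ℂ) : IsSphereMoment s u 0 :=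
  ⟨(homogPoly n _).zero_mem, fun k hk => absurd hk (by linarith [k.cast_nonneg (α := ℝ)])⟩

theorem isSphereMoment_C (u : E n → ℂ) : IsSphereMoment (-(n : ℝ)) u
    (MvPolynomial.C (∫ y : Metric.sphere (0 : E n) 1, u y ∂(volume : Measure (E n)).toSphere)) := by
  refine ⟨by simpa using isHomogPoly_C _, fun k hk ξ => ?_⟩
  obtain rfl : k = 0 := by simpa using hk
  simp [polyEval, sphereInt]

theorem integrable_sphere {f : E n → ℂ} (hf : ContinuousOn f {0}ᶜ) :
    Integrable (fun y : Metric.sphere (0 : E n) 1 => f y)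
      (volume : Measure (E n)).toSphere := by
  have hcont : Continuous fun y : Metric.sphere (0 : E n) 1 => f y :=
    hf.comp_continuous continuous_subtype_val fun y => ne_zero_of_mem_unit_sphere y
  exact hcont.integrable_of_hasCompactSupport (.of_compactSpace _)

theorem sum_mul_sphereInt_coord_mul {u : E n → ℂ} (hu : SmoothOffZero u) (k : ℕ) (ξ : E n) :
    ∑ j, Complex.I * ξ j * sphereInt k (fun x => (x j : ℂ) * u x) ξ =
      -(k + 1) * sphereInt (k + 1) u ξ := by
  have hint (j : Fin n) : Integrable (fun y : Metric.sphere (0 : E n) 1 =>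
      (-Complex.I * (inner ℝ (y : E n) ξ : ℝ)) ^ k * (((y : E n) j : ℂ) * u y) / (k.factorial : ℂ))
      (volume : Measure (E n)).toSphere :=
    integrable_sphere (f := fun y : E n =>
      (-Complex.I * (inner ℝ y ξ : ℝ)) ^ k * ((y j : ℂ) * u y) / (k.factorial : ℂ))
      (((by fun_prop : Continuous fun y : E n =>
        (-Complex.I * (inner ℝ y ξ : ℝ)) ^ k).continuousOn.mul
        (hu.coord_mul j).continuousOn).div_const _)
  simp only [sphereInt, ← integral_const_mul]
  rw [← integral_finsetSum _ fun j _ => (hint j).const_mul _]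
  refine integral_congr_ae (.of_forall fun y => ?_)
  have hinner : ((inner ℝ (y : E n) ξ : ℝ) : ℂ) = ∑ j, (ξ j : ℂ) * ((y : E n) j : ℂ) := by
    simp [PiLp.inner_apply]
  have hk : (k.factorial : ℂ) ≠ 0 := by exact_mod_cast k.factorial_ne_zero
  have hk1 : (k + 1 : ℂ) ≠ 0 := by exact_mod_cast k.succ_ne_zero
  calc _ = (-Complex.I * (inner ℝ (y : E n) ξ : ℝ)) ^ k * u y / (k.factorial : ℂ) * Complex.I *
        ∑ j, (ξ j : ℂ) * ((y : E n) j : ℂ) := by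
        rw [Finset.mul_sum]
        exact Finset.sum_congr rfl fun j _ => by ring
    _ = _ := by
        rw [← hinner, Nat.factorial_succ]
        push_cast
        field_simp
        ring

theorem IsSphereMoment.of_coord_mul {s : ℝ} (hs : (n : ℝ) + s ≠ 0) {u : E n → ℂ}
    (hu : SmoothOffZero u) {P : Fin n → MvPolynomial (Fin n) ℂ}
    (hP : ∀ j, IsSphereMoment (s + 1) (fun x => (x j : ℂ) * u x) (P j)) :
    IsSphereMoment s u
      (((n + s : ℝ) : ℂ)⁻¹ • ∑ j, Complex.I • (MvPolynomial.X j * P j)) := by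
  refine ⟨(homogPoly n _).smul_mem _ (sum_mem fun j _ => (homogPoly n _).smul_mem _ ?_),
    fun k hk ξ => ?_⟩
  · have h := (hP j).isHomogPoly.X_mul j
    rwa [show -(n : ℝ) - (s + 1) + 1 = -(n : ℝ) - s by ring] at h
  · obtain _ | k := k
    · exact absurd (by push_cast at hk; linarith) hs
    have hval (j : Fin n) := (hP j).eval_eq k (by push_cast at hk; linarith) ξ
    have hns : ((n + s : ℝ) : ℂ) = -(k + 1) := by
      rw [show n + s = -((k + 1 : ℕ) : ℝ) by linarith]
      push_cast
      rfl
    have hk1 : (k + 1 : ℂ) ≠ 0 := by exact_mod_cast k.succ_ne_zero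
    have hsum := sum_mul_sphereInt_coord_mul hu k ξ
    simp only [← hval] at hsum
    simp only [polyEval, MvPolynomial.smul_eval, map_sum, map_mul, MvPolynomial.eval_X] at hsum ⊢
    simp only [← mul_assoc, hsum, hns]
    field_simp

theorem exists_isLogHomogDist_of_neg_lt [NeZero n] {s : ℝ} (hs : -(n : ℝ) < s) {u : E n → ℂ}
    (hu : SmoothOffZero u) (hu' : IsHomogFun s u) :
    ∃ T P, AgreesOffZero T u ∧ IsSphereMoment s u P ∧ IsLogHomogDist s T (polyDelta P) := by
  have hT := hu'.isLogHomogFun.isTemperedFun hs hu contDiffOn_const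
  refine ⟨ofFun u hT, 0, agreesOffZero_ofFun hT, isSphereMoment_zero hs u, ?_⟩
  rw [isLinearMap_polyDelta.map_zero]
  refine IsHomogDist.isLogHomogDist fun t ht => ?_
  ext φ
  rw [dil_apply, ofFun_apply, integral_mul_dilS _ ht, smul_apply, ofFun_apply, smul_eq_mul,
    ← integral_const_mul]
  exact integral_congr_ae (ae_ne_zero.mono fun x hx => by simp only [hu' x hx t ht, mul_assoc])

-- In the critical degree Euler's relation is applied to `u log |x|`, whose defect is `u`.
theorem exists_isLogHomogDist_of_eq_neg [NeZero n] {u : E n → ℂ} (hu : SmoothOffZero u)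
    (hu' : IsHomogFun (-(n : ℝ)) u) :
    ∃ T P, AgreesOffZero T u ∧ IsSphereMoment (-(n : ℝ)) u P ∧
      IsLogHomogDist (-(n : ℝ)) T (polyDelta P) := by
  have hs : -(n : ℝ) < -(n : ℝ) + 1 := lt_add_one _
  have hlog : SmoothOffZero fun x : E n => u x * (Real.log ‖x‖ : ℂ) :=
    ContDiffOn.mul hu smoothOffZero_log
  have hjlog (j : Fin n) : IsLogHomogFun (-(n : ℝ) + 1)
      (fun x : E n => (x j : ℂ) * (u x * (Real.log ‖x‖ : ℂ))) (fun x => (x j : ℂ) * u x) := by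
    simpa only [mul_assoc] using (hu'.coord_mul j).mul_log
  have hV (j : Fin n) := (hjlog j).isTemperedFun hs (hlog.coord_mul j) (hu.coord_mul j)
  have hW (j : Fin n) :=
    (hu'.coord_mul j).isLogHomogFun.isTemperedFun hs (hu.coord_mul j) contDiffOn_const
  refine ⟨divergence fun j => ofFun _ (hV j), _, ?_, isSphereMoment_C u, ?_⟩
  · exact (agreesOffZero_divergence hu'.mul_log hlog fun j => agreesOffZero_ofFun (hV j)).congr
      fun x _ => by simp
  · rw [polyDelta_C, ← divergence_ofFun_coord_mul hu' hW]
    exact IsLogHomogDist.divergence fun j => isLogHomogDist_ofFun (hjlog j) (hV j) (hW j)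

theorem exists_isLogHomogDist_of_coord_mul {s : ℝ} (hs : (n : ℝ) + s ≠ 0) {u : E n → ℂ}
    (hu : SmoothOffZero u) (hu' : IsHomogFun s u)
    (h : ∀ j, ∃ T P, AgreesOffZero T (fun x : E n => (x j : ℂ) * u x) ∧
      IsSphereMoment (s + 1) (fun x : E n => (x j : ℂ) * u x) P ∧
      IsLogHomogDist (s + 1) T (polyDelta P)) :
    ∃ T P, AgreesOffZero T u ∧ IsSphereMoment s u P ∧ IsLogHomogDist s T (polyDelta P) := by
  choose V P hV hP hdefect using h
  have hns : ((n + s : ℝ) : ℂ) ≠ 0 := Complex.ofReal_ne_zero.2 hs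
  refine ⟨((n + s : ℝ) : ℂ)⁻¹ • divergence V, _, ?_, .of_coord_mul hs hu hP, ?_⟩
  · refine ((agreesOffZero_divergence hu'.isLogHomogFun hu hV).const_smul _).congr fun x _ => ?_
    rw [Pi.zero_apply, add_zero, inv_mul_cancel_left₀ hns]
  · rw [isLinearMap_polyDelta.map_smul, ← divergence_polyDelta]
    exact (IsLogHomogDist.divergence hdefect).const_smul _

theorem exists_agreesOffZero_isLogHomogDist [NeZero n] (s : ℝ) {u : E n → ℂ}
    (hu : SmoothOffZero u) (hu' : IsHomogFun s u) :
    ∃ T P, AgreesOffZero T u ∧ IsSphereMoment s u P ∧ IsLogHomogDist s T (polyDelta P) := by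
  obtain ⟨m, hm⟩ := exists_nat_gt (-(n : ℝ) - s)
  induction m generalizing s u with
  | zero => exact exists_isLogHomogDist_of_neg_lt (by push_cast at hm; linarith) hu hu'
  | succ m ih =>
    rcases eq_or_ne s (-(n : ℝ)) with rfl | hs
    · exact exists_isLogHomogDist_of_eq_neg hu hu'
    · exact exists_isLogHomogDist_of_coord_mul (fun h => hs (by linarith)) hu hu' fun j =>
        ih (s + 1) (hu.coord_mul j) (hu'.coord_mul j) (by push_cast at hm; linarith)

/-- `(-i x·ξ)ᵐ / m!`, the homogeneous part of degree `m` of the Taylor expansion of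
`exp (-i x·ξ)` at `x = 0`. -/
def expTerm (ξ : E n) (m : ℕ) (x : E n) : ℂ :=
  (-Complex.I * (inner ℝ x ξ : ℝ)) ^ m / (m.factorial : ℂ)

theorem hasTemperateGrowth_expTerm (ξ : E n) (m : ℕ) : (expTerm ξ m).HasTemperateGrowth :=
  (((Function.HasTemperateGrowth.const (-Complex.I)).mul
    (Complex.ofRealCLM.comp ((innerSL ℝ).flip ξ)).hasTemperateGrowth).pow m).mul
    (Function.HasTemperateGrowth.const ((m.factorial : ℂ)⁻¹))

theorem expTerm_smul (ξ : E n) (m : ℕ) (t : ℝ) (x : E n) :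
    expTerm ξ m (t • x) = ((t ^ m : ℝ) : ℂ) * expTerm ξ m x := by
  simp only [expTerm, inner_smul_left]
  push_cast
  simp
  ring

theorem hasFDerivAt_expTerm (ξ : E n) (m : ℕ) (x : E n) :
    HasFDerivAt (expTerm ξ (m + 1))
      ((-Complex.I * expTerm ξ m x) • Complex.ofRealCLM.comp ((innerSL ℝ).flip ξ)) x := by
  have h1 : HasFDerivAt (fun x : E n => ((inner ℝ x ξ : ℝ) : ℂ))
      (Complex.ofRealCLM.comp ((innerSL ℝ).flip ξ)) x :=
    (Complex.ofRealCLM.comp ((innerSL ℝ).flip ξ)).hasFDerivAt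
  have h2 := ((h1.const_mul (-Complex.I)).pow (m + 1)).mul_const (((m + 1).factorial : ℂ)⁻¹)
  refine h2.congr_fderiv ?_
  ext v
  have : (m.factorial : ℂ) ≠ 0 := by exact_mod_cast m.factorial_ne_zero
  have : (m : ℂ) + 1 ≠ 0 := by exact_mod_cast m.succ_ne_zero
  simp [expTerm, Nat.factorial_succ]
  field_simp

theorem polyDelta_apply_of_eventuallyEq {k : ℕ} {P : MvPolynomial (Fin n) ℂ}
    (hP : P.IsHomogeneous k) (ξ : E n) {c : ℂ} {φ : 𝓢(E n, ℂ)}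
    (hφ : φ =ᶠ[nhds 0] fun x => c * expTerm ξ k x) :
    polyDelta P φ = c * polyEval P ξ := by
  induction k generalizing P c φ with
  | zero =>
    obtain ⟨a, rfl⟩ : ∃ a, P = MvPolynomial.C a :=
      ⟨_, MvPolynomial.totalDegree_eq_zero_iff_eq_C.1
        (Nat.le_zero.1 hP.totalDegree_le)⟩
    simp [polyDelta_C, hφ.self_of_nhds, expTerm, polyEval, mul_comm]
  | succ k ih =>
    have hk : (k + 1 : ℂ) ≠ 0 := by exact_mod_cast k.succ_ne_zero
    have hterm (j : Fin n) : polyDelta (MvPolynomial.X j * MvPolynomial.pderiv j P) φ =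
        c * (ξ j * polyEval (MvPolynomial.pderiv j P) ξ) := by
      rw [← dOp_polyDelta, dOp_apply, ih (c := -Complex.I * ξ j * c) hP.pderiv]
      · linear_combination (-(c * ξ j * polyEval (MvPolynomial.pderiv j P) ξ)) * Complex.I_sq
      · filter_upwards [hφ.eventuallyEq_nhds] with x hx
        have hj : innerSL ℝ ξ (EuclideanSpace.single j 1) = ξ j := by
          simp [EuclideanSpace.inner_single_right]
        rw [lineDerivOp_apply_eq_fderiv, hx.fderiv_eq,
          ((hasFDerivAt_expTerm ξ k x).const_mul c).fderiv]
        simp [hj]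
        ring
    have hsum : (k + 1 : ℂ) • P = ∑ j, MvPolynomial.X j * MvPolynomial.pderiv j P := by
      rw [hP.sum_X_mul_pderiv, ← Nat.cast_smul_eq_nsmul ℂ, Nat.cast_succ]
    refine mul_left_cancel₀ hk ?_
    calc (k + 1 : ℂ) * polyDelta P φ = polyDelta ((k + 1 : ℂ) • P) φ := by
          rw [isLinearMap_polyDelta.map_smul, smul_apply, smul_eq_mul]
      _ = ∑ j, c * (ξ j * polyEval (MvPolynomial.pderiv j P) ξ) := by
          simp only [← hterm, hsum, ← sum_apply]
          exact congrArg (· φ) (map_sum (isLinearMap_polyDelta.mk' _) _ _)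
      _ = c * polyEval ((k + 1 : ℂ) • P) ξ := by
          rw [hsum, ← Finset.mul_sum]
          simp [polyEval]
      _ = (k + 1) * (c * polyEval P ξ) := by
          rw [polyEval, MvPolynomial.smul_eval]
          exact mul_left_comm _ _ _

theorem AgreesOffZero.dil_apply_expTerm {R : 𝓢'(E n, ℂ)} (hR : AgreesOffZero R 0) {t : ℝ}
    (ht : 0 < t) {k : ℕ} {ξ : E n} {φ : 𝓢(E n, ℂ)} (hφ : φ =ᶠ[nhds 0] expTerm ξ k) :
    HomogDistr.dil t ht R φ = ((t ^ (-(n : ℝ) - k) : ℝ) : ℂ) * R φ := by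
  have hlim : Filter.Tendsto (fun x : E n => t⁻¹ • x) (nhds 0) (nhds 0) :=
    (continuous_const_smul t⁻¹).tendsto' 0 0 (smul_zero _)
  have hzero : R (dilS t⁻¹ (inv_ne_zero ht.ne') φ - ((t⁻¹ ^ k : ℝ) : ℂ) • φ) = 0 := by
    refine hR.apply_eq_zero ?_
    filter_upwards [hφ, hlim.eventually hφ] with x hx hx'
    rw [sub_apply, smul_apply, dilS_apply, hx, hx', expTerm_smul, smul_eq_mul, sub_self]
  rw [map_sub, map_smul, sub_eq_zero, smul_eq_mul] at hzero
  rw [dil_apply, hzero, rpow_neg_sub_eq ht, Real.rpow_natCast, mul_assoc]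

theorem AgreesOffZero.isHomogDist {s : ℝ} {R : 𝓢'(E n, ℂ)} (hR : AgreesOffZero R 0)
    (h : ∀ (t : ℝ) (ht : 0 < t), ∃ P, IsHomogPoly (-(n : ℝ) - s) P ∧
      HomogDistr.dil t ht R - ((t ^ s : ℝ) : ℂ) • R = polyDelta P) : IsHomogDist s R := by
  intro t ht
  obtain ⟨P, hP, hRP⟩ := h t ht
  rw [← sub_eq_zero, hRP]
  by_cases hs : ∃ k : ℕ, (k : ℝ) = -(n : ℝ) - s
  · obtain ⟨k, hk⟩ := hs
    have hzero (ξ : E n) : polyEval P ξ = 0 := by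
      obtain ⟨χ, hχ⟩ := exists_isCutoff n
      have hφ : mulS (expTerm ξ k) hχ.isTestFun.toS =ᶠ[nhds 0] expTerm ξ k := by
        filter_upwards [hχ.eq_one] with x hx
        rw [mulS_apply (hasTemperateGrowth_expTerm ξ k)]
        simp [IsTestFun.toS, hx]
      have hPk : P.IsHomogeneous k := isHomogPoly_natCast.1 (hk ▸ hP)
      have hs' : -(n : ℝ) - k = s := by rw [hk]; ring
      rw [← one_mul (polyEval P ξ), ← polyDelta_apply_of_eventuallyEq hPk ξ (by simpa using hφ),
        ← hRP, sub_apply, smul_apply, smul_eq_mul, hR.dil_apply_expTerm ht hφ, hs', sub_self]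
    refine fourierD_injective ?_
    rw [fourierD_polyDelta, isLinearMap_fourierD.map_zero]
    ext φ
    simp [polyDist_apply, hzero]
  · rw [hP.eq_zero (not_exists.1 hs), isLinearMap_polyDelta.map_zero]

theorem IsProlongation.isLogHomogDist {s : ℝ} {u : E n → ℂ} (hu : SmoothOffZero u)
    {S T : 𝓢'(E n, ℂ)} {Q : MvPolynomial (Fin n) ℂ} (hQ : IsHomogPoly (-(n : ℝ) - s) Q)
    (hS : AgreesOffZero S u) (hSQ : IsLogHomogDist s S (polyDelta Q)) (hT : IsProlongation s u T) :
    IsLogHomogDist s T (polyDelta Q) := by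
  have hR : AgreesOffZero (T + (-1 : ℂ) • S) 0 :=
    (hT.agrees.add (hS.const_smul _) hu (contDiffOn_const.mul hu)).congr fun x _ => by simp
  have hhomog : IsHomogDist s (T + (-1 : ℂ) • S) := hR.isHomogDist fun t ht => by
    obtain ⟨P, hP, hTP⟩ := hT.homog t ht
    refine ⟨P - ((t ^ s : ℝ) * Real.log t : ℂ) • Q,
      (homogPoly n _).sub_mem hP ((homogPoly n _).smul_mem _ hQ), ?_⟩
    rw [isLinearMap_polyDelta.map_sub, isLinearMap_polyDelta.map_smul, ← hTP,
      (isLinearMap_dil t ht).map_add, (isLinearMap_dil t ht).map_smul, hSQ t ht]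
    module
  have h := hhomog.isLogHomogDist.add hSQ
  rwa [zero_add, show T + (-1 : ℂ) • S + S = T by module] at h

theorem IsLogHomogDist.isProlongation {s : ℝ} {u : E n → ℂ} {T : 𝓢'(E n, ℂ)}
    {Q : MvPolynomial (Fin n) ℂ} (hQ : IsHomogPoly (-(n : ℝ) - s) Q) (hT : AgreesOffZero T u)
    (hTQ : IsLogHomogDist s T (polyDelta Q)) : IsProlongation s u T where
  agrees := hT
  homog t ht := ⟨((t ^ s : ℝ) * Real.log t : ℂ) • Q, (homogPoly n _).smul_mem _ hQ, by
    rw [hTQ t ht, isLinearMap_polyDelta.map_smul]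
    module⟩

/-! ### Symbols -/

section Symbol

variable {F : Type*} [NormedAddCommGroup F] [NormedSpace ℝ F] {m : ℝ}

/-- `f` is a symbol of order `m`: a smooth function whose derivatives of order `k` grow at most
like `‖x‖ ^ (m - k)` at infinity. -/
structure IsSymbol (m : ℝ) (f : E n → F) : Prop where
  smooth : ContDiff ℝ ∞ f
  exists_norm_le : ∀ k : ℕ, ∃ C : ℝ, ∀ x, ‖iteratedFDeriv ℝ k f x‖ ≤ C * (1 + ‖x‖) ^ (m - k)

theorem rpow_le_two_rpow_abs_mul {r : ℝ} (hr : 1 ≤ r) (a : ℝ) :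
    r ^ a ≤ 2 ^ |a| * (1 + r) ^ a := by
  rcases le_total 0 a with ha | ha
  · calc r ^ a ≤ 1 * (1 + r) ^ a := by
          rw [one_mul]
          exact Real.rpow_le_rpow (by linarith) (by linarith) ha
      _ ≤ 2 ^ |a| * (1 + r) ^ a := by
          gcongr
          exact Real.one_le_rpow one_le_two (abs_nonneg a)
  · calc r ^ a ≤ ((1 + r) / 2) ^ a :=
          Real.rpow_le_rpow_of_nonpos (by linarith) (by linarith) ha
      _ = 2 ^ |a| * (1 + r) ^ a := by
          rw [Real.div_rpow (by linarith) zero_le_two, abs_of_nonpos ha,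
            Real.rpow_neg zero_le_two, div_eq_inv_mul]

theorem isSymbol_of_norm_iteratedFDeriv_le {f : E n → F} (hf : ContDiff ℝ ∞ f) {R : ℝ}
    (hR : 1 ≤ R) (h : ∀ k : ℕ, ∃ C : ℝ, ∀ x, R ≤ ‖x‖ →
      ‖iteratedFDeriv ℝ k f x‖ ≤ C * ‖x‖ ^ (m - k)) : IsSymbol m f := by
  refine ⟨hf, fun k => ?_⟩
  obtain ⟨C, hC⟩ := h k
  have hcont : Continuous fun x => (1 + ‖x‖) ^ (-(m - k)) • iteratedFDeriv ℝ k f x :=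
    (Continuous.rpow_const (by fun_prop) fun x => Or.inl (by positivity)).smul
      (hf.continuous_iteratedFDeriv (by exact_mod_cast le_top))
  obtain ⟨B, hB⟩ := (isCompact_closedBall (0 : E n) R).exists_bound_of_continuousOn
    hcont.continuousOn
  refine ⟨max B (|C| * 2 ^ |m - k|), fun x => ?_⟩
  rcases le_total ‖x‖ R with hx | hx
  · have hBx := hB x (mem_closedBall_zero_iff.2 hx)
    rw [norm_smul, Real.norm_of_nonneg (by positivity), Real.rpow_neg (by positivity),
      inv_mul_le_iff₀ (by positivity), mul_comm] at hBx
    exact hBx.trans (by gcongr; exact le_max_left _ _)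
  · calc ‖iteratedFDeriv ℝ k f x‖ ≤ |C| * ‖x‖ ^ (m - k) :=
          (hC x hx).trans (by gcongr; exact le_abs_self C)
      _ ≤ |C| * (2 ^ |m - k| * (1 + ‖x‖) ^ (m - k)) := by
          gcongr
          exact rpow_le_two_rpow_abs_mul (hR.trans hx) _
      _ ≤ max B (|C| * 2 ^ |m - k|) * (1 + ‖x‖) ^ (m - k) := by
          rw [← mul_assoc]
          gcongr
          exact le_max_right _ _

theorem IsLogHomogFun.exists_norm_iteratedFDeriv_le {s : ℝ} {w q : E n → F}
    (h : IsLogHomogFun s w q) (hw : ContDiffOn ℝ ∞ w {0}ᶜ) (hq : ContDiffOn ℝ ∞ q {0}ᶜ) (k : ℕ) :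
    ∃ C : ℝ, ∀ x, 1 ≤ ‖x‖ → ‖iteratedFDeriv ℝ k w x‖ ≤ C * ‖x‖ ^ (s + 1 - k) := by
  induction k generalizing F s w q with
  | zero =>
    obtain ⟨C, hC0, hC⟩ := h.exists_norm_le hw.continuousOn hq.continuousOn one_pos
    refine ⟨C * 2, fun x hx => ?_⟩
    have hle : ‖x‖ ^ (s - 1) ≤ ‖x‖ ^ (s + 1) := Real.rpow_le_rpow_of_exponent_le hx (by linarith)
    rw [norm_iteratedFDeriv_zero, Nat.cast_zero, sub_zero, mul_assoc]
    exact (hC x (norm_pos_iff.1 (by linarith))).trans (by gcongr; linarith)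
  | succ k ih =>
    have hopen : IsOpen ({0}ᶜ : Set (E n)) := isOpen_compl_singleton
    obtain ⟨C, hC⟩ := ih (h.isLogHomogFun_fderiv hw hq) (hw.fderiv_of_isOpen hopen (by simp))
      (hq.fderiv_of_isOpen hopen (by simp))
    refine ⟨C, fun x hx => ?_⟩
    rw [← norm_iteratedFDeriv_fderiv, Nat.cast_succ,
      show s + 1 - ((k : ℝ) + 1) = s - 1 + 1 - k by ring]
    exact hC x hx

theorem IsLogHomogFun.isSymbol_patch_mul {s : ℝ} {w q : E n → ℂ} (h : IsLogHomogFun s w q)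
    (hw : SmoothOffZero w) (hq : SmoothOffZero q) {θ : E n → ℝ} (hθ : IsPatch θ) :
    IsSymbol (s + 1) fun x => (θ x : ℂ) * w x := by
  have hθ0 : ∀ᶠ x in nhds (0 : E n), (θ x : ℂ) = 0 := hθ.eventually_eq_zero.mono (by simp)
  have hsmooth : ContDiff ℝ ∞ fun x => (θ x : ℂ) * w x := by
    simpa only [mul_comm] using hw.contDiff_mul hθ.hasTemperateGrowth.1 hθ0
  obtain ⟨χ, hχ, hθχ⟩ := hθ
  obtain ⟨R, hR⟩ := hχ.compact.isCompact.isBounded.subset_closedBall 0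
  refine isSymbol_of_norm_iteratedFDeriv_le hsmooth (le_max_left 1 (R + 1)) fun k => ?_
  obtain ⟨C, hC⟩ := h.exists_norm_iteratedFDeriv_le hw hq k
  refine ⟨C, fun x hx => ?_⟩
  have hxχ : x ∉ tsupport χ := fun hx' => by
    have := mem_closedBall_zero_iff.1 (hR hx')
    linarith [le_max_right 1 (R + 1)]
  have heq : (fun y => (θ y : ℂ) * w y) =ᶠ[nhds x] w := by
    filter_upwards [notMem_tsupport_iff_eventuallyEq.1 hxχ] with y hy
    simp [hθχ, hy]
  rw [(heq.iteratedFDeriv ℝ k).eq_of_nhds]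
  exact hC x ((le_max_left _ _).trans hx)

end Symbol

theorem IsSymbol.fderiv_apply {m : ℝ} {f : E n → ℂ} (hf : IsSymbol m f) (v : E n) :
    IsSymbol (m - 1) fun x => fderiv ℝ f x v := by
  have hf' : ContDiff ℝ ∞ (fderiv ℝ f) := hf.smooth.fderiv_right (by simp)
  refine ⟨hf'.clm_apply contDiff_const, fun k => ?_⟩
  obtain ⟨C, hC⟩ := hf.exists_norm_le (k + 1)
  refine ⟨‖v‖ * C, fun x => ?_⟩
  calc ‖iteratedFDeriv ℝ k (fun y => fderiv ℝ f y v) x‖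
      ≤ ‖v‖ * ‖iteratedFDeriv ℝ k (fderiv ℝ f) x‖ :=
        norm_iteratedFDeriv_clm_apply_const hf'.contDiffAt (by exact_mod_cast le_top)
    _ ≤ ‖v‖ * (C * (1 + ‖x‖) ^ (m - (k + 1 : ℕ))) := by
        rw [norm_iteratedFDeriv_fderiv]
        gcongr
        exact hC x
    _ = ‖v‖ * C * (1 + ‖x‖) ^ (m - 1 - k) := by
        rw [mul_assoc, Nat.cast_succ, add_comm (k : ℝ), sub_sub]

theorem IsSymbol.const_mul {m : ℝ} {f : E n → ℂ} (hf : IsSymbol m f) (c : ℂ) :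
    IsSymbol m fun x => c * f x := by
  refine ⟨contDiff_const.mul hf.smooth, fun k => ?_⟩
  obtain ⟨C, hC⟩ := hf.exists_norm_le k
  refine ⟨‖c‖ * C, fun x => ?_⟩
  have h : iteratedFDeriv ℝ k (fun x => c * f x) x = c • iteratedFDeriv ℝ k f x :=
    iteratedFDeriv_const_smul_apply (a := c)
      (hf.smooth.contDiffAt.of_le (by exact_mod_cast le_top))
  rw [h, norm_smul, mul_assoc]
  gcongr
  exact hC x

theorem IsSymbol.sum {m : ℝ} {ι : Type*} {s : Finset ι} {f : ι → E n → ℂ}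
    (hf : ∀ i ∈ s, IsSymbol m (f i)) : IsSymbol m fun x => ∑ i ∈ s, f i x := by
  refine ⟨ContDiff.sum fun i hi => (hf i hi).smooth, fun k => ?_⟩
  choose! C hC using fun i hi => (hf i hi).exists_norm_le k
  refine ⟨∑ i ∈ s, C i, fun x => ?_⟩
  rw [iteratedFDeriv_fun_sum_apply fun i hi =>
    (hf i hi).smooth.contDiffAt.of_le (by exact_mod_cast le_top), Finset.sum_mul]
  exact norm_sum_le_of_le _ fun i hi => hC i hi x

theorem IsTemperedFun.aestronglyMeasurable {f : E n → ℂ} (hf : IsTemperedFun f) :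
    AEStronglyMeasurable f := by
  obtain ⟨N, hN⟩ := hf
  have hcont : Continuous fun x : E n => (1 + ‖x‖) ^ (N : ℝ) :=
    (by fun_prop : Continuous fun x : E n => 1 + ‖x‖).rpow_const fun x => Or.inl (by positivity)
  refine ((Complex.continuous_ofReal.comp hcont).aestronglyMeasurable.mul
    hN.aestronglyMeasurable).congr (.of_forall fun x => ?_)
  have hx : (0 : ℝ) < 1 + ‖x‖ := by positivity
  simp only [Pi.mul_apply, Function.comp_apply]
  rw [← mul_assoc, ← Complex.ofReal_mul, ← Real.rpow_add hx, add_neg_cancel, Real.rpow_zero,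
    Complex.ofReal_one, one_mul]

theorem IsSymbol.hasTemperateGrowth {m : ℝ} {f : E n → ℂ} (hf : IsSymbol m f) :
    f.HasTemperateGrowth := by
  refine ⟨hf.smooth, fun k => ?_⟩
  obtain ⟨C, hC⟩ := hf.exists_norm_le k
  refine ⟨⌈m⌉₊, |C|, fun x => (hC x).trans ?_⟩
  have hx : 1 ≤ 1 + ‖x‖ := by simp
  calc C * (1 + ‖x‖) ^ (m - k) ≤ |C| * (1 + ‖x‖) ^ (⌈m⌉₊ : ℝ) := by
        have hm : m - k ≤ ⌈m⌉₊ := by linarith [Nat.le_ceil m, k.cast_nonneg (α := ℝ)]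
        gcongr
        exact le_abs_self C
    _ = |C| * (1 + ‖x‖) ^ ⌈m⌉₊ := by rw [Real.rpow_natCast]

theorem IsSymbol.integrable_pow_mul {m : ℝ} {f : E n → ℂ} (hf : IsSymbol m f) {k p : ℕ}
    (h : m + k - p < -n) : Integrable fun x => ‖x‖ ^ k * ‖iteratedFDeriv ℝ p f x‖ := by
  obtain ⟨C, hC⟩ := hf.exists_norm_le p
  have hint : Integrable fun x : E n => C * (1 + ‖x‖) ^ (-(-(m + k - p))) :=
    (integrable_one_add_norm (by rw [finrank_euclideanSpace_fin]; linarith)).const_mul C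
  refine hint.mono' (Continuous.aestronglyMeasurable ?_) (.of_forall fun x => ?_)
  · exact (continuous_norm.pow k).mul
      (hf.smooth.continuous_iteratedFDeriv (by exact_mod_cast le_top)).norm
  · rw [Real.norm_of_nonneg (by positivity)]
    calc ‖x‖ ^ k * ‖iteratedFDeriv ℝ p f x‖ ≤ (1 + ‖x‖) ^ k * (C * (1 + ‖x‖) ^ (m - p)) := by
          gcongr
          exacts [by simp, hC x]
      _ = C * (1 + ‖x‖) ^ (-(-(m + k - p))) := by
          rw [mul_left_comm, ← Real.rpow_natCast, ← Real.rpow_add (by positivity)]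
          ring_nf

theorem isTemperedFun_of_hasTemperateGrowth {f : E n → ℂ} (hf : f.HasTemperateGrowth) :
    IsTemperedFun f := by
  obtain ⟨l, C, hC⟩ := hf.2 0
  refine ⟨l + n + 1, ?_⟩
  have hint : Integrable fun x : E n => C * (1 + ‖x‖) ^ (-(n + 1 : ℝ)) :=
    (integrable_one_add_norm (by rw [finrank_euclideanSpace_fin]; linarith)).const_mul C
  have hcont : Continuous fun x : E n => (1 + ‖x‖) ^ (-((l + n + 1 : ℕ) : ℝ)) :=
    (by fun_prop : Continuous fun x : E n => 1 + ‖x‖).rpow_const fun x => Or.inl (by positivity)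
  refine hint.mono' ((Complex.continuous_ofReal.comp hcont).mul
    hf.1.continuous).aestronglyMeasurable (.of_forall fun x => ?_)
  rw [norm_mul, Complex.norm_real, Real.norm_of_nonneg (by positivity)]
  calc (1 + ‖x‖) ^ (-((l + n + 1 : ℕ) : ℝ)) * ‖f x‖
      ≤ (1 + ‖x‖) ^ (-((l + n + 1 : ℕ) : ℝ)) * (C * (1 + ‖x‖) ^ l) := by
        gcongr
        simpa using hC x
    _ = C * (1 + ‖x‖) ^ (-(n + 1 : ℝ)) := by
        rw [mul_left_comm, ← Real.rpow_natCast _ l, ← Real.rpow_add (by positivity)]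
        push_cast
        ring_nf

theorem IsSymbol.isTemperedFun {m : ℝ} {f : E n → ℂ} (hf : IsSymbol m f) : IsTemperedFun f :=
  isTemperedFun_of_hasTemperateGrowth hf.hasTemperateGrowth

theorem IsSymbol.dOp_ofFun {m : ℝ} {f : E n → ℂ} (hf : IsSymbol m f) (j : Fin n) :
    dOp j (ofFun f hf.isTemperedFun) =
      ofFun (fun x => -Complex.I * fderiv ℝ f x (EuclideanSpace.single j 1))
        ((hf.fderiv_apply _).const_mul _).isTemperedFun := by
  set v : E n := EuclideanSpace.single j 1
  ext φ
  have hparts : ∫ x, f x * ∂_{v} φ x = -∫ x, fderiv ℝ f x v * φ x :=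
    integral_mul_fderiv_eq_neg_fderiv_mul_of_integrable
      ((hf.fderiv_apply v).isTemperedFun.integrable_mul φ)
      (hf.isTemperedFun.integrable_mul (∂_{v} φ)) (hf.isTemperedFun.integrable_mul φ)
      (fun x _ => hf.smooth.differentiable (by simp) x) fun x _ => φ.differentiableAt
  simp only [dOp_apply, ofFun_apply, mul_assoc, integral_const_mul]
  rw [hparts, mul_neg, neg_mul]

theorem sum_ofFun {ι : Type*} {s : Finset ι} {f : ι → E n → ℂ} (hf : ∀ i, IsTemperedFun (f i))
    (hs : IsTemperedFun fun x => ∑ i ∈ s, f i x) :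
    ∑ i ∈ s, ofFun (f i) (hf i) = ofFun (fun x => ∑ i ∈ s, f i x) hs := by
  ext φ
  simp only [sum_apply, ofFun_apply, Finset.sum_mul]
  exact (integral_finsetSum _ fun i _ => (hf i).integrable_mul φ).symm

/-- `-Δ` on tempered distributions. -/
def negLaplacian (T : 𝓢'(E n, ℂ)) : 𝓢'(E n, ℂ) := ∑ j, dOp j (dOp j T)

theorem IsSymbol.exists_negLaplacian_eq_ofFun {m : ℝ} {f : E n → ℂ} (hf : IsSymbol m f) :
    ∃ (f' : E n → ℂ) (hf' : IsSymbol (m - 2) f'),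
      negLaplacian (ofFun f hf.isTemperedFun) = ofFun f' hf'.isTemperedFun := by
  have hderiv (j : Fin n) := (((hf.fderiv_apply (EuclideanSpace.single j 1)).const_mul
    (-Complex.I)).fderiv_apply (EuclideanSpace.single j 1)).const_mul (-Complex.I)
  have hsum := IsSymbol.sum fun j (_ : j ∈ Finset.univ) => hderiv j
  rw [sub_sub, one_add_one_eq_two] at hsum
  refine ⟨_, hsum, ?_⟩
  rw [← sum_ofFun (fun j => (hderiv j).isTemperedFun)]
  refine Finset.sum_congr rfl fun j _ => ?_
  rw [hf.dOp_ofFun j, ((hf.fderiv_apply (EuclideanSpace.single j 1)).const_mul _).dOp_ofFun j]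

theorem IsSymbol.exists_iterate_negLaplacian_eq_ofFun {m : ℝ} {f : E n → ℂ} (hf : IsSymbol m f)
    (M : ℕ) : ∃ (f' : E n → ℂ) (hf' : IsSymbol (m - 2 * M) f'),
      negLaplacian^[M] (ofFun f hf.isTemperedFun) = ofFun f' hf'.isTemperedFun := by
  induction M with
  | zero => exact ⟨f, by simpa using hf, rfl⟩
  | succ M ih =>
    obtain ⟨g, hg, hfg⟩ := ih
    obtain ⟨g', hg', hgg'⟩ := hg.exists_negLaplacian_eq_ofFun
    rw [show m - 2 * M - 2 = m - 2 * (M + 1 : ℕ) by push_cast; ring] at hg'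
    exact ⟨g', hg', by rw [Function.iterate_succ_apply', hfg, hgg']⟩

theorem hasTemperateGrowth_norm_pow (M : ℕ) :
    (fun x : E n => ((‖x‖ ^ (2 * M) : ℝ) : ℂ)).HasTemperateGrowth := by
  have h : (fun x : E n => ((‖x‖ ^ 2 : ℝ) : ℂ)).HasTemperateGrowth :=
    Complex.ofRealCLM.hasTemperateGrowth.comp (Function.hasTemperateGrowth_norm_sq (E n))
  simpa [pow_mul, Pi.pow_def] using h.pow M

theorem fourierD_negLaplacian (T : 𝓢'(E n, ℂ)) (φ : 𝓢(E n, ℂ)) :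
    fourierD (negLaplacian T) φ = fourierD T (mulS (fun x => ((‖x‖ ^ (2 * 1) : ℝ) : ℂ)) φ) := by
  have hnorm : mulS (fun x => ((‖x‖ ^ (2 * 1) : ℝ) : ℂ)) φ =
      ∑ j, mulS (fun x => (x j : ℂ)) (mulS (fun x => (x j : ℂ)) φ) := by
    ext x
    rw [mulS_apply (hasTemperateGrowth_norm_pow 1), sum_apply, mul_one,
      EuclideanSpace.real_norm_sq_eq]
    simp only [mulS_apply (hasTemperateGrowth_coord _), ← mul_assoc, ← sq, ← Finset.sum_mul]
    push_cast
    rfl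
  rw [hnorm, map_sum, fourierD_apply, negLaplacian, sum_apply]
  simp only [← fourierD_dOp, ← fourierD_apply]

theorem fourierD_iterate_negLaplacian (M : ℕ) (T : 𝓢'(E n, ℂ)) (φ : 𝓢(E n, ℂ)) :
    fourierD (negLaplacian^[M] T) φ =
      fourierD T (mulS (fun x => ((‖x‖ ^ (2 * M) : ℝ) : ℂ)) φ) := by
  induction M generalizing T with
  | zero => simp
  | succ M ih =>
    rw [Function.iterate_succ_apply, ih, fourierD_negLaplacian,
      smulLeftCLM_smulLeftCLM_apply (hasTemperateGrowth_norm_pow 1)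
        (hasTemperateGrowth_norm_pow M)]
    congr 2
    refine congrArg (fun a : E n → ℂ => mulS a) (funext fun x => ?_)
    rw [Pi.mul_apply, ← Complex.ofReal_mul, ← pow_add, mul_add, add_comm]

/-! ### Schwartz functions as Fourier transforms -/

theorem contDiff_fourierFun {f : E n → ℂ} {K : ℕ}
    (hf : ∀ k ≤ K, Integrable fun x => ‖x‖ ^ k * ‖f x‖) : ContDiff ℝ K (fourierFun f) :=
  (Real.contDiff_fourier (N := (K : ℕ∞)) fun k hk => hf k (by exact_mod_cast hk)).comp
    (contDiff_const_smul _)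

theorem norm_iteratedFDeriv_fourierFun_le {f : E n → ℂ} (hm : AEStronglyMeasurable f) {k : ℕ}
    (hf : ∀ j ≤ k, Integrable fun x => ‖x‖ ^ j * ‖f x‖) (ξ : E n) :
    ‖iteratedFDeriv ℝ k (fourierFun f) ξ‖ ≤ ∫ x, ‖x‖ ^ k * ‖f x‖ := by
  have hf' (j : ℕ) (hj : (j : ℕ∞) ≤ k) : Integrable fun x => ‖x‖ ^ j * ‖f x‖ :=
    hf j (by exact_mod_cast hj)
  have hscale : iteratedFDeriv ℝ k (fourierFun f) ξ =
      (2 * Real.pi)⁻¹ ^ k • iteratedFDeriv ℝ k (𝓕 f) ((2 * Real.pi)⁻¹ • ξ) :=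
    congrFun (iteratedFDeriv_comp_const_smul _ (Real.contDiff_fourier hf')) ξ
  rw [hscale, norm_smul, Real.norm_of_nonneg (by positivity), inv_pow,
    inv_mul_le_iff₀ (by positivity), ← integral_const_mul,
    Real.iteratedFDeriv_fourier hf' hm le_rfl]
  refine (VectorFourier.norm_fourierIntegral_le_integral_norm _ _ _ _ _).trans
    (integral_mono_of_nonneg (.of_forall fun _ => norm_nonneg _) ((hf k le_rfl).const_mul _)
      (.of_forall fun x => ?_))
  calc ‖VectorFourier.fourierPowSMulRight (innerSL ℝ) f x k‖
      ≤ (2 * Real.pi * ‖innerSL ℝ (E := E n)‖) ^ k * ‖x‖ ^ k * ‖f x‖ :=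
        VectorFourier.norm_fourierPowSMulRight_le _ f x k
    _ ≤ (2 * Real.pi * 1) ^ k * ‖x‖ ^ k * ‖f x‖ := by
        gcongr
        exact norm_innerSL_le ℝ
    _ = (2 * Real.pi) ^ k * (‖x‖ ^ k * ‖f x‖) := by rw [mul_one, mul_assoc]

theorem exists_eq_ofSchwartz {S : 𝓢'(E n, ℂ)} (h : ∀ N : ℕ, ∃ f : E n → ℂ, ContDiff ℝ N f ∧
      (∀ k ≤ N, ∃ C : ℝ, ∀ x, (1 + ‖x‖) ^ N * ‖iteratedFDeriv ℝ k f x‖ ≤ C) ∧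
      ∀ φ : 𝓢(E n, ℂ), S φ = ∫ x, f x * φ x) : ∃ g : 𝓢(E n, ℂ), S = ofSchwartz g := by
  choose f hsmooth hbound hf using h
  have heq (N : ℕ) : f N = f 0 := funext fun x =>
    eqOn_of_integral_mul_schwartz_eq isOpen_univ (hsmooth N).continuous.continuousOn
      (hsmooth 0).continuous.continuousOn (fun φ _ _ => (hf N φ).symm.trans (hf 0 φ))
      (Set.mem_univ x)
  simp only [heq] at hsmooth hbound hf
  refine ⟨⟨f 0, contDiff_infty.2 hsmooth, fun p k => ?_⟩, ?_⟩
  · obtain ⟨C, hC⟩ := hbound (max p k) k (le_max_right p k)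
    refine ⟨C, fun x => le_trans ?_ (hC x)⟩
    gcongr
    calc ‖x‖ ^ p ≤ (1 + ‖x‖) ^ p := by gcongr; simp
      _ ≤ (1 + ‖x‖) ^ max p k := pow_le_pow_right₀ (by simp) (le_max_left p k)
  · ext φ
    rw [ofSchwartz_apply, hf 0]
    exact integral_congr_ae (.of_forall fun x => mul_comm _ _)

theorem IsSymbol.exists_norm_iteratedFDeriv_mul_le {m : ℝ} {σ F : E n → ℂ} (hσ : IsSymbol m σ)
    {N k : ℕ} (hm : m ≤ -N) (hF : ContDiff ℝ k F)
    (hbound : ∀ i ≤ k, ∃ C : ℝ, ∀ x, ‖iteratedFDeriv ℝ i F x‖ ≤ C) :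
    ∃ C : ℝ, ∀ x, (1 + ‖x‖) ^ N * ‖iteratedFDeriv ℝ k (fun x => σ x * F x) x‖ ≤ C := by
  choose A hA using hσ.exists_norm_le
  choose! B hB using hbound
  refine ⟨∑ i ∈ Finset.range (k + 1), k.choose i * A i * B (k - i), fun x => ?_⟩
  have hσ' (i : ℕ) : (1 + ‖x‖) ^ N * ‖iteratedFDeriv ℝ i σ x‖ ≤ A i := by
    have hA0 : 0 ≤ A i := by simpa using (norm_nonneg _).trans (hA i 0)
    calc (1 + ‖x‖) ^ N * ‖iteratedFDeriv ℝ i σ x‖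
        ≤ (1 + ‖x‖) ^ N * (A i * (1 + ‖x‖) ^ (m - i)) := by gcongr; exact hA i x
      _ = A i * (1 + ‖x‖) ^ (N + (m - i)) := by
          rw [Real.rpow_add (by positivity), Real.rpow_natCast, mul_left_comm]
      _ ≤ A i * 1 := by
          gcongr
          refine Real.rpow_le_one_of_one_le_of_nonpos (by simp) ?_
          linarith [i.cast_nonneg (α := ℝ)]
      _ = A i := mul_one _
  calc (1 + ‖x‖) ^ N * ‖iteratedFDeriv ℝ k (fun x => σ x * F x) x‖
      ≤ (1 + ‖x‖) ^ N * ∑ i ∈ Finset.range (k + 1), (k.choose i : ℝ) *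
          ‖iteratedFDeriv ℝ i σ x‖ * ‖iteratedFDeriv ℝ (k - i) F x‖ := by
        gcongr
        exact norm_iteratedFDeriv_mul_le (hσ.smooth.of_le (by exact_mod_cast le_top)) hF x le_rfl
    _ = ∑ i ∈ Finset.range (k + 1), (k.choose i : ℝ) *
          ((1 + ‖x‖) ^ N * ‖iteratedFDeriv ℝ i σ x‖) * ‖iteratedFDeriv ℝ (k - i) F x‖ := by
        rw [Finset.mul_sum]
        exact Finset.sum_congr rfl fun i _ => by ring
    _ ≤ ∑ i ∈ Finset.range (k + 1), k.choose i * A i * B (k - i) := by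
        gcongr with i
        · exact mul_nonneg (Nat.cast_nonneg _) ((by positivity : (0 : ℝ) ≤ _).trans (hσ' i))
        · exact hσ' i
        · exact hB _ (Nat.sub_le k i) x

theorem isSymbol_patch_mul_inv_norm_pow {θ : E n → ℝ} (hθ : IsPatch θ) (M : ℕ) :
    IsSymbol (-(2 * M : ℕ) + 1) fun x => (θ x : ℂ) * ((‖x‖ ^ (2 * M))⁻¹ : ℝ) := by
  have hhom : IsHomogFun (-(2 * M : ℕ)) fun x : E n => (((‖x‖ ^ (2 * M))⁻¹ : ℝ) : ℂ) := by
    intro x _ t ht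
    beta_reduce
    rw [norm_smul, Real.norm_of_nonneg ht.le, mul_pow, mul_inv, Real.rpow_neg ht.le,
      Real.rpow_natCast, Complex.ofReal_mul]
  refine hhom.isLogHomogFun.isSymbol_patch_mul (fun x hx => ?_) contDiffOn_const hθ
  exact (Complex.ofRealCLM.contDiff.contDiffAt.comp x (((contDiffAt_norm ℝ hx).pow _).inv
    (pow_ne_zero _ (norm_ne_zero_iff.2 hx)))).contDiffWithinAt

theorem mulDist_fourierD_apply_of_iterate_negLaplacian {S : 𝓢'(E n, ℂ)} {M : ℕ} {f : E n → ℂ}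
    {hf : IsTemperedFun f} (hint : Integrable f) (hS : negLaplacian^[M] S = ofFun f hf)
    {θ : E n → ℝ} (hθ : IsPatch θ) (φ : 𝓢(E n, ℂ)) : mulDist θ (fourierD S) φ =
      ∫ x, (θ x : ℂ) * ((‖x‖ ^ (2 * M))⁻¹ : ℝ) * fourierFun f x * φ x := by
  have hσ := (isSymbol_patch_mul_inv_norm_pow hθ M).hasTemperateGrowth
  have hθφ : mulS (fun x => (θ x : ℂ)) φ = mulS (fun x => ((‖x‖ ^ (2 * M) : ℝ) : ℂ))
      (mulS (fun x => (θ x : ℂ) * ((‖x‖ ^ (2 * M))⁻¹ : ℝ)) φ) := by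
    ext x
    rw [mulS_apply hθ.hasTemperateGrowth, mulS_apply (hasTemperateGrowth_norm_pow M),
      mulS_apply hσ]
    rcases eq_or_ne x 0 with rfl | hx
    · simp [hθ.eventually_eq_zero.self_of_nhds]
    · have hx' : (‖x‖ : ℂ) ≠ 0 := by simpa using hx
      push_cast
      field_simp
  rw [mulDist_apply, hθφ, ← fourierD_iterate_negLaplacian, hS, fourierD_apply, ofFun_apply,
    ← integral_fourierFun_mul hint]
  refine integral_congr_ae (.of_forall fun x => ?_)
  simp only [mulS_apply hσ]
  ring

theorem exists_mulDist_fourierD_eq_ofSchwartz {S : 𝓢'(E n, ℂ)}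
    (h : ∀ N : ℕ, ∃ M > N, ∃ (f : E n → ℂ) (hf : IsTemperedFun f),
      (∀ k ≤ N, Integrable fun x => ‖x‖ ^ k * ‖f x‖) ∧ negLaplacian^[M] S = ofFun f hf)
    {θ : E n → ℝ} (hθ : IsPatch θ) : ∃ g : 𝓢(E n, ℂ), mulDist θ (fourierD S) = ofSchwartz g := by
  refine exists_eq_ofSchwartz fun N => ?_
  obtain ⟨M, hM, f, hf, hfint, hS⟩ := h N
  have hσ := isSymbol_patch_mul_inv_norm_pow hθ M
  have hmeas : AEStronglyMeasurable f := hf.aestronglyMeasurable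
  have hint : Integrable f := (integrable_norm_iff hmeas).1 (by simpa using hfint 0 N.zero_le)
  have hM' : (-(2 * M : ℕ) + 1 : ℝ) ≤ -N := by
    have : (N : ℝ) + 1 ≤ M := by exact_mod_cast hM
    push_cast
    linarith [N.cast_nonneg (α := ℝ)]
  refine ⟨_, (hσ.smooth.of_le (by exact_mod_cast le_top)).mul (contDiff_fourierFun hfint),
    fun k hk => hσ.exists_norm_iteratedFDeriv_mul_le hM'
      (contDiff_fourierFun fun j hj => hfint j (hj.trans hk)) fun i hi => ⟨_, fun x =>
        norm_iteratedFDeriv_fourierFun_le hmeas (fun j hj => hfint j (hj.trans (hi.trans hk))) x⟩,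
    mulDist_fourierD_apply_of_iterate_negLaplacian hint hS hθ⟩

theorem IsSymbol.exists_mulDist_fourierD_eq_ofSchwartz {m : ℝ} {f : E n → ℂ} (hf : IsSymbol m f)
    {θ : E n → ℝ} (hθ : IsPatch θ) :
    ∃ g : 𝓢(E n, ℂ), mulDist θ (fourierD (ofFun f hf.isTemperedFun)) = ofSchwartz g := by
  refine HomogDistr.exists_mulDist_fourierD_eq_ofSchwartz (fun N => ?_) hθ
  obtain ⟨M, hM⟩ := exists_nat_gt (|m| + N + n)
  obtain ⟨f', hf', h⟩ := hf.exists_iterate_negLaplacian_eq_ofFun M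
  refine ⟨M, ?_, f', hf'.isTemperedFun, fun k hk => ?_, h⟩
  · have : (N : ℝ) < M := by linarith [abs_nonneg m, n.cast_nonneg (α := ℝ)]
    exact_mod_cast this
  · have hk' : (k : ℝ) ≤ N := by exact_mod_cast hk
    simpa using hf'.integrable_pow_mul (k := k) (p := 0) (by
      push_cast
      linarith [le_abs_self m, abs_nonneg m, n.cast_nonneg (α := ℝ), N.cast_nonneg (α := ℝ)])

/-! ### Localizations of the Fourier transform of a compactly supported distribution -/

theorem exists_memLp_eq_integral {S : 𝓢'(E n, ℂ)} {C : ℝ}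
    (hS : ∀ φ : 𝓢(E n, ℂ), ‖S φ‖ ≤ C * ‖φ.toLp 2‖) :
    ∃ v : E n → ℂ, MemLp v 2 ∧ ∀ φ : 𝓢(E n, ℂ), S φ = ∫ x, v x * φ x := by
  let e : 𝓢(E n, ℂ) →ₗ[ℂ] Lp ℂ 2 (volume : Measure (E n)) := (toLpCLM ℂ ℂ 2 volume).toLinearMap
  let L := (S : 𝓢(E n, ℂ) →ₗ[ℂ] ℂ).extendOfNorm e
  let w := (InnerProductSpace.toDual ℂ (Lp ℂ 2 (volume : Measure (E n)))).symm L
  refine ⟨fun x => (starRingEnd ℂ) (w x), (Lp.memLp w).star, fun φ => ?_⟩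
  have hL : L (φ.toLp 2) = S φ :=
    LinearMap.extendOfNorm_eq (f := (S : 𝓢(E n, ℂ) →ₗ[ℂ] ℂ)) (e := e)
      (denseRange_toLpCLM (by simp)) ⟨C, hS⟩ φ
  rw [← hL, ← InnerProductSpace.toDual_symm_apply, L2.inner_def]
  refine integral_congr_ae ?_
  filter_upwards [φ.coeFn_toLp 2] with x hx
  rw [hx, RCLike.inner_apply, mul_comm]

theorem IsTestFun.memLp_norm_pow_mul {ρ : E n → ℝ} (hρ : IsTestFun ρ) (j : ℕ) :
    MemLp (fun x => ‖x‖ ^ j * ρ x) 2 :=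
  ((continuous_norm.pow j).mul hρ.smooth.continuous).memLp_of_hasCompactSupport
    hρ.compact.mul_left

theorem norm_pow_mul_norm_ofReal_mul (ρ : E n → ℝ) (v : E n → ℂ) (j : ℕ) (x : E n) :
    ‖x‖ ^ j * ‖(ρ x : ℂ) * v x‖ = ‖(‖x‖ ^ j * ρ x) • v x‖ := by
  rw [norm_smul, norm_mul, norm_mul, Complex.norm_real, norm_pow, norm_norm, mul_assoc]

theorem IsTestFun.integrable_norm_pow_mul {ρ : E n → ℝ} (hρ : IsTestFun ρ) {v : E n → ℂ}
    (hv : MemLp v 2) (j : ℕ) : Integrable fun x => ‖x‖ ^ j * ‖(ρ x : ℂ) * v x‖ := by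
  simp only [norm_pow_mul_norm_ofReal_mul]
  have hint : MemLp (fun x => (‖x‖ ^ j * ρ x) • v x) 1 := hv.smul (hρ.memLp_norm_pow_mul j)
  exact (memLp_one_iff_integrable.1 hint).norm

theorem integral_norm_smul_le_of_memLp_two {α : Type*} [MeasurableSpace α] {μ : Measure α}
    {g : α → ℝ} {v : α → ℂ} (hg : MemLp g 2 μ) (hv : MemLp v 2 μ) :
    ∫ x, ‖g x • v x‖ ∂μ ≤ (eLpNorm g 2 μ).toReal * (eLpNorm v 2 μ).toReal := by
  have hholder : eLpNorm (g • v) 1 μ ≤ eLpNorm g 2 μ * eLpNorm v 2 μ :=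
    eLpNorm_smul_le_mul_eLpNorm hv.1 hg.1
  have hint : ∫ x, ‖g x • v x‖ ∂μ = (eLpNorm (g • v) 1 μ).toReal := by
    rw [eLpNorm_one_eq_lintegral_enorm]
    exact integral_norm_eq_lintegral_enorm (hg.1.smul hv.1)
  rw [hint, ← ENNReal.toReal_mul]
  exact ENNReal.toReal_mono (ENNReal.mul_ne_top hg.2.ne hv.2.ne) hholder

theorem IsTestFun.exists_norm_iteratedFDeriv_fourierS_mulS_le {ρ : E n → ℝ} (hρ : IsTestFun ρ)
    (j : ℕ) : ∃ C : ℝ, 0 ≤ C ∧ ∀ (φ : 𝓢(E n, ℂ)) (x : E n),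
      ‖iteratedFDeriv ℝ j (fourierS (mulS (fun x => (ρ x : ℂ)) φ)) x‖ ≤ C * ‖φ.toLp 2‖ := by
  refine ⟨(eLpNorm (fun x => ‖x‖ ^ j * ρ x) 2 volume).toReal, ENNReal.toReal_nonneg,
    fun φ x => ?_⟩
  have hφ := φ.memLp 2
  have hint (i : ℕ) := hρ.integrable_norm_pow_mul hφ i
  have hle := integral_norm_smul_le_of_memLp_two (hρ.memLp_norm_pow_mul j) hφ
  simp only [← norm_pow_mul_norm_ofReal_mul] at hle
  rw [coe_fourierS, norm_toLp, coe_mulS hρ.hasTemperateGrowth]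
  exact (norm_iteratedFDeriv_fourierFun_le
    ((hρ.ofReal_smooth.continuous.mul φ.continuous).aestronglyMeasurable)
    (fun i _ => hint i) x).trans hle

theorem exists_seminorm_mulS_le_of_norm_iteratedFDeriv_le (η : 𝓢(E n, ℂ)) (k l : ℕ) :
    ∃ C : ℝ, ∀ (B : ℝ) (ψ : 𝓢(E n, ℂ)), 0 ≤ B →
      (∀ j ≤ l, ∀ x, ‖iteratedFDeriv ℝ j ψ x‖ ≤ B) →
      SchwartzMap.seminorm ℂ k l (mulS ψ η) ≤ C * B := by
  obtain ⟨C, hC⟩ := exists_seminorm_mulS_le η k l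
  exact ⟨C, fun B ψ hB h => hC B ψ hB ψ.hasTemperateGrowth fun j hj x => (h j hj x).trans
    (le_mul_of_one_le_right hB (le_add_of_nonneg_right (norm_nonneg x)))⟩

theorem IsTestFun.exists_seminorm_mulS_fourierS_mulS_le {ρ : E n → ℝ} (hρ : IsTestFun ρ)
    (η : 𝓢(E n, ℂ)) (k l : ℕ) : ∃ C : ℝ, ∀ φ : 𝓢(E n, ℂ), SchwartzMap.seminorm ℂ k l
      (mulS (fourierS (mulS (fun x => (ρ x : ℂ)) φ)) η) ≤ C * ‖φ.toLp 2‖ := by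
  choose D hD0 hD using hρ.exists_norm_iteratedFDeriv_fourierS_mulS_le
  obtain ⟨C, hC⟩ := exists_seminorm_mulS_le_of_norm_iteratedFDeriv_le η k l
  have hDsum : 0 ≤ ∑ j ∈ Finset.range (l + 1), D j := Finset.sum_nonneg fun j _ => hD0 j
  refine ⟨C * ∑ j ∈ Finset.range (l + 1), D j, fun φ => ?_⟩
  rw [mul_assoc]
  refine hC _ _ (mul_nonneg hDsum (norm_nonneg _)) fun j hj x => (hD j φ x).trans ?_
  exact mul_le_mul_of_nonneg_right (Finset.single_le_sum (fun i _ => hD0 i)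
    (Finset.mem_range.2 (Nat.lt_succ_iff.2 hj))) (norm_nonneg _)

theorem IsTestFun.mulS_eq_mulS_toS {χ : E n → ℝ} (hχ : IsTestFun χ) (ψ : 𝓢(E n, ℂ)) :
    mulS (fun x => (χ x : ℂ)) ψ = mulS ψ hχ.toS := by
  ext x
  rw [mulS_apply hχ.hasTemperateGrowth, mulS_apply ψ.hasTemperateGrowth, mul_comm]
  rfl

theorem exists_norm_apply_le_sum_seminorm (T : 𝓢'(E n, ℂ)) : ∃ (s : Finset (ℕ × ℕ)) (A : ℝ),
    0 ≤ A ∧ ∀ ψ : 𝓢(E n, ℂ), ‖T ψ‖ ≤ A * ∑ i ∈ s, SchwartzMap.seminorm ℂ i.1 i.2 ψ := by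
  obtain ⟨s, A, -, hA⟩ := Seminorm.bound_of_continuous (schwartz_withSeminorms ℂ (E n) ℂ)
    ((normSeminorm ℂ ℂ).comp (T : 𝓢(E n, ℂ) →ₗ[ℂ] ℂ)) (map_continuous T).norm
  refine ⟨s, A, A.2, fun ψ => (hA ψ).trans ?_⟩
  exact mul_le_mul_of_nonneg_left (Seminorm.finset_sup_apply_le
    (Finset.sum_nonneg fun i _ => apply_nonneg _ ψ) fun i hi =>
      Finset.single_le_sum (f := fun i : ℕ × ℕ => SchwartzMap.seminorm ℂ i.1 i.2 ψ)
        (fun i _ => apply_nonneg _ ψ) hi) A.2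

theorem IsTestFun.exists_norm_mulDist_fourierD_mulDist_le {χ ρ : E n → ℝ} (hχ : IsTestFun χ)
    (hρ : IsTestFun ρ) (T : 𝓢'(E n, ℂ)) : ∃ C : ℝ, ∀ φ : 𝓢(E n, ℂ),
      ‖mulDist ρ (fourierD (mulDist χ T)) φ‖ ≤ C * ‖φ.toLp 2‖ := by
  obtain ⟨s, A, hA0, hA⟩ := exists_norm_apply_le_sum_seminorm T
  choose C hC using hρ.exists_seminorm_mulS_fourierS_mulS_le hχ.toS
  refine ⟨A * ∑ i ∈ s, C i.1 i.2, fun φ => ?_⟩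
  rw [mulDist_apply, fourierD_apply, mulDist_apply, hχ.mulS_eq_mulS_toS, mul_assoc,
    Finset.sum_mul]
  refine (hA _).trans ?_
  gcongr with i
  exact hC i.1 i.2 φ

theorem fourierS_lineDerivOp (j : Fin n) (φ : 𝓢(E n, ℂ)) :
    fourierS (∂_{(EuclideanSpace.single j (1 : ℝ) : E n)} φ) =
      Complex.I • mulS (fun x => (x j : ℂ)) (fourierS φ) := by
  have hpi : (Real.pi : ℂ) ≠ 0 := by exact_mod_cast Real.pi_ne_zero
  ext ξ
  rw [smul_apply, mulS_apply (hasTemperateGrowth_coord j), fourierS_eq, fourierS_eq,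
    SchwartzMap.fourier_lineDerivOp_eq, smul_apply, smulLeftCLM_apply_apply (by fun_prop)]
  simp only [EuclideanSpace.inner_single_right, smul_eq_mul, Complex.real_smul, PiLp.smul_apply]
  push_cast
  simp
  field_simp

theorem IsTestFun.coord_mul {ρ : E n → ℝ} (hρ : IsTestFun ρ) (j : Fin n) :
    IsTestFun fun x => x j * ρ x :=
  ⟨(EuclideanSpace.proj (𝕜 := ℝ) j : E n →L[ℝ] ℝ).contDiff.mul hρ.smooth, hρ.compact.mul_left⟩

theorem IsTestFun.fderiv_apply {ρ : E n → ℝ} (hρ : IsTestFun ρ) (v : E n) :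
    IsTestFun fun x => fderiv ℝ ρ x v :=
  ⟨(hρ.smooth.fderiv_right (by simp)).clm_apply contDiff_const, hρ.compact.fderiv_apply ℝ v⟩

theorem dOp_fourierD_mulDist {χ : E n → ℝ} (hχ : IsTestFun χ) (j : Fin n) (T : 𝓢'(E n, ℂ)) :
    dOp j (fourierD (mulDist χ T)) = (-1 : ℂ) • fourierD (mulDist (fun x => x j * χ x) T) := by
  ext φ
  have hmul : mulS (fun x => (χ x : ℂ)) (mulS (fun x => (x j : ℂ)) (fourierS φ)) =
      mulS (fun x => ((x j * χ x : ℝ) : ℂ)) (fourierS φ) := by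
    ext x
    rw [mulS_apply hχ.hasTemperateGrowth, mulS_apply (hasTemperateGrowth_coord j),
      mulS_apply (hχ.coord_mul j).hasTemperateGrowth]
    push_cast
    ring
  rw [dOp_apply, fourierD_apply, mulDist_apply, fourierS_lineDerivOp, map_smul, map_smul, hmul,
    smul_apply, fourierD_apply, mulDist_apply, smul_eq_mul, smul_eq_mul, ← mul_assoc,
    Complex.I_mul_I]

theorem mulS_lineDerivOp {ρ : E n → ℝ} (hρ : IsTestFun ρ) (v : E n) (φ : 𝓢(E n, ℂ)) :
    mulS (fun x => (ρ x : ℂ)) (∂_{v} φ) = ∂_{v} (mulS (fun x => (ρ x : ℂ)) φ) -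
      mulS (fun x => ((fderiv ℝ ρ x v : ℝ) : ℂ)) φ := by
  ext x
  have hρx : DifferentiableAt ℝ ρ x := hρ.smooth.differentiable (by simp) x
  have hρx' : HasFDerivAt (fun x => (ρ x : ℂ)) _ x :=
    Complex.ofRealCLM.hasFDerivAt.comp x hρx.hasFDerivAt
  have hprod : HasFDerivAt (fun x => (ρ x : ℂ) * φ x) _ x :=
    hρx'.mul φ.differentiableAt.hasFDerivAt
  rw [mulS_apply hρ.hasTemperateGrowth, sub_apply, lineDerivOp_apply_eq_fderiv,
    lineDerivOp_apply_eq_fderiv, coe_mulS hρ.hasTemperateGrowth,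
    mulS_apply (hρ.fderiv_apply v).hasTemperateGrowth, hprod.fderiv]
  simp
  ring

theorem dOp_mulDist {ρ : E n → ℝ} (hρ : IsTestFun ρ) (j : Fin n) (T : 𝓢'(E n, ℂ)) :
    dOp j (mulDist ρ T) = mulDist ρ (dOp j T) +
      (-Complex.I) • mulDist (fun x => fderiv ℝ ρ x (EuclideanSpace.single j 1)) T := by
  ext φ
  simp only [add_apply, smul_apply, dOp_apply, mulDist_apply, mulS_lineDerivOp hρ, map_sub,
    smul_eq_mul]
  ring

/-- The span of the localized Fourier transforms of compactly supported tempered distributions.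
It is invariant under differentiation, which is what makes its elements smooth. -/
def localizedFourier (n : ℕ) : Submodule ℂ 𝓢'(E n, ℂ) :=
  Submodule.span ℂ {S | ∃ (ρ χ : E n → ℝ) (T : 𝓢'(E n, ℂ)), IsTestFun ρ ∧ IsTestFun χ ∧
    S = mulDist ρ (fourierD (mulDist χ T))}

theorem mulDist_fourierD_mulDist_mem {ρ χ : E n → ℝ} (hρ : IsTestFun ρ) (hχ : IsTestFun χ)
    (T : 𝓢'(E n, ℂ)) : mulDist ρ (fourierD (mulDist χ T)) ∈ localizedFourier n :=
  Submodule.subset_span ⟨ρ, χ, T, hρ, hχ, rfl⟩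

theorem isLinearMap_dOp (j : Fin n) : IsLinearMap ℂ (dOp j) where
  map_add S T := by ext φ; simp only [dOp_apply, add_apply, mul_add]
  map_smul c T := by ext φ; simp only [dOp_apply, smul_apply, smul_eq_mul, mul_left_comm]

theorem dOp_mem_localizedFourier {S : 𝓢'(E n, ℂ)} (hS : S ∈ localizedFourier n) (j : Fin n) :
    dOp j S ∈ localizedFourier n := by
  induction hS using Submodule.span_induction with
  | mem S hS =>
    obtain ⟨ρ, χ, T, hρ, hχ, rfl⟩ := hS
    rw [dOp_mulDist hρ, dOp_fourierD_mulDist hχ, (isLinearMap_mulDist ρ).map_smul]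
    exact add_mem
      (Submodule.smul_mem _ _ (mulDist_fourierD_mulDist_mem hρ (hχ.coord_mul j) T))
      (Submodule.smul_mem _ _ (mulDist_fourierD_mulDist_mem (hρ.fderiv_apply _) hχ T))
  | zero => simpa only [(isLinearMap_dOp j).map_zero] using zero_mem _
  | add S S' _ _ h h' => simpa only [(isLinearMap_dOp j).map_add] using add_mem h h'
  | smul c S _ h => simpa only [(isLinearMap_dOp j).map_smul] using Submodule.smul_mem _ c h

theorem iterate_negLaplacian_mem_localizedFourier {S : 𝓢'(E n, ℂ)}
    (hS : S ∈ localizedFourier n) (M : ℕ) : negLaplacian^[M] S ∈ localizedFourier n := by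
  induction M with
  | zero => exact hS
  | succ M ih =>
    rw [Function.iterate_succ_apply']
    exact sum_mem fun j _ => dOp_mem_localizedFourier (dOp_mem_localizedFourier ih j) j

theorem IsTestFun.exists_isTestFun_mul_eq {ρ : E n → ℝ} (hρ : IsTestFun ρ) :
    ∃ η : E n → ℝ, IsTestFun η ∧ ∀ x, η x * ρ x = ρ x := by
  obtain ⟨r, hr⟩ := hρ.compact.isCompact.isBounded.subset_closedBall (0 : E n)
  let b : ContDiffBump (0 : E n) :=
    ⟨max r 1, max r 1 + 1, lt_max_of_lt_right one_pos, lt_add_one _⟩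
  refine ⟨b, ⟨b.contDiff, b.hasCompactSupport⟩, fun x => ?_⟩
  by_cases hx : x ∈ tsupport ρ
  · rw [b.one_of_mem_closedBall (Metric.closedBall_subset_closedBall (le_max_left _ _) (hr hx)),
      one_mul]
  · rw [image_eq_zero_of_notMem_tsupport hx, mul_zero]

theorem mulDist_mulDist {f g h : E n → ℝ} (hf : (fun x => (f x : ℂ)).HasTemperateGrowth)
    (hg : (fun x => (g x : ℂ)).HasTemperateGrowth) (hfg : ∀ x, f x * g x = h x)
    (T : 𝓢'(E n, ℂ)) : mulDist f (mulDist g T) = mulDist h T := by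
  obtain rfl : (fun x => f x * g x) = h := funext hfg
  ext φ
  have hmul : mulS (fun x => (g x : ℂ)) (mulS (fun x => (f x : ℂ)) φ) =
      mulS (fun x => ((f x * g x : ℝ) : ℂ)) φ := by
    ext x
    rw [mulS_apply hg, mulS_apply hf, mulS_apply (by push_cast; exact hf.mul hg), ← mul_assoc,
      ← Complex.ofReal_mul, mul_comm (g x)]
  rw [mulDist_apply, mulDist_apply, hmul, mulDist_apply]

theorem isTemperedFun_of_integrable {f : E n → ℂ} (hf : Integrable f) : IsTemperedFun f :=
  ⟨0, by simpa using hf⟩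

theorem IsTestFun.exists_mulDist_fourierD_mulDist_eq_ofFun {ρ χ : E n → ℝ} (hρ : IsTestFun ρ)
    (hχ : IsTestFun χ) (T : 𝓢'(E n, ℂ)) : ∃ (f : E n → ℂ) (hf : IsTemperedFun f),
      (∀ k : ℕ, Integrable fun x => ‖x‖ ^ k * ‖f x‖) ∧
      mulDist ρ (fourierD (mulDist χ T)) = ofFun f hf := by
  obtain ⟨C, hC⟩ := exists_norm_mulDist_fourierD_mulDist_le hχ hρ T
  obtain ⟨v, hv, hvS⟩ := exists_memLp_eq_integral hC
  obtain ⟨η, hη, hηρ⟩ := hρ.exists_isTestFun_mul_eq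
  have hmoment := hη.integrable_norm_pow_mul hv
  have hint : Integrable fun x => (η x : ℂ) * v x := (integrable_norm_iff
    (hη.ofReal_smooth.continuous.aestronglyMeasurable.mul hv.1)).1 (by simpa using hmoment 0)
  refine ⟨_, isTemperedFun_of_integrable hint, hmoment, ?_⟩
  rw [← mulDist_mulDist hη.hasTemperateGrowth hρ.hasTemperateGrowth hηρ]
  ext φ
  rw [mulDist_apply, hvS, ofFun_apply]
  simp only [mulS_apply hη.hasTemperateGrowth, mul_left_comm, mul_assoc]

theorem exists_eq_ofFun_of_mem_localizedFourier {S : 𝓢'(E n, ℂ)} (hS : S ∈ localizedFourier n) :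
    ∃ (f : E n → ℂ) (hf : IsTemperedFun f),
      (∀ k : ℕ, Integrable fun x => ‖x‖ ^ k * ‖f x‖) ∧ S = ofFun f hf := by
  induction hS using Submodule.span_induction with
  | mem S hS =>
    obtain ⟨ρ, χ, T, hρ, hχ, rfl⟩ := hS
    exact hρ.exists_mulDist_fourierD_mulDist_eq_ofFun hχ T
  | zero =>
    refine ⟨0, isTemperedFun_of_integrable (integrable_zero _ _ _), fun k => by simp, ?_⟩
    ext φ
    simp [ofFun_apply]
  | add S S' _ _ h h' =>
    obtain ⟨f, hf, hfint, rfl⟩ := h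
    obtain ⟨g, hg, hgint, rfl⟩ := h'
    refine ⟨f + g, hf.add hg, fun k => ?_, ?_⟩
    · have hmeas : AEStronglyMeasurable fun x => ‖x‖ ^ k * ‖(f + g) x‖ :=
        (continuous_norm.pow k).aestronglyMeasurable.mul
          (hf.add hg).aestronglyMeasurable.norm
      refine ((hfint k).add (hgint k)).mono' hmeas (.of_forall fun x => ?_)
      rw [norm_mul, norm_pow, norm_norm, norm_norm, Pi.add_apply, Pi.add_apply, ← mul_add]
      gcongr
      exact norm_add_le _ _
    · ext φ
      simp only [add_apply, ofFun_apply, Pi.add_apply, add_mul]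
      exact (integral_add (hf.integrable_mul φ) (hg.integrable_mul φ)).symm
  | smul c S _ h =>
    obtain ⟨f, hf, hfint, rfl⟩ := h
    refine ⟨_, hf.const_mul c, fun k => ?_, ?_⟩
    · simpa only [norm_mul, mul_left_comm] using (hfint k).const_mul ‖c‖
    · ext φ
      simp only [smul_apply, ofFun_apply, smul_eq_mul, mul_assoc]
      exact (integral_const_mul _ _).symm

theorem IsTestFun.exists_mulDist_fourierD_ofFun_eq_ofSchwartz {χ : E n → ℝ} (hχ : IsTestFun χ)
    {f : E n → ℂ} (hf : IsTemperedFun f) (hfint : ∀ k : ℕ, Integrable fun x => ‖x‖ ^ k * ‖f x‖) :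
    ∃ g : 𝓢(E n, ℂ), mulDist χ (fourierD (ofFun f hf)) = ofSchwartz g := by
  have hint : Integrable f :=
    (integrable_norm_iff hf.aestronglyMeasurable).1 (by simpa using hfint 0)
  have hsmooth : ContDiff ℝ ∞ (fourierFun f) :=
    contDiff_infty.2 fun K => contDiff_fourierFun fun k _ => hfint k
  refine ⟨(hχ.ofReal_compact.mul_right (f' := fourierFun f)).toSchwartzMap
    (hχ.ofReal_smooth.mul hsmooth), ?_⟩
  ext φ
  rw [mulDist_apply, fourierD_apply, ofFun_apply, ← integral_fourierFun_mul hint,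
    ofSchwartz_apply]
  refine integral_congr_ae (.of_forall fun x => ?_)
  change fourierFun f x * mulS _ φ x = φ x * ((χ x : ℂ) * fourierFun f x)
  rw [mulS_apply hχ.hasTemperateGrowth]
  ring

theorem mulDist_add_mulDist {f g h : E n → ℝ} (hf : (fun x => (f x : ℂ)).HasTemperateGrowth)
    (hg : (fun x => (g x : ℂ)).HasTemperateGrowth) (hfg : ∀ x, f x + g x = h x)
    (T : 𝓢'(E n, ℂ)) : mulDist f T + mulDist g T = mulDist h T := by
  have hh : (fun x => (h x : ℂ)) = (fun x => (f x : ℂ)) + fun x => (g x : ℂ) :=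
    funext fun x => by simp [← hfg]
  rw [mulDist, mulDist, mulDist, hh, TemperedDistribution.smulLeftCLM_add hf hg, add_apply]

theorem IsCutoff.mulDist_add_mulDist_one_sub {χ : E n → ℝ} (hχ : IsCutoff χ) (T : 𝓢'(E n, ℂ)) :
    mulDist χ T + mulDist (fun x => 1 - χ x) T = T := by
  rw [mulDist_add_mulDist (h := fun _ => 1) hχ.hasTemperateGrowth hχ.isPatch.hasTemperateGrowth
    fun x => add_sub_cancel _ _]
  simp [mulDist]

/-- The tempered distributions given by Schwartz functions, as a subspace. -/
def schwartzDist (n : ℕ) : Submodule ℂ 𝓢'(E n, ℂ) :=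
  LinearMap.range (toTemperedDistributionCLM (E n) ℂ volume).toLinearMap

theorem mem_schwartzDist {T : 𝓢'(E n, ℂ)} : T ∈ schwartzDist n ↔ ∃ g, T = ofSchwartz g :=
  exists_congr fun _ => eq_comm

theorem ofSchwartz_mem_schwartzDist (g : 𝓢(E n, ℂ)) : ofSchwartz g ∈ schwartzDist n :=
  ⟨g, rfl⟩

theorem fourierD_mem_schwartzDist {T : 𝓢'(E n, ℂ)} (hT : T ∈ schwartzDist n) :
    fourierD T ∈ schwartzDist n := by
  obtain ⟨g, rfl⟩ := mem_schwartzDist.1 hT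
  exact fourierD_ofSchwartz g ▸ ofSchwartz_mem_schwartzDist _

theorem fourierD_mem_schwartzDist_iff {T : 𝓢'(E n, ℂ)} :
    fourierD T ∈ schwartzDist n ↔ T ∈ schwartzDist n := by
  refine ⟨fun h => ?_, fourierD_mem_schwartzDist⟩
  have h4 := fourierD_mem_schwartzDist (fourierD_mem_schwartzDist (fourierD_mem_schwartzDist h))
  rw [fourierD_four] at h4
  exact (Submodule.smul_mem_iff _ (pow_ne_zero 2 two_pi_pow_ne_zero)).1 h4

theorem IsTestFun.mulDist_fourierD_mulDist_mem_schwartzDist {ρ χ : E n → ℝ} (hρ : IsTestFun ρ)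
    (hχ : IsTestFun χ) (T : 𝓢'(E n, ℂ)) :
    mulDist ρ (fourierD (mulDist χ T)) ∈ schwartzDist n := by
  have hmem := mulDist_fourierD_mulDist_mem hρ hχ T
  obtain ⟨κ, hκ⟩ := exists_isCutoff n
  obtain ⟨f, hf, hfint, hS⟩ := exists_eq_ofFun_of_mem_localizedFourier hmem
  rw [← fourierD_mem_schwartzDist_iff, ← hκ.mulDist_add_mulDist_one_sub (fourierD _)]
  refine add_mem (mem_schwartzDist.2 ?_) (mem_schwartzDist.2 ?_)
  · exact hS ▸ hκ.isTestFun.exists_mulDist_fourierD_ofFun_eq_ofSchwartz hf hfint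
  · refine exists_mulDist_fourierD_eq_ofSchwartz (fun N => ⟨N + 1, N.lt_succ_self, ?_⟩) hκ.isPatch
    obtain ⟨f', hf', hfint', hS'⟩ := exists_eq_ofFun_of_mem_localizedFourier
      (iterate_negLaplacian_mem_localizedFourier hmem (N + 1))
    exact ⟨f', hf', fun k _ => hfint' k, hS'⟩

theorem mulDist_mem_schwartzDist {f : E n → ℝ} (hf : (fun x => (f x : ℂ)).HasTemperateGrowth)
    {T : 𝓢'(E n, ℂ)} (hT : T ∈ schwartzDist n) : mulDist f T ∈ schwartzDist n := by
  obtain ⟨g, rfl⟩ := mem_schwartzDist.1 hT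
  refine mem_schwartzDist.2 ⟨mulS (fun x => (f x : ℂ)) g, ?_⟩
  ext φ
  simp only [mulDist_apply, ofSchwartz_apply, mulS_apply hf, mul_left_comm, mul_assoc]

/-! ### Smoothness off the origin -/

theorem AgreesOffZero.mulDist_mem_schwartzDist {T : 𝓢'(E n, ℂ)} {w : E n → ℂ}
    (hT : AgreesOffZero T w) (hw : SmoothOffZero w) {ρ : E n → ℝ} (hρ : IsTestFun ρ)
    (h0 : ∀ᶠ x in nhds (0 : E n), ρ x = 0) : mulDist ρ T ∈ schwartzDist n := by
  have h0' : ∀ᶠ x in nhds (0 : E n), (ρ x : ℂ) = 0 := h0.mono fun x hx => by simp [hx]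
  have hg := hρ.hasTemperateGrowth
  let g : 𝓢(E n, ℂ) := (hρ.ofReal_compact.mul_left (f := w)).toSchwartzMap
    (hw.contDiff_mul hρ.ofReal_smooth h0')
  refine mem_schwartzDist.2 ⟨g, ext_of_hasCompactSupport fun φ hφ => ?_⟩
  rw [mulDist_apply, ofSchwartz_apply, hT _ _ (zero_notMem_tsupport_mulS hg h0' φ)]
  · refine integral_congr_ae (.of_forall fun x => ?_)
    change w x * mulS _ φ x = φ x * (w x * ρ x)
    rw [mulS_apply hg]
    ring
  · rw [coe_mulS hg]
    exact hφ.mul_left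

theorem exists_isTestFun_eq_one {K : Set (E n)} (hK : IsCompact K) (h0 : (0 : E n) ∉ K) :
    ∃ ρ : E n → ℝ, IsTestFun ρ ∧ (∀ᶠ x in nhds (0 : E n), ρ x = 0) ∧
      ∀ x ∈ K, ∀ᶠ y in nhds x, ρ y = 1 := by
  obtain ⟨L, hL, hKL, hL0⟩ :=
    exists_compact_between hK isOpen_compl_singleton (Set.subset_compl_singleton_iff.2 h0)
  obtain ⟨f, hf1, hf0, -⟩ :=
    exists_contMDiffMap_one_nhds_of_subset_interior (n := ⊤) (modelWithCornersSelf ℝ (E n))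
      hK.isClosed hKL
  refine ⟨f, ⟨f.contMDiff.contDiff, HasCompactSupport.intro hL hf0⟩, ?_, fun x hx =>
    hf1.filter_mono (nhds_le_nhdsSet hx)⟩
  filter_upwards [hL.isClosed.isOpen_compl.mem_nhds fun h => hL0 h rfl] with x hx
  exact hf0 x hx

theorem eqOn_of_mulDist_eq_ofSchwartz {S : 𝓢'(E n, ℂ)} {ρ ρ' : E n → ℝ} (hρ : IsTestFun ρ)
    (hρ' : IsTestFun ρ') {g g' : 𝓢(E n, ℂ)} (hg : mulDist ρ S = ofSchwartz g)
    (hg' : mulDist ρ' S = ofSchwartz g') {U : Set (E n)} (hU : IsOpen U) (h : Set.EqOn ρ ρ' U) :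
    Set.EqOn g g' U := by
  refine eqOn_of_integral_mul_schwartz_eq hU g.continuous.continuousOn g'.continuous.continuousOn
    fun φ _ hφ => ?_
  have hmul : mulS (fun x => (ρ x : ℂ)) φ = mulS (fun x => (ρ' x : ℂ)) φ := by
    ext x
    rw [mulS_apply hρ.hasTemperateGrowth, mulS_apply hρ'.hasTemperateGrowth]
    by_cases hx : x ∈ tsupport φ
    · rw [h (hφ hx)]
    · rw [image_eq_zero_of_notMem_tsupport hx, mul_zero, mul_zero]
  simp only [mul_comm _ (φ _)]
  rw [← ofSchwartz_apply, ← hg, mulDist_apply, hmul, ← mulDist_apply, hg', ofSchwartz_apply]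

theorem exists_agreesOffZero_of_mulDist_mem_schwartzDist {S : 𝓢'(E n, ℂ)}
    (h : ∀ ρ : E n → ℝ, IsTestFun ρ → (∀ᶠ x in nhds (0 : E n), ρ x = 0) →
      mulDist ρ S ∈ schwartzDist n) :
    ∃ v : E n → ℂ, SmoothOffZero v ∧ AgreesOffZero S v := by
  choose! g hg using fun ρ hρ h0 => mem_schwartzDist.1 (h ρ hρ h0)
  choose! ρ hρ hρ0 hρ1 using fun (x : E n) (hx : x ≠ 0) =>
    exists_isTestFun_eq_one (isCompact_singleton (x := x)) hx.symm
  have hlocal {σ : E n → ℝ} (hσ : IsTestFun σ) (hσ0 : ∀ᶠ x in nhds (0 : E n), σ x = 0) {x : E n}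
      (hx : x ≠ 0) (hσ1 : ∀ᶠ y in nhds x, σ y = 1) : g (ρ x) x = g σ x :=
    eqOn_of_mulDist_eq_ofSchwartz (hρ x hx) hσ (hg _ (hρ x hx) (hρ0 x hx)) (hg σ hσ hσ0)
      (isOpen_setOfPred_eventually_nhds (p := fun y => ρ x y = 1 ∧ σ y = 1))
      (fun y hy => hy.self_of_nhds.1.trans hy.self_of_nhds.2.symm)
      ((hρ1 x hx x rfl).and hσ1)
  refine ⟨fun x => g (ρ x) x, fun x hx => ContDiffAt.contDiffWithinAt ?_, fun φ hc h0 => ?_⟩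
  · refine ((g (ρ x)).smooth ⊤).contDiffAt.congr_of_eventuallyEq ?_
    filter_upwards [(hρ1 x hx x rfl).eventually_nhds, isOpen_compl_singleton.mem_nhds hx]
      with y hy hy0
    exact hlocal (hρ x hx) (hρ0 x hx) hy0 hy
  · obtain ⟨σ, hσ, hσ0, hσ1⟩ := exists_isTestFun_eq_one hc h0
    have hφ : mulS (fun x => (σ x : ℂ)) φ = φ := by
      ext x
      rw [mulS_apply hσ.hasTemperateGrowth]
      by_cases hx : x ∈ tsupport φ
      · rw [(hσ1 x hx).self_of_nhds, Complex.ofReal_one, one_mul]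
      · rw [image_eq_zero_of_notMem_tsupport hx, mul_zero]
    rw [← hφ, ← mulDist_apply, hg σ hσ hσ0, ofSchwartz_apply, hφ]
    refine integral_congr_ae (.of_forall fun x => ?_)
    by_cases hx : x ∈ tsupport φ
    · simp only [hlocal hσ hσ0 (ne_of_mem_of_not_mem hx h0) (hσ1 x hx), mul_comm]
    · simp only [image_eq_zero_of_notMem_tsupport hx, mul_zero, zero_mul]

/-! ### The spaces `ℋ_s` -/

theorem IsLogHomogDist.isLogHomogFun {s : ℝ} {T S : 𝓢'(E n, ℂ)}
    (h : IsLogHomogDist s T S) {w q : E n → ℂ} (hT : AgreesOffZero T w)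
    (hS : AgreesOffZero S q) (hw : SmoothOffZero w)
    (hq : SmoothOffZero q) : IsLogHomogFun s w q := by
  intro x hx t ht
  have hw' : SmoothOffZero fun x => w (t • x) :=
    hw.comp (contDiff_const_smul t).contDiffOn fun y hy => smul_ne_zero ht.ne' hy
  have hq' : SmoothOffZero fun x => (Real.log t : ℂ) * q x := contDiffOn_const.mul hq
  have hagree := (hT.add (hS.const_smul (Real.log t : ℂ)) hw hq').const_smul ((t ^ s : ℝ) : ℂ)
  rw [← h t ht] at hagree
  exact (hT.dil ht).eq_of_ne_zero hagree hw' (contDiffOn_const.mul (hw.add hq')) hx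

theorem mem_mulHomogSpace_iff {s : ℝ} {f : E n → ℝ} {T : 𝓢'(E n, ℂ)} :
    T ∈ mulHomogSpace n f s ↔ ∃ v ∈ homogSpace n s, T - mulDist f v ∈ schwartzDist n :=
  exists_congr fun v => and_congr_right fun _ => by
    simp only [mem_schwartzDist, sub_eq_iff_eq_add']

section homogSpace

variable [NeZero n] {s : ℝ}

theorem exists_isSphereMoment_isProlongation {u : E n → ℂ} (hu : SmoothOffZero u)
    (hu' : IsHomogFun s u) :
    ∃ Q, IsSphereMoment s u Q ∧ (∃ T, IsProlongation s u T) ∧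
      ∀ T, IsProlongation s u T → IsLogHomogDist s T (polyDelta Q) := by
  obtain ⟨T, Q, hT, hQ, hTQ⟩ := exists_agreesOffZero_isLogHomogDist s hu hu'
  exact ⟨Q, hQ, ⟨T, hTQ.isProlongation hQ.isHomogPoly hT⟩, fun _ h =>
    h.isLogHomogDist hu hQ.isHomogPoly hT hTQ⟩

theorem mem_homogSpace_iff {T : 𝓢'(E n, ℂ)} :
    T ∈ homogSpace n s ↔ ∃ (w : E n → ℂ) (Q P : MvPolynomial (Fin n) ℂ), SmoothOffZero w ∧
      AgreesOffZero T w ∧ IsHomogPoly s Q ∧ IsHomogPoly (-(n : ℝ) - s) P ∧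
      IsLogHomogDist s T (polyDist Q + polyDelta P) := by
  constructor
  · rintro ⟨U, V, Q, P, hU, hU', hV, hQ, hP, rfl⟩
    obtain ⟨P', hP', -, hlog⟩ := exists_isSphereMoment_isProlongation hU hU'
    have hVQ := (hlog V hV).add (isLogHomogDist_polyLog hQ)
    have hδ : IsHomogDist s (polyDelta P) := fun t ht => dil_polyDelta hP t ht
    refine ⟨_, Q, P', (hU.add (smoothOffZero_polyEval_mul_log Q)).add contDiffOn_const,
      (hV.agrees.add (agreesOffZero_polyLog Q) hU (smoothOffZero_polyEval_mul_log Q)).add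
        (agreesOffZero_polyDelta P) (hU.add (smoothOffZero_polyEval_mul_log Q)) contDiffOn_const,
      hQ, hP'.isHomogPoly, ?_⟩
    rw [add_comm (polyDist Q), ← add_zero (polyDelta P' + polyDist Q)]
    exact hVQ.add hδ.isLogHomogDist
  · rintro ⟨w, Q, P, hw, hT, hQ, hP, h⟩
    have hlog := smoothOffZero_polyEval_mul_log Q
    have hU := hT.add ((agreesOffZero_polyLog Q).const_smul (-1)) hw
      (contDiffOn_const.mul hlog)
    have hUP := h.add ((isLogHomogDist_polyLog hQ).const_smul (-1))
    rw [show polyDist Q + polyDelta P + (-1 : ℂ) • polyDist Q = polyDelta P by module] at hUP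
    have hsmooth := hw.add ((contDiffOn_const (c := (-1 : ℂ))).mul hlog)
    refine ⟨_, _, Q, 0, hsmooth, fun x hx t ht => ?_, hUP.isProlongation hP hU, hQ,
      (homogPoly n _).zero_mem, ?_⟩
    · simpa [mul_add] using
        hUP.isLogHomogFun hU (agreesOffZero_polyDelta P) hsmooth contDiffOn_const x hx t ht
    · rw [isLinearMap_polyDelta.map_zero]
      module

theorem smul_mem_homogSpace {T : 𝓢'(E n, ℂ)} (hT : T ∈ homogSpace n s) (c : ℂ) :
    c • T ∈ homogSpace n s := by
  obtain ⟨w, Q, P, hw, hT, hQ, hP, h⟩ := mem_homogSpace_iff.1 hT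
  refine mem_homogSpace_iff.2 ⟨_, c • Q, c • P, contDiffOn_const.mul hw, hT.const_smul c,
    (homogPoly n _).smul_mem _ hQ, (homogPoly n _).smul_mem _ hP, ?_⟩
  rw [isLinearMap_polyDist.map_smul, isLinearMap_polyDelta.map_smul, ← smul_add]
  exact h.const_smul c

theorem exists_isSymbol_mulDist_eq_ofFun {T : 𝓢'(E n, ℂ)} (hT : T ∈ homogSpace n s) {θ : E n → ℝ}
    (hθ : IsPatch θ) : ∃ (m : ℝ) (f : E n → ℂ) (hf : IsSymbol m f),
      mulDist θ T = ofFun f hf.isTemperedFun := by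
  obtain ⟨w, Q, P, hw, hT, -, -, h⟩ := mem_homogSpace_iff.1 hT
  have hQ : SmoothOffZero (polyEval Q) := (hasTemperateGrowth_polyEval Q).1.contDiffOn
  have hS := (agreesOffZero_polyDist Q).add (agreesOffZero_polyDelta P) hQ contDiffOn_const
  have hsymb := (h.isLogHomogFun hT (add_zero (polyEval Q) ▸ hS) hw hQ).isSymbol_patch_mul hw hQ hθ
  exact ⟨_, _, hsymb, hT.mulDist_eq_ofFun hθ _⟩

theorem mulDist_fourierD_mulDist_mem_schwartzDist {T : 𝓢'(E n, ℂ)} (hT : T ∈ homogSpace n s)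
    {θ θ' : E n → ℝ} (hθ : IsPatch θ) (hθ' : IsPatch θ') :
    mulDist θ' (fourierD (mulDist θ T)) ∈ schwartzDist n := by
  obtain ⟨m, f, hf, hfT⟩ := exists_isSymbol_mulDist_eq_ofFun hT hθ
  exact mem_schwartzDist.2 (hfT ▸ hf.exists_mulDist_fourierD_eq_ofSchwartz hθ')

theorem exists_agreesOffZero_fourierD {T : 𝓢'(E n, ℂ)} (hT : T ∈ homogSpace n s) :
    ∃ v : E n → ℂ, SmoothOffZero v ∧ AgreesOffZero (fourierD T) v := by
  obtain ⟨χ, hχ⟩ := exists_isCutoff n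
  refine exists_agreesOffZero_of_mulDist_mem_schwartzDist fun ρ hρ h0 => ?_
  obtain ⟨κ, hκ, hκρ⟩ := exists_isCutoff_of_mem_nhds h0
  have hρκ (x : E n) : ρ x * (1 - κ x) = ρ x := by
    by_cases hx : ρ x = 0
    · rw [hx, zero_mul]
    · rw [hκρ x hx, sub_zero, mul_one]
  rw [← hχ.mulDist_add_mulDist_one_sub T, isLinearMap_fourierD.map_add,
    (isLinearMap_mulDist ρ).map_add]
  refine add_mem (hρ.mulDist_fourierD_mulDist_mem_schwartzDist hχ.isTestFun T) ?_
  rw [← mulDist_mulDist hρ.hasTemperateGrowth hκ.isPatch.hasTemperateGrowth hρκ]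
  exact mulDist_mem_schwartzDist hρ.hasTemperateGrowth
    (mulDist_fourierD_mulDist_mem_schwartzDist hT hχ.isPatch hκ.isPatch)

theorem fourierD_mem_homogSpace {T : 𝓢'(E n, ℂ)} (hT : T ∈ homogSpace n s) :
    fourierD T ∈ homogSpace n (-(n : ℝ) - s) := by
  obtain ⟨v, hv, hTv⟩ := exists_agreesOffZero_fourierD hT
  obtain ⟨w, Q, P, -, -, hQ, hP, h⟩ := mem_homogSpace_iff.1 hT
  obtain ⟨c, hc⟩ := fourierD_polyDist hQ
  refine mem_homogSpace_iff.2 ⟨v, -P, -(c • Q), hv, hTv, (homogPoly n _).neg_mem hP,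
    (homogPoly n _).neg_mem ((homogPoly n _).smul_mem c ?_), ?_⟩
  · rwa [sub_sub_cancel]
  · have hF := h.fourierD
    rwa [isLinearMap_fourierD.map_add, hc, fourierD_polyDelta, neg_add_rev,
      ← isLinearMap_polyDist.map_neg, ← isLinearMap_polyDelta.map_smul,
      ← isLinearMap_polyDelta.map_neg] at hF

theorem fourierD_mem_homogSpace_iff {T : 𝓢'(E n, ℂ)} :
    fourierD T ∈ homogSpace n (-(n : ℝ) - s) ↔ T ∈ homogSpace n s := by
  refine ⟨fun h => ?_, fourierD_mem_homogSpace⟩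
  have h4 := fourierD_mem_homogSpace (fourierD_mem_homogSpace (fourierD_mem_homogSpace h))
  rw [fourierD_four, sub_sub_cancel, sub_sub_cancel] at h4
  have hc := smul_mem_homogSpace h4 ((((2 * Real.pi) ^ n : ℝ) : ℂ) ^ 2)⁻¹
  rwa [inv_smul_smul₀ (pow_ne_zero 2 two_pi_pow_ne_zero)] at hc

theorem fourierD_mulDist_sub_mulDist_fourierD_mem_schwartzDist {T : 𝓢'(E n, ℂ)}
    (hT : T ∈ homogSpace n s) {θ χ : E n → ℝ} (hθ : IsPatch θ) (hχ : IsCutoff χ) :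
    fourierD (mulDist θ T) - mulDist χ (fourierD T) ∈ schwartzDist n := by
  obtain ⟨κ, hκ, hθκ⟩ := id hθ
  obtain rfl : θ = fun x => 1 - κ x := funext hθκ
  have hpatch := mulDist_fourierD_mulDist_mem_schwartzDist hT hθ hχ.isPatch
  have hcutoff := hχ.isTestFun.mulDist_fourierD_mulDist_mem_schwartzDist hκ.isTestFun T
  have hθT := hχ.mulDist_add_mulDist_one_sub (fourierD (mulDist (fun x => 1 - κ x) T))
  have hFT := congrArg (mulDist χ) (congrArg fourierD (hκ.mulDist_add_mulDist_one_sub T))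
  rw [isLinearMap_fourierD.map_add, (isLinearMap_mulDist χ).map_add] at hFT
  rw [← hFT, add_comm]
  nth_rewrite 1 [← hθT]
  rw [add_sub_add_left_eq_sub]
  exact sub_mem hpatch hcutoff

theorem fourierD_mem_mulHomogSpace_iff {θ χ : E n → ℝ} (hθ : IsPatch θ) (hχ : IsCutoff χ)
    {T : 𝓢'(E n, ℂ)} :
    fourierD T ∈ mulHomogSpace n χ (-(n : ℝ) - s) ↔ T ∈ mulHomogSpace n θ s := by
  rw [mem_mulHomogSpace_iff, mem_mulHomogSpace_iff, fourierD_surjective.exists]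
  refine exists_congr fun v => ?_
  rw [fourierD_mem_homogSpace_iff]
  refine and_congr_right fun hv => ?_
  have hdiff := fourierD_mulDist_sub_mulDist_fourierD_mem_schwartzDist hv hθ hχ
  rw [← fourierD_mem_schwartzDist_iff (T := T - mulDist θ v), isLinearMap_fourierD.map_sub,
    ← sub_sub_sub_cancel_right (fourierD T) (fourierD (mulDist θ v)) (mulDist χ (fourierD v)),
    (schwartzDist n).sub_mem_iff_left hdiff]

theorem bijOn_fourierD_mulHomogSpace {θ χ : E n → ℝ} (hθ : IsPatch θ) (hχ : IsCutoff χ) :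
    Set.BijOn fourierD (mulHomogSpace n θ s) (mulHomogSpace n χ (-(n : ℝ) - s)) := by
  refine ⟨fun T => (fourierD_mem_mulHomogSpace_iff hθ hχ).2, fourierD_injective.injOn, ?_⟩
  intro S hS
  obtain ⟨T, rfl⟩ := fourierD_surjective S
  exact ⟨T, (fourierD_mem_mulHomogSpace_iff hθ hχ).1 hS, rfl⟩

theorem mulHomogSpace_eq {f f' ρ : E n → ℝ} (hf' : (fun x => (f' x : ℂ)).HasTemperateGrowth)
    (hρ : IsTestFun ρ) (h0 : ∀ᶠ x in nhds (0 : E n), ρ x = 0) (h : ∀ x, f' x + ρ x = f x) :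
    mulHomogSpace n f s = mulHomogSpace n f' s := by
  ext T
  rw [mem_mulHomogSpace_iff, mem_mulHomogSpace_iff]
  refine exists_congr fun v => and_congr_right fun hv => ?_
  obtain ⟨w, -, -, hw, hv, -⟩ := mem_homogSpace_iff.1 hv
  rw [← mulDist_add_mulDist hf' hρ.hasTemperateGrowth h, ← sub_sub]
  exact (schwartzDist n).sub_mem_iff_left (hv.mulDist_mem_schwartzDist hw hρ h0)

theorem IsCutoff.mulHomogSpace_eq {χ χ' : E n → ℝ} (hχ : IsCutoff χ) (hχ' : IsCutoff χ') :
    mulHomogSpace n χ s = mulHomogSpace n χ' s := by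
  refine HomogDistr.mulHomogSpace_eq (ρ := fun x => χ x - χ' x) hχ'.hasTemperateGrowth
    ⟨hχ.smooth.sub hχ'.smooth, hχ.compact.sub hχ'.compact⟩ ?_ fun x => add_sub_cancel _ _
  filter_upwards [hχ.eq_one, hχ'.eq_one] with x h h'
  rw [h, h', sub_self]

theorem IsPatch.mulHomogSpace_eq {θ θ' : E n → ℝ} (hθ : IsPatch θ) (hθ' : IsPatch θ') :
    mulHomogSpace n θ s = mulHomogSpace n θ' s := by
  have hθ'_growth := hθ'.hasTemperateGrowth
  obtain ⟨χ, hχ, h⟩ := hθ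
  obtain ⟨χ', hχ', h'⟩ := hθ'
  refine HomogDistr.mulHomogSpace_eq (ρ := fun x => χ' x - χ x) hθ'_growth
    ⟨hχ'.smooth.sub hχ.smooth, hχ'.compact.sub hχ.compact⟩ ?_ fun x => by rw [h, h']; ring
  filter_upwards [hχ.eq_one, hχ'.eq_one] with x h h'
  rw [h, h', sub_self]

/-! ### Prolongations and their Fourier transforms -/

variable {u : E n → ℂ} {T : 𝓢'(E n, ℂ)}

theorem IsProlongation.mem_homogSpace (hT : IsProlongation s u T) (hu : SmoothOffZero u)
    (hu' : IsHomogFun s u) : T ∈ homogSpace n s := by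
  obtain ⟨Q, hQ, -, hlog⟩ := exists_isSphereMoment_isProlongation hu hu'
  refine mem_homogSpace_iff.2 ⟨u, 0, Q, hu, hT.agrees, (homogPoly n _).zero_mem,
    hQ.isHomogPoly, ?_⟩
  rw [isLinearMap_polyDist.map_zero, zero_add]
  exact hlog T hT

theorem IsLogHomogDist.isHomogDist_fourierD_add_polyLog {Q : MvPolynomial (Fin n) ℂ}
    (hQ : IsHomogPoly (-(n : ℝ) - s) Q) (h : IsLogHomogDist s T (polyDelta Q)) :
    IsHomogDist (-(n : ℝ) - s) (HomogDistr.fourierD T + polyLog Q) := by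
  have hadd := h.fourierD.add (isLogHomogDist_polyLog hQ)
  rw [fourierD_polyDelta, neg_add_cancel] at hadd
  exact hadd.isHomogDist

theorem exists_agreesOffZero_fourierD_add_polyLog (hT : T ∈ homogSpace n s)
    (Q : MvPolynomial (Fin n) ℂ) :
    ∃ v : E n → ℂ, SmoothOffZero v ∧ AgreesOffZero (fourierD T + polyLog Q) v := by
  obtain ⟨v, hv, hTv⟩ := exists_agreesOffZero_fourierD hT
  exact ⟨_, hv.add (smoothOffZero_polyEval_mul_log Q),
    hTv.add (agreesOffZero_polyLog Q) hv (smoothOffZero_polyEval_mul_log Q)⟩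

theorem IsProlongation.exists_fourierD_ofFun_eq (hT : IsProlongation s u T)
    (hu : SmoothOffZero u) (hu' : IsHomogFun s u) {θ χ : E n → ℝ} (hθ : IsPatch θ)
    (hχ : IsCutoff χ) :
    ∃ (hθu : IsTemperedFun fun x => (θ x : ℂ) * u x) (g : 𝓢(E n, ℂ)),
      fourierD (ofFun (fun x => (θ x : ℂ) * u x) hθu) =
        mulDist χ (fourierD T) + ofSchwartz g := by
  have hθu := hu'.isLogHomogFun.isSymbol_patch_mul hu contDiffOn_const hθ
  obtain ⟨g, hg⟩ := mem_schwartzDist.1 (fourierD_mulDist_sub_mulDist_fourierD_mem_schwartzDist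
    (hT.mem_homogSpace hu hu') hθ hχ)
  refine ⟨hθu.isTemperedFun, g, ?_⟩
  rw [← hT.agrees.mulDist_eq_ofFun hθ, ← hg, add_sub_cancel]

end homogSpace

end HomogDistr

end

open HomogDistr

theorem proposition4 (n : ℕ) (hn : 1 ≤ n) (s : ℝ) :
    -- part (i)
    (∀ u : E n → ℂ, SmoothOffZero u → IsHomogFun s u →
      (∃ T : 𝓢'(E n, ℂ), IsProlongation s u T) ∧
      ∃ Q : MvPolynomial (Fin n) ℂ, IsHomogPoly (-(n : ℝ) - s) Q ∧
        (∀ k : ℕ, (k : ℝ) = -(n : ℝ) - s → ∀ ξ : E n, polyEval Q ξ = sphereInt k u ξ) ∧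
        ∀ T : 𝓢'(E n, ℂ), IsProlongation s u T →
          ∃ U : 𝓢'(E n, ℂ), fourierD T = U - polyLog Q ∧
            IsHomogDist (-(n : ℝ) - s) U ∧
            (∃ v : E n → ℂ, SmoothOffZero v ∧ AgreesOffZero U v) ∧
            ∀ θ χ : E n → ℝ, IsPatch θ → IsCutoff χ →
              ∃ (hθ : IsTemperedFun (fun x => (θ x : ℂ) * u x)) (g : 𝓢(E n, ℂ)),
                fourierD (ofFun (fun x => (θ x : ℂ) * u x) hθ) =
                  mulDist χ (U - polyLog Q) + ofSchwartz g) ∧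
    -- part (ii)
    (∀ θ χ : E n → ℝ, IsPatch θ → IsCutoff χ →
      Set.BijOn fourierD (mulHomogSpace n θ s) (mulHomogSpace n χ (-(n : ℝ) - s))) ∧
    -- the spaces do not depend on the choice of the patch function and of the cutoff function
    (∀ θ θ' : E n → ℝ, IsPatch θ → IsPatch θ' → mulHomogSpace n θ s = mulHomogSpace n θ' s) ∧
    (∀ χ χ' : E n → ℝ, IsCutoff χ → IsCutoff χ' →
      mulHomogSpace n χ s = mulHomogSpace n χ' s) := by
  have : NeZero n := ⟨by omega⟩
  refine ⟨fun u hu hu' => ?_, fun θ χ => bijOn_fourierD_mulHomogSpace,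
    fun θ θ' => IsPatch.mulHomogSpace_eq, fun χ χ' => IsCutoff.mulHomogSpace_eq⟩
  obtain ⟨Q, hQ, hexists, hlog⟩ := exists_isSphereMoment_isProlongation hu hu'
  refine ⟨hexists, Q, hQ.isHomogPoly, hQ.eval_eq, fun T hT => ⟨fourierD T + polyLog Q,
    (add_sub_cancel_right _ _).symm,
    (hlog T hT).isHomogDist_fourierD_add_polyLog hQ.isHomogPoly,
    exists_agreesOffZero_fourierD_add_polyLog (hT.mem_homogSpace hu hu') Q,
    fun θ χ hθ hχ => ?_⟩⟩
  rw [add_sub_cancel_right]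
  exact hT.exists_fourierD_ofFun_eq hu hu' hθ hχ
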